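/- **Setting.** Let $H^n=H^n(\mathbb R)$ be the real Sobolev spaces over $L^2(\mathbb R)$, with $\|f\|_{H^1}^2=\|f\|_{L^2}^2+\|f'\|_{L^2}^2$ and $\|f\|_{H^2}^2=\|f\|_{H^1}^2+\|f'\|_{H^1}^2$, and let $Q=(1-\partial_x^2)^{1/2}$ (Fourier multiplier). For $w\in H^1$ put $A(w)f=a\,\partial_xf+b\,f$, $f\in H^2$, with $a=Q^{-2}w$ and $b=2\,\partial_xQ^{-2}w$. Let $\xi\in C_b^4(\mathbb R)$ and $\eta\in C_b^3(\mathbb R)$ be real functions ($C_b^n$: $n$ times continuously differentiable, all derivatives up to order $n$ bounded), let $\varphi_t$ be the flow of the vector field $\xi\partial_x$, and let $U_t$, $t\in\mathbb R$, be the one-parameter group $$[U_tf](x)=e^{c(t,x)}f(\varphi_{-t}(x)),\qquad c(t,x)=\int_0^t\eta(\varphi_{s-t}(x))\,ds,\qquad U_t^{-1}=U_{-t}.$$ For $t\in\mathbb R$ and $v\in H^2$ let $\widehat A(t,v)$ be the closure in $H^1$ of the operator $U_tA(U_t^{-1}v)U_t^{-1}$ with domain $H^2$. **Theorem.** Let $\tau,R>0$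 and $I=[-\tau,\tau]$. The family $\widehat A(t,v)$, $t\in I$, $v\in H^2$, satisfies Kato's condition with $X=H^1$, $Y=H^2$, radius $R$ and the above $Q$; that is, $H^2$ is densely embedded in $H^1$ and contained in the domain of every $\widehat A(t,v)$, $Q:H^2\to H^1$ is an isomorphism, and: 1. for all $t\in I$, $v\in H^2$ the operator $-\widehat A(t,v)$ generates a $C_0$-semigroup $e^{-s\widehat A(t,v)}$ in $H^1$, and there is $\beta\in\mathbb R$ such that $\|e^{-s\widehat A(t,v)}\|_{\mathcal L(H^1)}\le e^{\beta s}$ for all $s\ge0$, $t\in I$ and $\|v\|_{H^2}\le R$; 2. there are $B(t,v)\in\mathcal L(H^1)$ such that $Q\widehat A(t,v)Q^{-1}=\widehat A(t,v)+B(t,v)$ for all $t\in I$, $v\in H^2$ (equality of unbounded operators in $H^1$, including their domains), the map $I\ni t\mapsto B(t,v)\in\mathcal L(H^1)$ is strongly measurable for every $v\in H^2$, and $\sup_{t\in I}\sup_{\|v\|_{H^2}\le R}\|B(t,v)\|_{\mathcal L(H^1)}<\infty$; 3. for all $v\in H^2$ one has $\widehat A(t,v)\in\mathcal L(H^2,H^1)$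 for $t\in I$, and $I\ni t\mapsto\widehat A(t,v)\in\mathcal L(H^2,H^1)$ is continuous in the operator norm; 4. there is $\mu$ such that $\|(\widehat A(t,v_1)-\widehat A(t,v_2))u\|_{H^1}\le\mu\,\|v_1-v_2\|_{H^1}\|u\|_{H^2}$ for all $t\in I$, $u\in H^2$ and $\|v_1\|_{H^2},\|v_2\|_{H^2}\le R$. -/

import Mathlib

open MeasureTheory Filter Topology Set
open scoped ContDiff FourierTransform

noncomputable section

namespace StochCH

/-! ### Real Sobolev spaces on the line -/

/-- The real Hilbert space `L²(ℝ)`. -/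
abbrev L2 : Type := Lp ℝ 2 (volume : Measure ℝ)

/-- `g` is the weak derivative of `f`. -/
def IsWeakDeriv (f g : L2) : Prop :=
  ∀ θ : ℝ → ℝ, ContDiff ℝ ∞ θ → HasCompactSupport θ →
    ∫ x, f x * deriv θ x = -∫ x, g x * θ x

theorem integrable_mul_test (f : L2) {θ : ℝ → ℝ} (h : Continuous θ) (hc : HasCompactSupport θ) :
    Integrable (fun x => f x * θ x) :=
  (Lp.memLp f).integrable_mul (q := 2) (h.memLp_of_hasCompactSupport hc)

theorem continuous_deriv_test {θ : ℝ → ℝ} (h : ContDiff ℝ ∞ θ) : Continuous (deriv θ) :=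
  h.continuous_deriv (by simp)

theorem IsWeakDeriv.zero : IsWeakDeriv 0 0 := by
  intro θ _ _
  have h0 : ((0 : L2) : ℝ → ℝ) =ᵐ[volume] 0 := Lp.coeFn_zero _ _ _
  have h1 : ∀ ψ : ℝ → ℝ, ∫ x, (0 : L2) x * ψ x = 0 := by
    intro ψ
    rw [integral_congr_ae (g := fun _ => (0 : ℝ))]
    · simp
    · filter_upwards [h0] with x hx
      rw [hx, Pi.zero_apply, zero_mul]
  rw [h1, h1, neg_zero]

theorem IsWeakDeriv.add {f g f' g' : L2} (h : IsWeakDeriv f f') (k : IsWeakDeriv g g') :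
    IsWeakDeriv (f + g) (f' + g') := by
  intro θ hθ hc
  have key : ∀ (p q : L2) (ψ : ℝ → ℝ), Continuous ψ → HasCompactSupport ψ →
      ∫ x, (p + q : L2) x * ψ x = (∫ x, p x * ψ x) + ∫ x, q x * ψ x := by
    intro p q ψ h1 h2
    rw [← integral_add (integrable_mul_test p h1 h2) (integrable_mul_test q h1 h2)]
    refine integral_congr_ae ?_
    filter_upwards [Lp.coeFn_add p q] with x hx
    rw [hx, Pi.add_apply, add_mul]
  rw [key f g _ (continuous_deriv_test hθ) hc.deriv, key f' g' _ hθ.continuous hc,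
    h θ hθ hc, k θ hθ hc]
  ring

theorem IsWeakDeriv.smul {f f' : L2} (c : ℝ) (h : IsWeakDeriv f f') :
    IsWeakDeriv (c • f) (c • f') := by
  intro θ hθ hc
  have key : ∀ (p : L2) (ψ : ℝ → ℝ), ∫ x, (c • p : L2) x * ψ x = c * ∫ x, p x * ψ x := by
    intro p ψ
    rw [← integral_const_mul]
    refine integral_congr_ae ?_
    filter_upwards [Lp.coeFn_smul c p] with x hx
    rw [hx, Pi.smul_apply, smul_eq_mul, mul_assoc]
  rw [key, key, h θ hθ hc]
  ring

/-- The pairs `(f, f')` of an `L²` function and its weak derivative in `L²`. -/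
def H1sub : Submodule ℝ (WithLp 2 (L2 × L2)) where
  carrier := {p | IsWeakDeriv p.fst p.snd}
  zero_mem' := IsWeakDeriv.zero
  add_mem' h k := IsWeakDeriv.add h k
  smul_mem' c _ h := IsWeakDeriv.smul c h

/-- The Sobolev space `H¹(ℝ)`: an element is an `L²` function `f` together with its weak derivative
`f'` in `L²`; the norm is `‖f‖² = ‖f‖_{L²}² + ‖f'‖_{L²}²`. -/
def H1 : Type := H1sub

instance : NormedAddCommGroup H1 := inferInstanceAs (NormedAddCommGroup H1sub)

instance : InnerProductSpace ℝ H1 := inferInstanceAs (InnerProductSpace ℝ H1sub)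

/-- The pairs `(f, f')` of elements of `H¹` such that `f'` is the weak derivative of `f`. -/
def H2sub : Submodule ℝ (WithLp 2 (H1 × H1)) where
  carrier := {p | p.fst.1.snd = p.snd.1.fst}
  zero_mem' := rfl
  add_mem' {p q} h k := by
    change p.fst.1.snd + q.fst.1.snd = p.snd.1.fst + q.snd.1.fst
    rw [show p.fst.1.snd = p.snd.1.fst from h, show q.fst.1.snd = q.snd.1.fst from k]
  smul_mem' c p h := by
    change c • p.fst.1.snd = c • p.snd.1.fst
    rw [show p.fst.1.snd = p.snd.1.fst from h]

/-- The Sobolev space `H²(ℝ)`: an element is an `f ∈ H¹` together with its weak derivative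
`f' ∈ H¹`; the norm is `‖f‖² = ‖f‖_{H¹}² + ‖f'‖_{H¹}²`, that is
`‖f‖_{L²}² + 2 ‖f'‖_{L²}² + ‖f''‖_{L²}²`, for which `(1 - ∂ₓ²)^{1/2} : H² → H¹` is isometric. -/
def H2 : Type := H2sub

instance : NormedAddCommGroup H2 := inferInstanceAs (NormedAddCommGroup H2sub)

instance : InnerProductSpace ℝ H2 := inferInstanceAs (InnerProductSpace ℝ H2sub)

/-- The embedding of `H²` into `H¹`. -/
def incl : H2 →L[ℝ] H1 :=
  (WithLp.fstL 2 ℝ H1 H1).comp H2sub.subtypeL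

/-- Differentiation `∂ₓ : H² → H¹`. -/
def dx : H2 →L[ℝ] H1 :=
  (WithLp.sndL 2 ℝ H1 H1).comp H2sub.subtypeL

theorem locallyIntegrable_L2 (f : L2) : LocallyIntegrable f volume :=
  (Lp.memLp f).locallyIntegrable (by norm_num)

theorem integral_primitive_mul_deriv (g : L2) {θ : ℝ → ℝ} (hθ : ContDiff ℝ ∞ θ)
    (hc : HasCompactSupport θ) :
    ∫ x, (∫ y in (0 : ℝ)..x, g y) * deriv θ x = -∫ x, g x * θ x := by
  have hloc := locallyIntegrable_L2 g
  have hint : ∀ a b, IntervalIntegrable g volume a b := fun a b =>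
    intervalIntegrable_iff.mpr
      ((hloc.integrableOn_isCompact isCompact_uIcc).mono_set uIoc_subset_uIcc)
  obtain ⟨M, hM⟩ : ∃ M : ℝ, ∀ x, M ≤ |x| → θ x = 0 := by
    obtain ⟨M, hM⟩ := hc.isCompact.isBounded.subset_closedBall (0 : ℝ)
    refine ⟨M + 1, fun x hx => ?_⟩
    by_contra h
    have := hM (subset_tsupport θ h)
    rw [Metric.mem_closedBall, dist_zero_right, Real.norm_eq_abs] at this
    linarith
  set N : ℝ := |M| + 1 with hN
  have hN0 : 0 ≤ N := by positivity
  have hMN : M < N := lt_of_le_of_lt (le_abs_self M) (by linarith)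
  have hθ0 : ∀ x, x ∉ Ioc (-N) N → θ x = 0 := by
    intro x hx
    apply hM
    by_contra h
    push Not at h
    obtain ⟨h1, h2⟩ := abs_lt.1 (h.trans hMN)
    exact hx ⟨h1, h2.le⟩
  have hθ'0 : ∀ x, x ∉ Ioc (-N) N → deriv θ x = 0 := by
    intro x hx
    have hMx : M < |x| := by
      by_contra h
      push Not at h
      obtain ⟨h1, h2⟩ := abs_lt.1 (h.trans_lt hMN)
      exact hx ⟨h1, h2.le⟩
    have : θ =ᶠ[𝓝 x] fun _ => 0 := by
      filter_upwards [continuous_abs.continuousAt.eventually (lt_mem_nhds hMx)] with y hy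
      exact hM y (le_of_lt hy)
    rw [this.deriv_eq, deriv_const]
  have hG : AbsolutelyContinuousOnInterval (fun x => ∫ y in (0 : ℝ)..x, g y) (-N) N :=
    (hint (-N) N).absolutelyContinuousOnInterval_intervalIntegral
      (by rw [uIcc_of_le (by linarith)]; exact ⟨by linarith, hN0⟩)
  have hT : AbsolutelyContinuousOnInterval θ (-N) N :=
    ContDiffOn.absolutelyContinuousOnInterval ((hθ.of_le (by simp)).contDiffOn)
  have hparts := hG.integral_mul_deriv_eq_deriv_mul hT
  have e1 : θ N = 0 := hM N (by rw [abs_of_nonneg hN0]; exact hMN.le)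
  have e2 : θ (-N) = 0 := hM (-N) (by rw [abs_neg, abs_of_nonneg hN0]; exact hMN.le)
  rw [e1, e2, mul_zero, mul_zero, sub_zero, zero_sub] at hparts
  have hle : -N ≤ N := by linarith
  rw [intervalIntegral.integral_of_le hle, intervalIntegral.integral_of_le hle,
    setIntegral_eq_integral_of_forall_compl_eq_zero (fun x hx => by rw [hθ'0 x hx, mul_zero]),
    setIntegral_eq_integral_of_forall_compl_eq_zero (fun x hx => by rw [hθ0 x hx, mul_zero])]
    at hparts
  rw [hparts]
  congr 1
  refine integral_congr_ae ?_
  filter_upwards [LocallyIntegrable.ae_hasDerivAt_integral hloc] with x hx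
  rw [(hx 0).deriv]

/-- A locally integrable function with zero weak derivative is a.e. constant. -/
theorem ae_const_of_weakDeriv_zero {u : ℝ → ℝ} (hu : LocallyIntegrable u volume)
    (h : ∀ θ : ℝ → ℝ, ContDiff ℝ ∞ θ → HasCompactSupport θ → ∫ x, u x * deriv θ x = 0) :
    ∃ c : ℝ, ∀ᵐ x, u x = c := by
  obtain ⟨ρ⟩ : Nonempty (ContDiffBump (0 : ℝ)) := ⟨default⟩
  set r : ℝ → ℝ := ρ.normed volume with hr
  have hr1 : ∫ x, r x = 1 := ρ.integral_normed
  have hrs : ContDiff ℝ ∞ r := ρ.contDiff_normed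
  have hrc : HasCompactSupport r := ρ.hasCompactSupport_normed
  have hui : ∀ ψ : ℝ → ℝ, Continuous ψ → HasCompactSupport ψ →
      Integrable (fun x => u x * ψ x) := by
    intro ψ h1 h2
    simpa [mul_comm] using hu.integrable_smul_left_of_hasCompactSupport h1 h2
  refine ⟨∫ x, u x * r x, ?_⟩
  set c := ∫ x, u x * r x with hcdef
  refine ae_eq_of_integral_contDiff_smul_eq hu (locallyIntegrable_const c) ?_
  intro θ hθ hc
  set m := ∫ x, θ x with hm
  -- the primitive of `θ - m r` is a test function
  set ψ : ℝ → ℝ := fun x => θ x - m * r x with hψ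
  have hψs : ContDiff ℝ ∞ ψ := hθ.sub (contDiff_const.mul hrs)
  have hψc : HasCompactSupport ψ := by
    have : HasCompactSupport fun x => m * r x := hrc.mul_left
    exact hc.sub this
  have hψi : Integrable ψ := hψs.continuous.integrable_of_hasCompactSupport hψc
  have hψ0 : ∫ x, ψ x = 0 := by
    rw [hψ, integral_sub (hθ.continuous.integrable_of_hasCompactSupport hc)
      ((hrs.continuous.integrable_of_hasCompactSupport hrc).const_mul m), integral_const_mul, hr1]
    simp [hm]
  obtain ⟨N, hN⟩ : ∃ N : ℝ, ∀ x, N ≤ |x| → ψ x = 0 := by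
    obtain ⟨M, hM⟩ := hψc.isCompact.isBounded.subset_closedBall (0 : ℝ)
    refine ⟨M + 1, fun x hx => ?_⟩
    by_contra h
    have := hM (subset_tsupport ψ h)
    rw [Metric.mem_closedBall, dist_zero_right, Real.norm_eq_abs] at this
    linarith
  set P : ℝ → ℝ := fun x => ∫ y in (-|N|)..x, ψ y with hP
  have hPd : ∀ x, HasDerivAt P (ψ x) x := fun x =>
    intervalIntegral.integral_hasDerivAt_right (hψs.continuous.intervalIntegrable _ _)
      hψs.continuous.stronglyMeasurable.stronglyMeasurableAtFilter hψs.continuous.continuousAt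
  have hPderiv : deriv P = ψ := funext fun x => (hPd x).deriv
  have hPs : ContDiff ℝ ∞ P := by
    rw [contDiff_infty_iff_deriv]
    exact ⟨fun x => (hPd x).differentiableAt, by rw [hPderiv]; exact hψs⟩
  have hPc : HasCompactSupport P := by
    refine HasCompactSupport.intro (K := Icc (-|N|) |N|) isCompact_Icc ?_
    intro x hx
    rcases lt_or_ge x (-|N|) with h1 | h1
    · rw [hP]
      dsimp only
      rw [intervalIntegral.integral_symm, neg_eq_zero]
      refine intervalIntegral.integral_zero_ae (ae_of_all _ fun y hy => hN y ?_)
      rw [uIoc_of_le h1.le] at hy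
      have := hy.2
      rw [abs_of_nonpos (by linarith [abs_nonneg N])]
      linarith [le_abs_self N]
    · have h2 : |N| < x := by
        by_contra h2
        exact hx ⟨h1, not_lt.1 h2⟩
      rw [hP]
      dsimp only
      rw [intervalIntegral.integral_of_le h1,
        setIntegral_eq_integral_of_forall_compl_eq_zero, hψ0]
      intro y hy
      apply hN
      by_contra h3
      push Not at h3
      obtain ⟨h4, h5⟩ := abs_lt.1 (h3.trans_le (le_abs_self N))
      exact hy ⟨h4, (h5.trans h2).le⟩
  have hz := h P hPs hPc
  rw [hPderiv] at hz
  have hsplit : ∫ x, u x * ψ x = (∫ x, u x * θ x) - m * c := by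
    rw [hcdef, ← integral_const_mul, ← integral_sub (hui θ hθ.continuous hc)
      ((hui r hrs.continuous hrc).const_mul m)]
    refine integral_congr_ae (ae_of_all _ fun x => ?_)
    simp only [hψ]
    ring
  rw [hsplit, sub_eq_zero] at hz
  calc ∫ x, θ x • u x = ∫ x, u x * θ x := by simp only [smul_eq_mul, mul_comm]
    _ = m * c := hz
    _ = ∫ x, θ x • c := by simp only [smul_eq_mul, integral_mul_const, hm]

/-- Every element of `H¹` has a continuous representative. -/
theorem exists_continuous_rep (f : H1) :
    ∃ F : ℝ → ℝ, Continuous F ∧ F =ᵐ[volume] f.1.fst := by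
  set g : L2 := f.1.snd with hg
  have hloc := locallyIntegrable_L2 g
  have hint : ∀ a b, IntervalIntegrable g volume a b := fun a b =>
    intervalIntegrable_iff.mpr
      ((hloc.integrableOn_isCompact isCompact_uIcc).mono_set uIoc_subset_uIcc)
  set G : ℝ → ℝ := fun x => ∫ y in (0 : ℝ)..x, g y with hGdef
  have hG : Continuous G := intervalIntegral.continuous_primitive hint 0
  obtain ⟨c, hc⟩ := ae_const_of_weakDeriv_zero (u := fun x => f.1.fst x - G x)
    ((locallyIntegrable_L2 f.1.fst).sub hG.locallyIntegrable) (by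
      intro θ hθ hcs
      have h1 := f.2 θ hθ hcs
      have h2 := integral_primitive_mul_deriv g hθ hcs
      have i1 := integrable_mul_test f.1.fst (continuous_deriv_test hθ) hcs.deriv
      have i2 : Integrable (fun x => G x * deriv θ x) :=
        (hG.mul (continuous_deriv_test hθ)).integrable_of_hasCompactSupport hcs.deriv.mul_left
      calc ∫ x, (f.1.fst x - G x) * deriv θ x
          = ∫ x, (f.1.fst x * deriv θ x - G x * deriv θ x) := by simp only [sub_mul]
        _ = 0 := by rw [integral_sub i1 i2, h1, h2, sub_self])
  refine ⟨fun x => G x + c, hG.add continuous_const, ?_⟩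
  filter_upwards [hc] with x hx
  linarith

/-- The continuous representative of an element of `H¹`. -/
def rep (f : H1) : ℝ → ℝ := (exists_continuous_rep f).choose

theorem rep_continuous (f : H1) : Continuous (rep f) := (exists_continuous_rep f).choose_spec.1

theorem rep_ae_eq (f : H1) : rep f =ᵐ[volume] f.1.fst := (exists_continuous_rep f).choose_spec.2

theorem rep_eq_of_ae_eq {f : H1} {F : ℝ → ℝ} (hF : Continuous F) (h : F =ᵐ[volume] f.1.fst) :
    rep f = F :=
  ((rep_continuous f).ae_eq_iff_eq volume hF).1 ((rep_ae_eq f).trans h.symm)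

theorem rep_zero : rep 0 = 0 :=
  rep_eq_of_ae_eq continuous_zero (Lp.coeFn_zero ℝ 2 (volume : Measure ℝ)).symm

theorem rep_add (f g : H1) : rep (f + g) = rep f + rep g := by
  refine rep_eq_of_ae_eq ((rep_continuous f).add (rep_continuous g)) ?_
  exact ((rep_ae_eq f).add (rep_ae_eq g)).trans (Lp.coeFn_add f.1.fst g.1.fst).symm

theorem rep_smul (c : ℝ) (f : H1) : rep (c • f) = c • rep f := by
  refine rep_eq_of_ae_eq ((rep_continuous f).const_smul c) ?_
  exact ((rep_ae_eq f).const_smul c).trans (Lp.coeFn_smul c f.1.fst).symm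

/-- Weak derivatives are unique, so an element of `H¹` is determined by its representative. -/
theorem rep_eq_zero {f : H1} (h : rep f = 0) : f = 0 := by
  have h0 : (f.1.fst : ℝ → ℝ) =ᵐ[volume] 0 := by
    have := rep_ae_eq f
    rw [h] at this
    exact this.symm
  have h1 : (f.1.snd : ℝ → ℝ) =ᵐ[volume] 0 := by
    refine ae_eq_zero_of_integral_contDiff_smul_eq_zero (locallyIntegrable_L2 f.1.snd) ?_
    intro θ hθ hc
    have := f.2 θ hθ hc
    rw [integral_congr_ae (g := fun _ => (0 : ℝ)) (by
      filter_upwards [h0] with x hx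
      rw [hx, Pi.zero_apply, zero_mul]), integral_zero] at this
    calc ∫ x, θ x • f.1.snd x = ∫ x, f.1.snd x * θ x := by simp only [smul_eq_mul, mul_comm]
      _ = 0 := by linarith
  apply Subtype.ext
  apply WithLp.ofLp_injective
  exact Prod.ext ((Lp.eq_zero_iff_ae_eq_zero).2 h0) ((Lp.eq_zero_iff_ae_eq_zero).2 h1)

theorem incl_injective : Function.Injective incl := by
  intro f g h
  have h1 : f.1.fst = g.1.fst := h
  have h2 : f.1.snd = g.1.snd := by
    rw [← sub_eq_zero]
    apply rep_eq_zero
    refine rep_eq_of_ae_eq continuous_zero ?_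
    have : (f.1.snd - g.1.snd : H1).1.fst = 0 := by
      change f.1.snd.1.fst - g.1.snd.1.fst = 0
      rw [← show f.1.fst.1.snd = f.1.snd.1.fst from f.2,
        ← show g.1.fst.1.snd = g.1.snd.1.fst from g.2, h1, sub_self]
    rw [this]
    exact (Lp.coeFn_zero ℝ 2 (volume : Measure ℝ)).symm
  exact Subtype.ext (WithLp.ofLp_injective 2 (Prod.ext h1 h2))

/-! ### The operator `Q = (1 - ∂ₓ²)^{1/2}` -/

/-- The Fourier transform of a real square integrable function, as an element of complex `L²`
(zero for functions which are not square integrable). -/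
def fourierL2 (w : ℝ → ℝ) : Lp ℂ 2 (volume : Measure ℝ) :=
  open Classical in
  if h : MemLp (fun x => (w x : ℂ)) 2 volume then 𝓕 (h.toLp (fun x => (w x : ℂ))) else 0

/-- The symbol of `1 - ∂ₓ²`, for the Fourier transform `∫ e^{-2πi x k} f(x) dx`. -/
def symb (k : ℝ) : ℝ := 1 + (2 * Real.pi * k) ^ 2

/-- `g = Q f`, where `Q = (1 - ∂ₓ²)^{1/2}` is understood as a Fourier multiplier. -/
def IsQ (f g : ℝ → ℝ) : Prop :=
  ∀ᵐ k, fourierL2 g k = (Real.sqrt (symb k) : ℂ) * fourierL2 f k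

/-- `Q⁻² w = (1 - ∂ₓ²)⁻¹ w` for `w ∈ L²`. The inverse Fourier transform is the one given by an
integral, as the product of `symb⁻¹` and an `L²` function is integrable. -/
def invQsq (w : ℝ → ℝ) : ℝ → ℝ :=
  fun x => (𝓕⁻ (fun k : ℝ => ((symb k)⁻¹ : ℂ) * fourierL2 w k) x).re

/-! ### The operators of the Camassa-Holm equation -/

/-- `A(w) f = a ∂ₓ f + b f`, `f ∈ H²`, where `a = Q⁻² w` and `b = 2 ∂ₓ Q⁻² w`. -/
def opA (w : ℝ → ℝ) (f : H2) : ℝ → ℝ :=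
  fun x => invQsq w x * rep (dx f) x + 2 * deriv (invQsq w) x * rep (incl f) x

theorem opA_zero (w : ℝ → ℝ) : opA w 0 = 0 := by
  funext x
  simp [opA, rep_zero]

theorem opA_add (w : ℝ → ℝ) (f g : H2) : opA w (f + g) = opA w f + opA w g := by
  funext x
  simp only [opA, map_add, rep_add, Pi.add_apply]
  ring

theorem opA_smul (w : ℝ → ℝ) (c : ℝ) (f : H2) : opA w (c • f) = c • opA w f := by
  funext x
  simp only [opA, map_smul, rep_smul, Pi.smul_apply, smul_eq_mul]
  ring

/-- The space `C_b^n` of `n` times continuously differentiable functions which are bounded together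
with their derivatives up to order `n`. -/
def MemCb (n : ℕ) (f : ℝ → ℝ) : Prop :=
  ContDiff ℝ n f ∧ ∀ m ≤ n, ∃ C : ℝ, ∀ x, |iteratedDeriv m f x| ≤ C

/-- The flow `φ_t` of the vector field `ξ ∂ₓ`: `t ↦ φ_t(x)` is the solution of `γ' = ξ(γ)`,
`γ(0) = x`, on the whole line, which exists and is unique for bounded Lipschitz `ξ`. -/
def flow (ξ : ℝ → ℝ) (t x : ℝ) : ℝ :=
  open Classical in
  if h : ∃ γ : ℝ → ℝ, γ 0 = x ∧ ∀ s, HasDerivAt γ (ξ (γ s)) s then h.choose t else x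

/-- The one-parameter group `[U_t f](x) = exp(c(t,x)) f(φ_{-t}(x))` with
`c(t,x) = ∫₀ᵗ η(φ_{s-t}(x)) ds`. -/
def U (ξ η : ℝ → ℝ) (t : ℝ) (f : ℝ → ℝ) : ℝ → ℝ :=
  fun x => Real.exp (∫ s in (0 : ℝ)..t, η (flow ξ (s - t) x)) * f (flow ξ (-t) x)

theorem U_zero (ξ η : ℝ → ℝ) (t : ℝ) : U ξ η t 0 = 0 := by
  funext x
  simp [U]

theorem U_add (ξ η : ℝ → ℝ) (t : ℝ) (f g : ℝ → ℝ) :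
    U ξ η t (f + g) = U ξ η t f + U ξ η t g := by
  funext x
  simp only [U, Pi.add_apply]
  ring

theorem U_smul (ξ η : ℝ → ℝ) (t c : ℝ) (f : ℝ → ℝ) : U ξ η t (c • f) = c • U ξ η t f := by
  funext x
  simp only [U, Pi.smul_apply, smul_eq_mul]
  ring

/-- The graph in `H¹ × H¹` of `U_t A(U_t⁻¹ v) U_t⁻¹`, where `U_t⁻¹ = U_{-t}` and `A(w)` has the
domain `H²`: pairs `(x, y)` such that `f := U_t⁻¹ x` lies in `H²` and `y = U_t A(U_t⁻¹ v) f`. -/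
def conjGraph (ξ η : ℝ → ℝ) (t : ℝ) (v : H2) : Submodule ℝ (H1 × H1) where
  carrier := {p | ∃ f : H2, rep (incl f) = U ξ η (-t) (rep p.1) ∧
    rep p.2 = U ξ η t (opA (U ξ η (-t) (rep (incl v))) f)}
  zero_mem' := ⟨0, by simp [rep_zero, U_zero], by simp [rep_zero, opA_zero, U_zero]⟩
  add_mem' := by
    rintro p q ⟨f, hf, hf'⟩ ⟨g, hg, hg'⟩
    refine ⟨f + g, ?_, ?_⟩
    · rw [map_add, rep_add, hf, hg, Prod.fst_add, rep_add, U_add]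
    · rw [Prod.snd_add, rep_add, hf', hg', opA_add, U_add]
  smul_mem' := by
    rintro c p ⟨f, hf, hf'⟩
    refine ⟨c • f, ?_, ?_⟩
    · rw [map_smul, rep_smul, hf, Prod.smul_fst, rep_smul, U_smul]
    · rw [Prod.smul_snd, rep_smul, hf', opA_smul, U_smul]

theorem conjGraph_single_valued (ξ η : ℝ → ℝ) (t : ℝ) (v : H2) (p : H1 × H1)
    (hp : p ∈ conjGraph ξ η t v) (h : p.1 = 0) : p.2 = 0 := by
  obtain ⟨f, hf, hf'⟩ := hp
  rw [h, rep_zero, U_zero] at hf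
  have h0 : f = 0 := incl_injective (by rw [rep_eq_zero hf, map_zero])
  rw [h0, opA_zero, U_zero] at hf'
  exact rep_eq_zero hf'

/-- The operator `Â(t,v)` in `H¹`: the closure in `H¹` of the operator `U_t A(U_t⁻¹ v) U_t⁻¹` with
domain `H²`. If minus this closure generates a `C₀`-semigroup in `H¹`, then no other extension of the
operator on `H²` does so. -/
def hatA (ξ η : ℝ → ℝ) (t : ℝ) (v : H2) : H1 →ₗ.[ℝ] H1 :=
  (conjGraph ξ η t v).toLinearPMap.closure

/-! ### Semigroups and Kato's condition -/

section Kato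

variable {X Y : Type*} [NormedAddCommGroup X] [NormedSpace ℝ X]
  [NormedAddCommGroup Y] [NormedSpace ℝ Y]

/-- `T s`, `s ≥ 0`, is a strongly continuous semigroup of bounded operators in `X`
(the values for `s < 0` play no role). -/
structure IsC0Semigroup (T : ℝ → X →L[ℝ] X) : Prop where
  zero : T 0 = ContinuousLinearMap.id ℝ X
  add : ∀ s r, 0 ≤ s → 0 ≤ r → T (s + r) = (T s).comp (T r)
  strong_cont : ∀ x, ContinuousOn (fun s => T s x) (Ici 0)

/-- `G` is the infinitesimal generator of `T`: `x` is in the domain of `G` and `G x = y` exactly when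
`(T(h) x - x) / h` tends to `y` as `h` decreases to `0`. -/
def IsGenerator (G : X →ₗ.[ℝ] X) (T : ℝ → X →L[ℝ] X) : Prop :=
  ∀ x y : X, (x, y) ∈ G.graph ↔
    Tendsto (fun h : ℝ => h⁻¹ • (T h x - x)) (𝓝[>] 0) (𝓝 y)

/-- Kato's condition with radius `R` and isomorphism `Q` for a family `A t v`, `t ∈ I`, `v ∈ Y`, of
linear operators in `X`, where `Y` is embedded in `X` by `ι`. -/
structure KatoCondition (ι : Y →L[ℝ] X) (Q : Y ≃L[ℝ] X) (I : Set ℝ) (R : ℝ)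
    (A : ℝ → Y → (X →ₗ.[ℝ] X)) : Prop where
  embedding : Function.Injective ι
  dense : DenseRange ι
  domain : ∀ t ∈ I, ∀ v y : Y, ι y ∈ (A t v).domain
  /-- `-A(t,v)` generates a semigroup, and `‖e^{-sA(t,v)}‖ ≤ e^{βs}` for `‖v‖ ≤ R`. -/
  quasi_accretive : ∃ β : ℝ, ∀ t ∈ I, ∀ v : Y, ∃ T : ℝ → X →L[ℝ] X,
    IsC0Semigroup T ∧ IsGenerator (-(A t v)) T ∧
      (‖v‖ ≤ R → ∀ s, 0 ≤ s → ‖T s‖ ≤ Real.exp (β * s))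
  /-- `Q A(t,v) Q⁻¹ = A(t,v) + B(t,v)` as unbounded operators, including equality of the domains. -/
  commutator : ∃ B : ℝ → Y → (X →L[ℝ] X),
    (∀ t ∈ I, ∀ v : Y, ∀ x z : X,
      (∃ y : Y, (ι (Q.symm x), ι y) ∈ (A t v).graph ∧ Q y = z) ↔
        (x, z - B t v x) ∈ (A t v).graph) ∧
    (∀ v : Y, StronglyMeasurable (fun t : I => B t v)) ∧
    ∃ l : ℝ, ∀ t ∈ I, ∀ v : Y, ‖v‖ ≤ R → ‖B t v‖ ≤ l
  /-- `A(t,v) ∈ L(Y,X)`, continuously in `t` for the operator norm. -/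
  continuity : ∀ v : Y, ∃ S : ℝ → (Y →L[ℝ] X),
    (∀ t ∈ I, ∀ y : Y, (ι y, S t y) ∈ (A t v).graph) ∧ ContinuousOn S I
  lipschitz : ∃ μ : ℝ, ∀ t (ht : t ∈ I), ∀ v₁ v₂ u : Y, ‖v₁‖ ≤ R → ‖v₂‖ ≤ R →
    ‖A t v₁ ⟨ι u, domain t ht v₁ u⟩ - A t v₂ ⟨ι u, domain t ht v₂ u⟩‖ ≤
      μ * ‖ι (v₁ - v₂)‖ * ‖u‖

end Kato

end StochCH

end

/-!
Conjugation by `U_t` turns `A(v)` again into a first order operator `f ↦ α f' + β f`. Since `Q⁻²`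
gains two derivatives, `α` lies in `H³` and `β` in `H²`, with norms which are bounded locally
uniformly in `t`. For such an operator everything is explicit. On the maximal domain, where the
relation `α f' + β f = g` is read in `L²`, it is closed, and `H²` is a core because the group below
preserves `H²`. Its negative generates the group `f ↦ exp (-∫ β) f ∘ φ` of weighted compositions
with the flow of `-α`, in `H¹` of norm at most `exp (κ |s|)` with `κ` depending only on the suprema
of `α'`, `β` and `β'`. The commutator `[Q, α]` has on the Fourier side the kernel
`(q(k) - q(k - m)) α̂(m)`, with `q` the symbol of `Q`; the bound
`q(k) |q(k) - q(k - m)| ≤ 2 q(m)² q(k - m)` and Young's inequality extend it to a bounded operator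
in `H¹`, of norm at most a constant times the norm of `Q² α` in `H¹`. Finally, strong continuity of
`t ↦ U_t` in `Hᵏ` becomes continuity in the operator norm, because an operator is bounded by the
norms of its coefficients.
-/

noncomputable section

open scoped ENNReal NNReal

namespace StochCH

/-! ### Components of elements of `H¹` and `H²` -/

/-- The underlying `L²` function of an element of `H¹`, as a bounded operator. -/
def val : H1 →L[ℝ] L2 := (WithLp.fstL 2 ℝ L2 L2).comp H1sub.subtypeL

/-- The weak derivative of an element of `H¹`, as a bounded operator into `L²`. -/
def der : H1 →L[ℝ] L2 := (WithLp.sndL 2 ℝ L2 L2).comp H1sub.subtypeL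

theorem isWeakDeriv_val_der (f : H1) : IsWeakDeriv (val f) (der f) := f.2

theorem der_incl (f : H2) : der (incl f) = val (dx f) := f.2

theorem rep_ae_eq_val (f : H1) : rep f =ᵐ[volume] val f := rep_ae_eq f

theorem rep_eq_of_ae_eq_val {f : H1} {F : ℝ → ℝ} (hF : Continuous F) (h : F =ᵐ[volume] val f) :
    rep f = F :=
  rep_eq_of_ae_eq hF h

theorem rep_neg (f : H1) : rep (-f) = -rep f := by
  rw [← neg_one_smul ℝ, rep_smul, neg_one_smul]

theorem rep_sub (f g : H1) : rep (f - g) = rep f - rep g := by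
  rw [sub_eq_add_neg, rep_add, rep_neg, sub_eq_add_neg]

theorem H1.ext_rep {f g : H1} (h : rep f = rep g) : f = g :=
  sub_eq_zero.1 (rep_eq_zero (by rw [rep_sub, h, sub_self]))

theorem H1.ext_val {f g : H1} (h : val f = val g) : f = g :=
  H1.ext_rep (rep_eq_of_ae_eq_val (rep_continuous g) (h ▸ rep_ae_eq_val g))

theorem H1.norm_sq_eq (f : H1) : ‖f‖ ^ 2 = ‖val f‖ ^ 2 + ‖der f‖ ^ 2 :=
  WithLp.prod_norm_sq_eq_of_L2 f.1

theorem H2.norm_sq_eq (f : H2) : ‖f‖ ^ 2 = ‖incl f‖ ^ 2 + ‖dx f‖ ^ 2 :=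
  WithLp.prod_norm_sq_eq_of_L2 f.1

theorem norm_val_le (f : H1) : ‖val f‖ ≤ ‖f‖ := WithLp.norm_fst_le _ f.1

theorem norm_der_le (f : H1) : ‖der f‖ ≤ ‖f‖ := WithLp.norm_snd_le _ f.1

theorem norm_incl_le (f : H2) : ‖incl f‖ ≤ ‖f‖ := WithLp.norm_fst_le _ f.1

theorem norm_dx_le (f : H2) : ‖dx f‖ ≤ ‖f‖ := WithLp.norm_snd_le _ f.1

theorem H1.norm_le_add (f : H1) : ‖f‖ ≤ ‖val f‖ + ‖der f‖ := by
  refine abs_le_of_sq_le_sq' ?_ (by positivity) |>.2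
  nlinarith [H1.norm_sq_eq f, norm_nonneg (val f), norm_nonneg (der f)]

theorem H2.norm_le_add (f : H2) : ‖f‖ ≤ ‖incl f‖ + ‖dx f‖ := by
  refine abs_le_of_sq_le_sq' ?_ (by positivity) |>.2
  nlinarith [H2.norm_sq_eq f, norm_nonneg (incl f), norm_nonneg (dx f)]

/-- The element of `H¹` with given function and weak derivative. -/
def H1.mk (f g : L2) (h : IsWeakDeriv f g) : H1 := ⟨WithLp.toLp 2 (f, g), h⟩

@[simp] theorem val_mk (f g : L2) (h : IsWeakDeriv f g) : val (H1.mk f g h) = f := rfl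

@[simp] theorem der_mk (f g : L2) (h : IsWeakDeriv f g) : der (H1.mk f g h) = g := rfl

/-- The element of `H²` with given function and weak derivative in `H¹`. -/
def H2.mk (f g : H1) (h : der f = val g) : H2 := ⟨WithLp.toLp 2 (f, g), h⟩

@[simp] theorem incl_mk (f g : H1) (h : der f = val g) : incl (H2.mk f g h) = f := rfl

@[simp] theorem dx_mk (f g : H1) (h : der f = val g) : dx (H2.mk f g h) = g := rfl

section Lift

variable {X : Type*} [NormedAddCommGroup X] [NormedSpace ℝ X]

/-- The bounded operator into `H¹` with components `S` and `T`, where `T x` is the weak derivative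
of `S x`. -/
def H1.lift (S T : X →L[ℝ] L2) (h : ∀ x, IsWeakDeriv (S x) (T x)) : X →L[ℝ] H1 :=
  ((WithLp.prodContinuousLinearEquiv 2 ℝ L2 L2).symm.toContinuousLinearMap.comp
    (S.prod T)).codRestrict H1sub h

/-- The bounded operator into `H²` with components `S` and `T`, where `T x` is the weak derivative
of `S x`. -/
def H2.lift (S T : X →L[ℝ] H1) (h : ∀ x, der (S x) = val (T x)) : X →L[ℝ] H2 :=
  ((WithLp.prodContinuousLinearEquiv 2 ℝ H1 H1).symm.toContinuousLinearMap.comp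
    (S.prod T)).codRestrict H2sub h

end Lift

theorem H1.continuousOn_of_val_der {X : Type*} [TopologicalSpace X] {f : X → H1} {s : Set X}
    (h0 : ContinuousOn (fun x => val (f x)) s) (h1 : ContinuousOn (fun x => der (f x)) s) :
    ContinuousOn f s := by
  have : ContinuousOn (fun x => (f x).1) s :=
    (WithLp.prodContinuousLinearEquiv 2 ℝ L2 L2).symm.continuous.comp_continuousOn (h0.prodMk h1)
  exact continuousOn_iff_continuous_domRestrict.2
    ((continuousOn_iff_continuous_domRestrict.1 this).subtype_mk fun x => (f x).2)

theorem H1.continuous_of_val_der {X : Type*} [TopologicalSpace X] {f : X → H1}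
    (h0 : Continuous (fun x => val (f x))) (h1 : Continuous (fun x => der (f x))) :
    Continuous f := by
  rw [← continuousOn_univ] at *
  exact H1.continuousOn_of_val_der h0 h1

theorem integrable_deriv_test (f : L2) {θ : ℝ → ℝ} (h : ContDiff ℝ ∞ θ)
    (hc : HasCompactSupport θ) : Integrable (fun x => f x * deriv θ x) :=
  integrable_mul_test f (continuous_deriv_test h) hc.deriv

theorem inner_eq_integral_mul (f g : L2) : inner ℝ f g = ∫ x, f x * g x := by
  simp only [L2.inner_def, RCLike.inner_apply', conj_trivial]

theorem integral_mul_test_eq_inner (f : L2) {θ : ℝ → ℝ} (h : Continuous θ)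
    (hc : HasCompactSupport θ) :
    ∫ x, f x * θ x = inner ℝ f ((h.memLp_of_hasCompactSupport (p := 2) hc).toLp θ) := by
  rw [inner_eq_integral_mul]
  refine integral_congr_ae ?_
  filter_upwards [(h.memLp_of_hasCompactSupport (p := 2) (μ := volume) hc).coeFn_toLp] with x hx
  rw [hx]

theorem isClosed_isWeakDeriv : IsClosed {p : L2 × L2 | IsWeakDeriv p.1 p.2} := by
  simp only [IsWeakDeriv, ofPred_forall]
  refine isClosed_iInter fun θ => isClosed_iInter fun h => isClosed_iInter fun hc => ?_
  simp only [integral_mul_test_eq_inner _ (continuous_deriv_test h) hc.deriv,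
    integral_mul_test_eq_inner _ h.continuous hc]
  exact isClosed_eq (by fun_prop) (by fun_prop)

instance : CompleteSpace H1 :=
  have : IsClosed (H1sub : Set (WithLp 2 (L2 × L2))) := isClosed_isWeakDeriv.preimage
    ((WithLp.fstL 2 ℝ L2 L2).continuous.prodMk (WithLp.sndL 2 ℝ L2 L2).continuous)
  this.completeSpace_coe

instance : CompleteSpace H2 :=
  have : IsClosed (H2sub : Set (WithLp 2 (H1 × H1))) :=
    isClosed_eq (der.continuous.comp (WithLp.fstL 2 ℝ H1 H1).continuous)
      (val.continuous.comp (WithLp.sndL 2 ℝ H1 H1).continuous)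
  this.completeSpace_coe

/-! ### Classical and weak derivatives -/

theorem isWeakDeriv_of_hasDerivAt {F G : ℝ → ℝ} {f g : L2} (h : ∀ x, HasDerivAt F (G x) x)
    (hf : F =ᵐ[volume] f) (hg : G =ᵐ[volume] g) : IsWeakDeriv f g := by
  intro θ hθ hc
  have mul_congr {u v : ℝ → ℝ} (huv : u =ᵐ[volume] v) (w : ℝ → ℝ) :
      (fun x => v x * w x) =ᵐ[volume] fun x => u x * w x :=
    huv.symm.mul .rfl
  rw [integral_congr_ae (mul_congr hf _), integral_congr_ae (mul_congr hg _)]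
  exact integral_mul_deriv_eq_deriv_mul_of_integrable (fun x _ => h x)
    (fun x _ => (hθ.differentiable (by simp) x).hasDerivAt)
    ((integrable_deriv_test f hθ hc).congr (mul_congr hf _))
    ((integrable_mul_test g hθ.continuous hc).congr (mul_congr hg _))
    ((integrable_mul_test f hθ.continuous hc).congr (mul_congr hf _))

theorem intervalIntegrable_L2 (g : L2) (a b : ℝ) : IntervalIntegrable g volume a b :=
  intervalIntegrable_iff.mpr
    (((locallyIntegrable_L2 g).integrableOn_isCompact isCompact_uIcc).mono_set uIoc_subset_uIcc)

theorem IsWeakDeriv.exists_ae_eq_integral_add {f g : L2} (h : IsWeakDeriv f g) :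
    ∃ c : ℝ, f =ᵐ[volume] fun x => (∫ y in (0 : ℝ)..x, g y) + c := by
  have hG : Continuous fun x : ℝ => ∫ y in (0 : ℝ)..x, g y :=
    intervalIntegral.continuous_primitive (intervalIntegrable_L2 g) 0
  obtain ⟨c, hc⟩ := ae_const_of_weakDeriv_zero (u := fun x => f x - ∫ y in (0 : ℝ)..x, g y)
    ((locallyIntegrable_L2 f).sub hG.locallyIntegrable) (by
      intro θ hθ hcs
      have hGθ : Integrable fun x => (∫ y in (0 : ℝ)..x, g y) * deriv θ x :=
        (hG.mul (continuous_deriv_test hθ)).integrable_of_hasCompactSupport hcs.deriv.mul_left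
      simp only [sub_mul]
      rw [integral_sub (integrable_deriv_test f hθ hcs) hGθ, h θ hθ hcs,
        integral_primitive_mul_deriv g hθ hcs, sub_self])
  refine ⟨c, ?_⟩
  filter_upwards [hc] with x hx
  linarith

theorem rep_eq_integral (f : H1) (x : ℝ) : rep f x = rep f 0 + ∫ y in (0 : ℝ)..x, der f y := by
  obtain ⟨c, hc⟩ := (isWeakDeriv_val_der f).exists_ae_eq_integral_add
  have key : rep f = fun x => (∫ y in (0 : ℝ)..x, der f y) + c := rep_eq_of_ae_eq_val
    ((intervalIntegral.continuous_primitive (intervalIntegrable_L2 _) 0).add continuous_const)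
    hc.symm
  simp only [key, intervalIntegral.integral_same]
  ring

theorem hasDerivAt_rep {f : H1} {G : ℝ → ℝ} (hG : Continuous G) (h : G =ᵐ[volume] der f) (x : ℝ) :
    HasDerivAt (rep f) (G x) x := by
  have rep_eq : rep f = fun x => rep f 0 + ∫ y in (0 : ℝ)..x, G y := by
    funext x
    rw [rep_eq_integral f x]
    congr 1
    refine intervalIntegral.integral_congr_ae ?_
    filter_upwards [h] with y hy _
    exact hy.symm
  rw [rep_eq]
  exact (intervalIntegral.integral_hasDerivAt_right (hG.intervalIntegrable _ _)
      hG.stronglyMeasurable.stronglyMeasurableAtFilter hG.continuousAt).const_add _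

theorem hasDerivAt_rep_incl (f : H2) (x : ℝ) : HasDerivAt (rep (incl f)) (rep (dx f) x) x :=
  hasDerivAt_rep (rep_continuous _) (by rw [der_incl]; exact rep_ae_eq_val _) x

theorem deriv_rep_incl (f : H2) : deriv (rep (incl f)) = rep (dx f) :=
  funext fun x => (hasDerivAt_rep_incl f x).deriv

/-! ### Multiplication by bounded functions in `Lᵖ` -/

section MulLp

variable {α 𝕜 : Type*} [MeasurableSpace α] {μ : Measure α} [RCLike 𝕜] {p : ℝ≥0∞} [Fact (1 ≤ p)]
  {m : α → 𝕜}

/-- Multiplication by a bounded measurable function, as a bounded operator in `Lᵖ`. -/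
def mulLp (hm : MemLp m ∞ μ) : Lp 𝕜 p μ →L[𝕜] Lp 𝕜 p μ :=
  (ContinuousLinearMap.mul 𝕜 𝕜).holderL μ ∞ p p hm.toLp

theorem coeFn_mulLp (hm : MemLp m ∞ μ) (f : Lp 𝕜 p μ) :
    mulLp hm f =ᵐ[μ] fun x => m x * f x := by
  filter_upwards [(ContinuousLinearMap.mul 𝕜 𝕜).coeFn_holder (r := p) hm.toLp f, hm.coeFn_toLp]
    with x hx hmx
  rw [← hmx]
  exact hx

theorem norm_mulLp_apply_le (hm : MemLp m ∞ μ) {C : ℝ} (hC : ∀ x, ‖m x‖ ≤ C) (f : Lp 𝕜 p μ) :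
    ‖mulLp hm f‖ ≤ C * ‖f‖ := by
  apply Lp.norm_le_mul_norm_of_ae_le_mul
  filter_upwards [coeFn_mulLp hm f] with x hx
  rw [hx, norm_mul]
  gcongr
  exact hC x

end MulLp

/-! ### The Fourier transform of real functions -/

/-- The complex Hilbert space `L²(ℝ)`, in which Fourier transforms live. -/
abbrev LC : Type := Lp ℂ 2 (volume : Measure ℝ)

/-- The inclusion of real into complex `L²`. -/
def toC : L2 →L[ℝ] LC := Complex.ofRealCLM.compLpL 2 volume

/-- The pointwise real part of a complex `L²` function. -/
def reL : LC →L[ℝ] L2 := Complex.reCLM.compLpL 2 volume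

theorem coeFn_toC (f : L2) : toC f =ᵐ[volume] fun x => (f x : ℂ) :=
  ContinuousLinearMap.coeFn_compLpL Complex.ofRealCLM f

theorem coeFn_reL (f : LC) : reL f =ᵐ[volume] fun x => (f x).re :=
  ContinuousLinearMap.coeFn_compLpL Complex.reCLM f

theorem norm_toC (f : L2) : ‖toC f‖ = ‖f‖ := by
  have norm_eq : ∀ᵐ x, ‖toC f x‖ = ‖f x‖ := by
    filter_upwards [coeFn_toC f] with x hx
    rw [hx, Complex.norm_real]
  exact le_antisymm (Lp.norm_le_norm_of_ae_le (norm_eq.mono fun _ => le_of_eq))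
    (Lp.norm_le_norm_of_ae_le (norm_eq.mono fun _ => ge_of_eq))

theorem star_toC (f : L2) : star (toC f) = toC f := by
  apply Lp.ext
  filter_upwards [Lp.coeFn_star (toC f), coeFn_toC f] with x h1 h2
  rw [h1, Pi.star_apply, h2, Complex.star_def, Complex.conj_ofReal]

theorem toC_reL {f : LC} (hf : star f = f) : toC (reL f) = f := by
  apply Lp.ext
  filter_upwards [coeFn_toC (reL f), coeFn_reL f, Lp.coeFn_star f] with x h1 h2 h3
  rw [hf] at h3
  rw [h1, h2]
  exact Complex.conj_eq_iff_re.1 h3.symm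

/-- The Fourier transform of real `L²` functions, with values in complex `L²`. -/
def FT : L2 →L[ℝ] LC :=
  (((Lp.fourierTransformₗᵢ ℝ ℂ).toContinuousLinearEquiv : LC →L[ℂ] LC).restrictScalars ℝ).comp toC

/-- The real part of the inverse Fourier transform: the inverse of `FT` on the hermitian functions,
see `FT_invFT`. -/
def invFT : LC →L[ℝ] L2 :=
  reL.comp
    (((Lp.fourierTransformₗᵢ ℝ ℂ).symm.toContinuousLinearEquiv : LC →L[ℂ] LC).restrictScalars ℝ)

theorem FT_apply (f : L2) : FT f = 𝓕 (toC f) := rfl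

theorem invFT_apply (h : LC) : invFT h = reL (𝓕⁻ h) := rfl

theorem norm_FT (f : L2) : ‖FT f‖ = ‖f‖ := by
  rw [FT_apply, Lp.norm_fourier_eq, norm_toC]

theorem FT_injective : Function.Injective FT := by
  rw [injective_iff_map_eq_zero]
  intro f hf
  rw [← norm_eq_zero, ← norm_FT, hf, norm_zero]

theorem inner_FT (f g : L2) : inner ℝ f g = (inner ℂ (FT f) (FT g)).re := by
  have inner_toC : inner ℂ (toC f) (toC g) = ((inner ℝ f g : ℝ) : ℂ) := by
    rw [inner_eq_integral_mul, L2.inner_def, ← integral_complex_ofReal]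
    refine integral_congr_ae ?_
    filter_upwards [coeFn_toC f, coeFn_toC g] with x h1 h2
    rw [h1, h2, RCLike.inner_apply', Complex.conj_ofReal, Complex.ofReal_mul]
  rw [FT_apply, FT_apply, Lp.inner_fourier_eq, inner_toC, Complex.ofReal_re]

theorem fourierL2_eq_FT {w : ℝ → ℝ} {f : L2} (h : w =ᵐ[volume] f) : fourierL2 w = FT f := by
  have h1 : (fun x => (w x : ℂ)) =ᵐ[volume] toC f := by
    filter_upwards [h, coeFn_toC f] with x h1 h2
    rw [h2, h1]
  have h2 : MemLp (fun x => (w x : ℂ)) 2 volume := (memLp_congr_ae h1).2 (Lp.memLp _)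
  rw [fourierL2, dif_pos h2, FT_apply]
  congr 1
  exact Lp.ext (h2.coeFn_toLp.trans h1)

/-- A test function, that is, a compactly supported smooth real function, as a Schwartz function. -/
def testSchwartz (θ : ℝ → ℝ) (h : ContDiff ℝ ∞ θ) (hc : HasCompactSupport θ) : SchwartzMap ℝ ℂ :=
  HasCompactSupport.toSchwartzMap (f := fun x => (θ x : ℂ))
    (hc.comp_left (g := fun x : ℝ => (x : ℂ)) rfl) (Complex.ofRealCLM.contDiff.comp h)

theorem testSchwartz_apply (θ : ℝ → ℝ) (h : ContDiff ℝ ∞ θ) (hc : HasCompactSupport θ) (x : ℝ) :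
    testSchwartz θ h hc x = (θ x : ℂ) := rfl

theorem ae_eq_of_integral_testSchwartz_mul_eq {u v : ℝ → ℂ} (hu : LocallyIntegrable u volume)
    (hv : LocallyIntegrable v volume)
    (h : ∀ (θ : ℝ → ℝ) (hθ : ContDiff ℝ ∞ θ) (hc : HasCompactSupport θ),
      ∫ x, testSchwartz θ hθ hc x * u x = ∫ x, testSchwartz θ hθ hc x * v x) : u =ᵐ[volume] v :=
  ae_eq_of_integral_contDiff_smul_eq hu hv fun θ hθ hc => by
    simpa only [testSchwartz_apply, Complex.real_smul] using h θ hθ hc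

theorem locallyIntegrable_LC (f : LC) : LocallyIntegrable f volume :=
  (Lp.memLp f).locallyIntegrable (by norm_num)

theorem integral_schwartz_mul_fourier (f : LC) (θ : SchwartzMap ℝ ℂ) :
    ∫ x, θ x * (𝓕 f : LC) x = ∫ x, (𝓕 θ) x * f x := by
  have h := congrArg (fun T => T θ) (Lp.fourier_toTemperedDistribution_eq f)
  simp only [TemperedDistribution.fourier_apply, Lp.toTemperedDistribution_apply, smul_eq_mul] at h
  exact h.symm

theorem ae_comp_neg {p : ℝ → Prop} (h : ∀ᵐ x, p x) : ∀ᵐ x, p (-x) :=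
  (Measure.measurePreserving_neg (volume : Measure ℝ)).quasiMeasurePreserving.ae h

theorem star_fourier_apply {V : Type*} [NormedAddCommGroup V] [InnerProductSpace ℝ V]
    [FiniteDimensional ℝ V] [MeasurableSpace V] [BorelSpace V] (f : V → ℂ) (w : V) :
    star (𝓕 f w) = 𝓕 (fun v => star (f (-v))) w := by
  simp only [Real.fourier_eq', Complex.star_def, ← integral_conj]
  rw [← integral_neg_eq_self]
  congr 1
  funext v
  simp [← Complex.exp_conj, Complex.conj_ofNat]

theorem fourier_star (f : LC) : (𝓕 (star f) : LC) =ᵐ[volume] fun k => star ((𝓕 f : LC) (-k)) := by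
  have hl : LocallyIntegrable (fun k => star ((𝓕 f : LC) (-k))) volume :=
    ((Lp.memLp (𝓕 f : LC)).comp_measurePreserving
      (Measure.measurePreserving_neg volume)).star.locallyIntegrable (by norm_num)
  refine ae_eq_of_integral_testSchwartz_mul_eq (locallyIntegrable_LC _) hl fun θ hθ hc => ?_
  set θneg := testSchwartz (fun x => θ (-x)) (hθ.comp contDiff_neg)
    (hc.comp_homeomorph (Homeomorph.neg ℝ))
  have star_θneg_neg : ∀ x, star (θneg (-x)) = testSchwartz θ hθ hc x := fun x => by
    change star ((θ (- -x) : ℝ) : ℂ) = (θ x : ℂ)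
    rw [neg_neg, Complex.star_def, Complex.conj_ofReal]
  have fourier_θ : ∀ x, (𝓕 (testSchwartz θ hθ hc)) x = star ((𝓕 θneg) x) := by
    intro x
    simp only [SchwartzMap.fourier_coe, star_fourier_apply, star_θneg_neg]
  calc ∫ x, testSchwartz θ hθ hc x * (𝓕 (star f) : LC) x
      = ∫ x, star ((𝓕 θneg) x * f x) := by
        rw [integral_schwartz_mul_fourier]
        refine integral_congr_ae ?_
        filter_upwards [Lp.coeFn_star f] with x hx
        rw [hx, fourier_θ, star_mul', Pi.star_apply]
    _ = star (∫ x, θneg x * (𝓕 f : LC) x) := by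
        rw [integral_schwartz_mul_fourier]
        exact integral_conj
    _ = ∫ x, star (θneg x * (𝓕 f : LC) x) := integral_conj.symm
    _ = ∫ x, testSchwartz θ hθ hc x * star ((𝓕 f : LC) (-x)) := by
        rw [← integral_neg_eq_self]
        simp only [star_mul', star_θneg_neg]

theorem FT_neg (f : L2) : ∀ᵐ k, FT f (-k) = star (FT f k) := by
  filter_upwards [fourier_star (toC f)] with k hk
  rw [star_toC] at hk
  rw [FT_apply, hk, star_star]

theorem FT_invFT {h : LC} (hh : ∀ᵐ k, h (-k) = star (h k)) : FT (invFT h) = h := by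
  have star_fourierInv : star (𝓕⁻ h : LC) = 𝓕⁻ h := by
    apply (Lp.fourierTransformₗᵢ ℝ ℂ).injective
    change (𝓕 (star (𝓕⁻ h)) : LC) = 𝓕 (𝓕⁻ h)
    apply Lp.ext
    filter_upwards [fourier_star (𝓕⁻ h : LC), hh] with k h1 h2
    rw [h1, FourierTransform.fourier_fourierInv_eq, h2, star_star]
  rw [FT_apply, invFT_apply, toC_reL star_fourierInv, FourierTransform.fourier_fourierInv_eq]

/-- The Fourier multiplier with bounded symbol `m`, acting on real functions. The real part is taken
for convenience only: a hermitian symbol preserves real functions, see `FT_multiplier`. -/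
def multiplier {m : ℝ → ℂ} (hm : MemLp m ∞ volume) : L2 →L[ℝ] L2 :=
  invFT.comp (((mulLp hm).restrictScalars ℝ).comp FT)

theorem FT_multiplier {m : ℝ → ℂ} (hm : MemLp m ∞ volume) (h : ∀ k, m (-k) = star (m k))
    (f : L2) : FT (multiplier hm f) =ᵐ[volume] fun k => m k * FT f k := by
  have FT_eq : FT (multiplier hm f) = mulLp hm (FT f) := by
    refine FT_invFT ?_
    filter_upwards [coeFn_mulLp hm (FT f), ae_comp_neg (coeFn_mulLp hm (FT f)), FT_neg f]
      with k h1 h2 h3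
    change mulLp hm (FT f) (-k) = star (mulLp hm (FT f) k)
    rw [h1, h2, h, h3, star_mul']
  rw [FT_eq]
  exact coeFn_mulLp hm _

/-! ### The Fourier transform and weak derivatives -/

open LineDeriv in
theorem hasDerivAt_schwartz (F : SchwartzMap ℝ ℂ) (x : ℝ) :
    HasDerivAt F ((∂_{(1 : ℝ)} F : SchwartzMap ℝ ℂ) x) x := by
  rw [SchwartzMap.lineDerivOp_apply_eq_fderiv]
  exact F.differentiableAt.hasFDerivAt.hasDerivAt

open LineDeriv in
theorem integral_deriv_fourier_mul (f : LC) (G : SchwartzMap ℝ ℂ) :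
    ∫ x, (∂_{(1 : ℝ)} (𝓕 G) : SchwartzMap ℝ ℂ) x * f x =
      -∫ k, G k * ((2 * Real.pi * k : ℝ) * Complex.I * (𝓕 f : LC) k) := by
  have inner_temperate : (fun x : ℝ => inner ℝ x (1 : ℝ)).HasTemperateGrowth := by fun_prop
  rw [SchwartzMap.lineDerivOp_fourier_eq, ← integral_schwartz_mul_fourier, ← integral_neg]
  refine integral_congr_ae (ae_of_all _ fun k => ?_)
  simp only [smul_apply, SchwartzMap.smulLeftCLM_apply_apply inner_temperate]
  simp only [RCLike.inner_apply', conj_trivial, mul_one, Complex.real_smul, smul_eq_mul]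
  push_cast
  ring

theorem isWeakDeriv_of_FT_ae_eq {f g : L2}
    (h : ∀ᵐ k, FT g k = (2 * Real.pi * k : ℝ) * Complex.I * FT f k) : IsWeakDeriv f g := by
  intro θ hθ hc
  set F := testSchwartz θ hθ hc
  have integral_mul_ofReal (u : L2) (ψ : ℝ → ℝ) :
      ∫ x, (ψ x : ℂ) * toC u x = ((∫ x, u x * ψ x : ℝ) : ℂ) := by
    rw [← integral_complex_ofReal]
    refine integral_congr_ae ?_
    filter_upwards [coeFn_toC u] with x hx
    rw [hx, Complex.ofReal_mul, mul_comm]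
  have deriv_F (x : ℝ) : (LineDeriv.lineDerivOp (1 : ℝ) F : SchwartzMap ℝ ℂ) x = (deriv θ x : ℝ) :=
    (hasDerivAt_schwartz F x).unique (hθ.differentiable (by simp) x).hasDerivAt.ofReal_comp
  have key : ∫ x, (LineDeriv.lineDerivOp (1 : ℝ) F : SchwartzMap ℝ ℂ) x * toC f x =
      -∫ x, F x * toC g x := by
    rw [← FourierTransform.fourier_fourierInv_eq (F := SchwartzMap ℝ ℂ) F,
      integral_deriv_fourier_mul, ← integral_schwartz_mul_fourier, neg_inj]
    refine integral_congr_ae ?_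
    filter_upwards [h] with k hk
    rw [← FT_apply, ← FT_apply, hk]
  simp only [deriv_F, F, testSchwartz_apply, integral_mul_ofReal] at key
  exact_mod_cast key

theorem H1.eq_zero_of_der_eq_val {d : H1} (h : der d = val d) : d = 0 := by
  have rep_eq_exp (x : ℝ) : rep d x = rep d 0 * Real.exp x := by
    have hasDerivAt_rep_mul_exp (x : ℝ) :
        HasDerivAt (fun x => rep d x * Real.exp (-x)) 0 x :=
      ((hasDerivAt_rep (rep_continuous d) (h ▸ rep_ae_eq_val d) x).fun_mul
        (hasDerivAt_neg x).exp).congr_deriv (by ring)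
    have const := is_const_of_deriv_eq_zero (fun x => (hasDerivAt_rep_mul_exp x).differentiableAt)
      (fun x => (hasDerivAt_rep_mul_exp x).deriv) x 0
    rw [neg_zero, Real.exp_zero, mul_one] at const
    rw [← const, mul_assoc, ← Real.exp_add, neg_add_cancel, Real.exp_zero, mul_one]
  have rep_zero_eq : rep d 0 = 0 := by
    by_contra hne
    have memLp_rep : MemLp (rep d) 2 volume := (Lp.memLp (val d)).ae_eq (rep_ae_eq_val d).symm
    have measure_lt_top : volume {x | ‖rep d 0‖₊ ≤ ‖rep d x‖₊} < ⊤ :=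
      memLp_rep.meas_ge_lt_top two_ne_zero ENNReal.ofNat_ne_top (nnnorm_ne_zero_iff.2 hne)
    refine measure_lt_top.not_ge ?_
    rw [← Real.volume_Ici (a := 0)]
    refine measure_mono fun x hx => ?_
    change ‖rep d 0‖ ≤ ‖rep d x‖
    rw [rep_eq_exp x, norm_mul, Real.norm_of_nonneg (Real.exp_pos x).le]
    exact le_mul_of_one_le_right (norm_nonneg _) (Real.one_le_exp hx)
  exact rep_eq_zero (funext fun x => by rw [rep_eq_exp, rep_zero_eq, zero_mul, Pi.zero_apply])

theorem exists_isWeakDeriv_sub (w : L2) : ∃ f : L2, IsWeakDeriv f (f - w) ∧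
    ∀ᵐ k, FT (f - w) k = (2 * Real.pi * k : ℝ) * Complex.I * FT f k := by
  set m : ℝ → ℂ := fun k => (1 - (2 * Real.pi * k : ℝ) * Complex.I)⁻¹
  have re_eq_one (k : ℝ) : (1 - (2 * Real.pi * k : ℝ) * Complex.I).re = 1 := by simp
  have ne_zero (k : ℝ) : 1 - (2 * Real.pi * k : ℝ) * Complex.I ≠ 0 := fun h => by
    simpa only [h, Complex.zero_re, zero_ne_one] using re_eq_one k
  have norm_m_le (k : ℝ) : ‖m k‖ ≤ 1 := by
    rw [norm_inv]
    refine inv_le_one_of_one_le₀ ?_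
    calc (1 : ℝ) = |(1 - (2 * Real.pi * k : ℝ) * Complex.I).re| := by rw [re_eq_one, abs_one]
      _ ≤ _ := Complex.abs_re_le_norm _
  have memLp_m : MemLp m ∞ volume := by
    refine memLp_top_of_bound (Continuous.aestronglyMeasurable ?_) 1 (ae_of_all _ norm_m_le)
    exact Continuous.inv₀ (by fun_prop) ne_zero
  have m_neg (k : ℝ) : m (-k) = star (m k) := by simp [m]
  set f := multiplier memLp_m w
  have FT_sub : ∀ᵐ k, FT (f - w) k = (2 * Real.pi * k : ℝ) * Complex.I * FT f k := by
    rw [map_sub]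
    filter_upwards [Lp.coeFn_sub (FT f) (FT w), FT_multiplier memLp_m m_neg w] with k h1 h2
    have mul_m : (1 - (2 * Real.pi * k : ℝ) * Complex.I) * m k = 1 := mul_inv_cancel₀ (ne_zero k)
    rw [h1, Pi.sub_apply, h2]
    linear_combination FT w k * mul_m
  exact ⟨f, isWeakDeriv_of_FT_ae_eq FT_sub, FT_sub⟩

-- The functions `f` and `f'` are determined by `w = f - f'`, because no element of `H¹` other than
-- `0` is its own derivative; on the Fourier side `1 - ∂` can be inverted by division.
theorem IsWeakDeriv.FT_ae_eq {f g : L2} (h : IsWeakDeriv f g) :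
    ∀ᵐ k, FT g k = (2 * Real.pi * k : ℝ) * Complex.I * FT f k := by
  obtain ⟨u, hu, FT_u⟩ := exists_isWeakDeriv_sub (f - g)
  have mk_eq : H1.mk f g h = H1.mk u (u - (f - g)) hu := sub_eq_zero.1
    (H1.eq_zero_of_der_eq_val (by
      rw [map_sub, map_sub, val_mk, val_mk, der_mk, der_mk]
      abel))
  have f_eq : f = u := congrArg val mk_eq
  rwa [← f_eq, sub_sub_cancel] at FT_u

theorem isWeakDeriv_iff (f g : L2) : IsWeakDeriv f g ↔
    ∀ᵐ k, FT g k = (2 * Real.pi * k : ℝ) * Complex.I * FT f k :=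
  ⟨IsWeakDeriv.FT_ae_eq, isWeakDeriv_of_FT_ae_eq⟩

/-! ### The inverse Fourier integral -/

theorem integral_schwartz_mul_fourierInv {h : ℝ → ℂ} (hh : Integrable h) (θ : SchwartzMap ℝ ℂ) :
    ∫ x, θ x * 𝓕⁻ h x = ∫ k, (𝓕⁻ θ) k * h k := by
  have self_adjoint : ∫ x, 𝓕 (θ : ℝ → ℂ) x • h (-x) = ∫ x, θ x • 𝓕 (fun y => h (-y)) x := by
    simpa using! VectorFourier.integral_fourierIntegral_smul_eq_flip (L := innerₗ ℝ) (f := θ)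
      (g := fun y => h (-y)) Real.continuous_fourierChar continuous_inner θ.integrable hh.comp_neg
  simp only [smul_eq_mul] at self_adjoint
  rw [Real.fourierInv_eq_fourier_comp_neg, ← self_adjoint, ← integral_neg_eq_self]
  refine integral_congr_ae (ae_of_all _ fun x => ?_)
  simp only [neg_neg]
  congr 1

theorem continuous_fourierInv {h : ℝ → ℂ} (hh : Integrable h) : Continuous (𝓕⁻ h) := by
  rw [Real.fourierInv_eq_fourier_comp_neg]
  exact VectorFourier.fourierIntegral_continuous Real.continuous_fourierChar
    (innerSL ℝ).continuous₂ hh.comp_neg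

theorem norm_fourierInv_le (h : ℝ → ℂ) (x : ℝ) : ‖𝓕⁻ h x‖ ≤ ∫ k, ‖h k‖ := by
  rw [Real.fourierInv_eq]
  refine (norm_integral_le_integral_norm _).trans_eq ?_
  simp_rw [Circle.norm_smul]

theorem fourier_ae_eq_of_ae_eq_fourierInv {g : LC} {h : ℝ → ℂ} (hh : Integrable h)
    (hg : g =ᵐ[volume] 𝓕⁻ h) : (𝓕 g : LC) =ᵐ[volume] h := by
  refine ae_eq_of_integral_testSchwartz_mul_eq (locallyIntegrable_LC _) hh.locallyIntegrable
    fun θ hθ hc => ?_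
  set F := testSchwartz θ hθ hc
  calc ∫ x, F x * (𝓕 g : LC) x = ∫ x, (𝓕 F) x * g x := integral_schwartz_mul_fourier g F
    _ = ∫ x, (𝓕 F) x * 𝓕⁻ h x := by
        refine integral_congr_ae ?_
        filter_upwards [hg] with x hx
        rw [hx]
    _ = ∫ k, F k * h k := by
        rw [integral_schwartz_mul_fourierInv hh, FourierTransform.fourierInv_fourier_eq]

theorem ae_eq_fourierInv_of_fourier_ae_eq {g : LC} {h : ℝ → ℂ} (hh : Integrable h)
    (hg : (𝓕 g : LC) =ᵐ[volume] h) : g =ᵐ[volume] 𝓕⁻ h := by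
  refine ae_eq_of_integral_testSchwartz_mul_eq (locallyIntegrable_LC _)
    (continuous_fourierInv hh).locallyIntegrable fun θ hθ hc => ?_
  set F := testSchwartz θ hθ hc
  calc ∫ x, F x * g x = ∫ k, (𝓕⁻ F) k * (𝓕 g : LC) k := by
        rw [integral_schwartz_mul_fourier, FourierTransform.fourier_fourierInv_eq]
    _ = ∫ k, (𝓕⁻ F) k * h k := by
        refine integral_congr_ae ?_
        filter_upwards [hg] with x hx
        rw [hx]
    _ = ∫ x, F x * 𝓕⁻ h x := (integral_schwartz_mul_fourierInv hh F).symm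

/-! ### The operator `Q` -/

/-- The symbol `(1 + (2πk)²)^(1/2)` of `Q`, in the frequency normalization of Mathlib. -/
def symbQ (k : ℝ) : ℝ := Real.sqrt (symb k)

theorem symb_pos (k : ℝ) : 0 < symb k := by unfold symb; positivity

theorem symbQ_pos (k : ℝ) : 0 < symbQ k := Real.sqrt_pos.2 (symb_pos k)

theorem symbQ_sq (k : ℝ) : symbQ k ^ 2 = 1 + (2 * Real.pi * k) ^ 2 := Real.sq_sqrt (symb_pos k).le

theorem one_le_symbQ (k : ℝ) : 1 ≤ symbQ k := by
  have := symbQ_sq k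
  nlinarith [symbQ_pos k, sq_nonneg (2 * Real.pi * k)]

theorem abs_le_symbQ (k : ℝ) : |2 * Real.pi * k| ≤ symbQ k := by
  rw [← sq_le_sq₀ (abs_nonneg _) (symbQ_pos k).le, sq_abs, symbQ_sq]
  linarith

theorem continuous_symbQ : Continuous symbQ := by unfold symbQ symb; fun_prop

theorem symbQ_neg (k : ℝ) : symbQ (-k) = symbQ k := by simp [symbQ, symb]

theorem ofReal_symbQ_ne_zero (k : ℝ) : (symbQ k : ℂ) ≠ 0 := by exact_mod_cast (symbQ_pos k).ne'

theorem ofReal_symbQ_sq (k : ℝ) : (symbQ k : ℂ) ^ 2 = 1 + (2 * Real.pi * k) ^ 2 := by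
  exact_mod_cast symbQ_sq k

/-- The symbol of `Q⁻¹`. -/
def symbInvQ (k : ℝ) : ℂ := ((symbQ k)⁻¹ : ℝ)

/-- The symbol of `∂ₓ Q⁻¹`. -/
def symbDxInvQ (k : ℝ) : ℂ := (2 * Real.pi * k / symbQ k : ℝ) * Complex.I

theorem symbInvQ_neg (k : ℝ) : symbInvQ (-k) = star (symbInvQ k) := by
  simp [symbInvQ, symbQ_neg]

theorem symbDxInvQ_neg (k : ℝ) : symbDxInvQ (-k) = star (symbDxInvQ k) := by
  simp [symbDxInvQ, symbQ_neg, neg_div]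

theorem memLp_top_symbInvQ : MemLp symbInvQ ∞ volume := by
  refine memLp_top_of_bound (Continuous.aestronglyMeasurable ?_) 1 (ae_of_all _ fun k => ?_)
  · exact Complex.continuous_ofReal.comp (continuous_symbQ.inv₀ fun k => (symbQ_pos k).ne')
  · rw [symbInvQ, Complex.norm_real, Real.norm_of_nonneg (inv_nonneg.2 (symbQ_pos k).le)]
    exact inv_le_one_of_one_le₀ (one_le_symbQ k)

theorem memLp_top_symbDxInvQ : MemLp symbDxInvQ ∞ volume := by
  refine memLp_top_of_bound (Continuous.aestronglyMeasurable ?_) 1 (ae_of_all _ fun k => ?_)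
  · have : Continuous fun k : ℝ => 2 * Real.pi * k / symbQ k :=
      Continuous.div (by fun_prop) continuous_symbQ fun k => (symbQ_pos k).ne'
    exact (Complex.continuous_ofReal.comp this).mul continuous_const
  · rw [symbDxInvQ, norm_mul, Complex.norm_I, mul_one, Complex.norm_real, Real.norm_eq_abs,
      abs_div, abs_of_pos (symbQ_pos k)]
    exact (div_le_one (symbQ_pos k)).2 (abs_le_symbQ k)

/-- The operator `Q⁻¹` in `L²`. -/
def invQ : L2 →L[ℝ] L2 := multiplier memLp_top_symbInvQ

/-- The operator `∂ₓ Q⁻¹` in `L²`, bounded although `∂ₓ` is not. -/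
def dxInvQ : L2 →L[ℝ] L2 := multiplier memLp_top_symbDxInvQ

theorem FT_invQ (f : L2) : ∀ᵐ k, FT (invQ f) k = (symbQ k : ℂ)⁻¹ * FT f k := by
  filter_upwards [FT_multiplier memLp_top_symbInvQ symbInvQ_neg f] with k hk
  rw [invQ, hk, symbInvQ, Complex.ofReal_inv]

theorem FT_dxInvQ (f : L2) :
    ∀ᵐ k, FT (dxInvQ f) k = (2 * Real.pi * k / symbQ k) * Complex.I * FT f k := by
  filter_upwards [FT_multiplier memLp_top_symbDxInvQ symbDxInvQ_neg f] with k hk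
  rw [dxInvQ, hk, symbDxInvQ]
  push_cast
  rfl

theorem ext_FT {f g : L2} (h : ∀ᵐ k, FT f k = FT g k) : f = g := FT_injective (Lp.ext h)

theorem FT_sub_ae (f g : L2) : ∀ᵐ k, FT (f - g) k = FT f k - FT g k := by
  rw [map_sub]
  filter_upwards [Lp.coeFn_sub (FT f) (FT g)] with k hk
  rw [hk, Pi.sub_apply]

theorem invQ_invQ_sub_dxInvQ_dxInvQ (f : L2) : invQ (invQ f) - dxInvQ (dxInvQ f) = f := by
  apply ext_FT
  filter_upwards [FT_sub_ae (invQ (invQ f)) (dxInvQ (dxInvQ f)), FT_invQ (invQ f), FT_invQ f,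
    FT_dxInvQ (dxInvQ f), FT_dxInvQ f] with k h1 h2 h3 h4 h5
  rw [h1, h2, h3, h4, h5]
  have := ofReal_symbQ_ne_zero k
  field_simp
  rw [ofReal_symbQ_sq, Complex.I_sq]
  ring

theorem invQ_dxInvQ (f : L2) : invQ (dxInvQ f) = dxInvQ (invQ f) := by
  apply ext_FT
  filter_upwards [FT_invQ (dxInvQ f), FT_invQ f, FT_dxInvQ (invQ f), FT_dxInvQ f] with k h2 h3 h4 h5
  rw [h2, h4, h3, h5]
  ring

theorem isWeakDeriv_invQ (f : L2) : IsWeakDeriv (invQ f) (dxInvQ f) := by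
  rw [isWeakDeriv_iff]
  filter_upwards [FT_invQ f, FT_dxInvQ f] with k h1 h2
  rw [h1, h2]
  push_cast
  ring

theorem IsWeakDeriv.invQ {f g : L2} (h : IsWeakDeriv f g) : IsWeakDeriv (invQ f) (invQ g) := by
  rw [isWeakDeriv_iff] at *
  filter_upwards [FT_invQ f, FT_invQ g, h] with k h1 h2 h3
  rw [h1, h2, h3]
  ring

theorem IsWeakDeriv.dxInvQ {f g : L2} (h : IsWeakDeriv f g) :
    IsWeakDeriv (dxInvQ f) (dxInvQ g) := by
  rw [isWeakDeriv_iff] at *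
  filter_upwards [FT_dxInvQ f, FT_dxInvQ g, h] with k h1 h2 h3
  rw [h1, h2, h3]
  ring

theorem IsWeakDeriv.unique {f g g' : L2} (h : IsWeakDeriv f g) (h' : IsWeakDeriv f g') :
    g = g' := by
  rw [isWeakDeriv_iff] at *
  apply ext_FT
  filter_upwards [h, h'] with k h1 h2
  rw [h1, h2]

theorem IsWeakDeriv.dxInvQ_eq {f g : L2} (h : IsWeakDeriv f g) :
    StochCH.dxInvQ f = StochCH.invQ g :=
  (isWeakDeriv_invQ f).unique h.invQ

theorem IsWeakDeriv.sub {f g f' g' : L2} (h : IsWeakDeriv f f') (k : IsWeakDeriv g g') :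
    IsWeakDeriv (f - g) (f' - g') := by
  simpa only [sub_eq_add_neg, neg_one_smul] using h.add (k.smul (-1))

/-- The operator `Q` as a map from `H¹` to `L²`, written as `Q⁻¹ - (∂ₓ Q⁻¹) ∂ₓ`, that is, as
`Q⁻¹ (1 - ∂ₓ²)`. -/
def QL2 : H1 →L[ℝ] L2 := invQ.comp val - dxInvQ.comp der

theorem QL2_apply (f : H1) : QL2 f = invQ (val f) - dxInvQ (der f) := rfl

theorem invQ_QL2 (f : H1) : invQ (QL2 f) = val f := by
  rw [QL2_apply, map_sub, invQ_dxInvQ, ← (isWeakDeriv_val_der f).dxInvQ_eq,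
    invQ_invQ_sub_dxInvQ_dxInvQ]

theorem QL2_injective : Function.Injective QL2 := by
  rw [injective_iff_map_eq_zero]
  intro f hf
  apply H1.ext_val
  rw [← invQ_QL2, hf, map_zero, map_zero]

/-- The operator `Q` as a map from `H²` to `H¹`. -/
def QH2 : H2 →L[ℝ] H1 :=
  H1.lift (QL2.comp incl) (QL2.comp dx) (fun f => by
    have h1 := (isWeakDeriv_val_der (incl f)).invQ
    have h2 := (isWeakDeriv_val_der (dx f)).dxInvQ
    simp only [ContinuousLinearMap.comp_apply, QL2_apply, der_incl] at *
    exact h1.sub h2)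

/-- The operator `Q⁻¹` as a map from `H¹` to `H²`. -/
def invQH1 : H1 →L[ℝ] H2 :=
  H2.lift (H1.lift (invQ.comp val) (dxInvQ.comp val) fun _ => isWeakDeriv_invQ _)
    (H1.lift (dxInvQ.comp val) (dxInvQ.comp der) fun f => (isWeakDeriv_val_der f).dxInvQ)
    fun _ => rfl

theorem val_QH2 (f : H2) : val (QH2 f) = QL2 (incl f) := rfl

theorem val_incl_invQH1 (f : H1) : val (incl (invQH1 f)) = invQ (val f) := rfl

theorem val_dx_invQH1 (f : H1) : val (dx (invQH1 f)) = dxInvQ (val f) := rfl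

theorem der_incl_invQH1 (f : H1) : der (incl (invQH1 f)) = dxInvQ (val f) := rfl

theorem QL2_incl_invQH1 (f : H1) : QL2 (incl (invQH1 f)) = val f := by
  rw [QL2_apply, val_incl_invQH1, der_incl_invQH1, invQ_invQ_sub_dxInvQ_dxInvQ]

/-- `Q` as an isomorphism of `H²` onto `H¹`. -/
def QE : H2 ≃L[ℝ] H1 :=
  ContinuousLinearEquiv.equivOfInverse QH2 invQH1
    (fun f => by
      apply incl_injective
      apply H1.ext_val
      rw [val_incl_invQH1, val_QH2, invQ_QL2])
    (fun f => by
      apply H1.ext_val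
      rw [val_QH2, QL2_incl_invQH1])

theorem QE_apply (f : H2) : QE f = QH2 f := rfl

theorem FT_QL2 (f : H1) : ∀ᵐ k, FT (QL2 f) k = (symbQ k : ℂ) * FT (val f) k := by
  have h := FT_invQ (QL2 f)
  rw [invQ_QL2] at h
  filter_upwards [h] with k hk
  rw [hk, mul_inv_cancel_left₀ (ofReal_symbQ_ne_zero k)]

theorem isQ_QE (f : H2) : IsQ (rep (incl f)) (rep (QE f)) := by
  rw [IsQ, fourierL2_eq_FT (rep_ae_eq_val (incl f)), fourierL2_eq_FT (rep_ae_eq_val (QE f)),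
    QE_apply, val_QH2]
  exact FT_QL2 _

theorem dx_invQH1_incl (f : H2) : dx (invQH1 (incl f)) = incl (invQH1 (dx f)) := by
  apply H1.ext_val
  rw [val_dx_invQH1, val_incl_invQH1, ← der_incl, (isWeakDeriv_val_der (incl f)).dxInvQ_eq]

theorem norm_sq_eq_integral_FT (f : L2) : ‖f‖ ^ 2 = ∫ k, ‖FT f k‖ ^ 2 := by
  rw [← norm_FT, ← @inner_self_eq_norm_sq ℂ, L2.inner_def, ← integral_re]
  · exact integral_congr_ae (ae_of_all _ fun k => inner_self_eq_norm_sq (𝕜 := ℂ) (FT f k))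
  · exact L2.integrable_inner (FT f) (FT f)

theorem norm_QL2 (f : H1) : ‖QL2 f‖ = ‖f‖ := by
  rw [← sq_eq_sq₀ (norm_nonneg _) (norm_nonneg _), H1.norm_sq_eq, norm_sq_eq_integral_FT,
    norm_sq_eq_integral_FT, norm_sq_eq_integral_FT, ← integral_add
      ((Lp.memLp (FT (val f))).integrable_norm_pow (by norm_num))
      ((Lp.memLp (FT (der f))).integrable_norm_pow (by norm_num))]
  refine integral_congr_ae ?_
  filter_upwards [FT_QL2 f, (isWeakDeriv_val_der f).FT_ae_eq] with k h1 h2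
  rw [h1, h2]
  simp only [norm_mul, mul_pow, Complex.norm_real, Complex.norm_I, Real.norm_eq_abs, sq_abs,
    symbQ_sq]
  ring

theorem inner_QL2 (f g : H1) : inner ℝ (QL2 f) (QL2 g) = inner ℝ f g :=
  (LinearMap.norm_map_iff_inner_map_map QL2).1 norm_QL2 f g

theorem inner_invQ_left (f g : L2) : inner ℝ (invQ f) g = inner ℝ f (invQ g) := by
  rw [inner_FT, inner_FT, L2.inner_def, L2.inner_def]
  congr 1
  refine integral_congr_ae ?_
  filter_upwards [FT_invQ f, FT_invQ g] with k h1 h2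
  rw [h1, h2, ← Complex.ofReal_inv, RCLike.inner_apply', RCLike.inner_apply', map_mul,
    Complex.conj_ofReal]
  ring

theorem denseRange_incl : DenseRange incl := by
  suffices (LinearMap.range incl.toLinearMap).topologicalClosure = ⊤ from
    Submodule.dense_iff_topologicalClosure_eq_top.2 this
  rw [Submodule.topologicalClosure_eq_top_iff, Submodule.eq_bot_iff]
  intro g hg
  have orthogonal : inner ℝ (incl (invQH1 (incl (invQH1 g)))) g = 0 := hg _ ⟨_, rfl⟩
  have inner_eq : inner ℝ (incl (invQH1 (incl (invQH1 g)))) g = inner ℝ (val g) (val g) := by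
    rw [← inner_QL2, QL2_incl_invQH1, val_incl_invQH1, inner_invQ_left, invQ_QL2]
  apply H1.ext_val
  rw [map_zero, ← inner_self_eq_zero (𝕜 := ℝ), ← inner_eq, orthogonal]

/-! ### The embedding of `H¹` into bounded functions -/

theorem integrable_symbQ_inv_sq : Integrable fun k => (symbQ k)⁻¹ ^ 2 := by
  have h := (integrable_inv_one_add_sq).comp_mul_left' (R := 2 * Real.pi) (by positivity)
  refine h.congr (ae_of_all _ fun k => ?_)
  simp only [inv_pow, symbQ_sq]

theorem memLp_two_symbInvQ : MemLp symbInvQ 2 volume := by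
  rw [memLp_two_iff_integrable_sq_norm memLp_top_symbInvQ.1]
  refine integrable_symbQ_inv_sq.congr (ae_of_all _ fun k => ?_)
  simp only [symbInvQ, Complex.norm_real, Real.norm_eq_abs, sq_abs]

/-- The `L²` norm of the symbol of `Q⁻¹`, a constant for the embedding of `H¹` into the bounded
functions. -/
def sobolevConst : ℝ := ‖memLp_two_symbInvQ.toLp‖

theorem sobolevConst_nonneg : 0 ≤ sobolevConst := norm_nonneg _

-- On the Fourier side an element of `H¹` is the product of two square integrable functions.
theorem integrable_FT_and_integral_le (f : H1) :
    Integrable (FT (val f)) ∧ ∫ k, ‖FT (val f) k‖ ≤ sobolevConst * ‖f‖ := by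
  set P : Lp ℂ 1 volume :=
    (ContinuousLinearMap.mul ℂ ℂ).holder 1 memLp_two_symbInvQ.toLp (FT (QL2 f))
  have P_ae_eq : P =ᵐ[volume] FT (val f) := by
    filter_upwards [(ContinuousLinearMap.mul ℂ ℂ).coeFn_holder (r := 1) memLp_two_symbInvQ.toLp
      (FT (QL2 f)), memLp_two_symbInvQ.coeFn_toLp, FT_QL2 f] with k h1 h2 h3
    rw [h1, h2, h3, ContinuousLinearMap.mul_apply', symbInvQ, Complex.ofReal_inv,
      inv_mul_cancel_left₀ (ofReal_symbQ_ne_zero k)]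
  refine ⟨(L1.integrable_coeFn P).congr P_ae_eq, ?_⟩
  calc ∫ k, ‖FT (val f) k‖ = ‖P‖ := by
        rw [L1.norm_eq_integral_norm]
        exact integral_congr_ae (P_ae_eq.symm.fun_comp norm)
    _ ≤ ‖ContinuousLinearMap.mul ℂ ℂ‖ * sobolevConst * ‖FT (QL2 f)‖ :=
        ContinuousLinearMap.norm_holder_apply_apply_le _ _ _
    _ = sobolevConst * ‖f‖ := by rw [ContinuousLinearMap.opNorm_mul, one_mul, norm_FT, norm_QL2]

theorem rep_eq_fourierInv (f : H1) (x : ℝ) : (rep f x : ℂ) = 𝓕⁻ (FT (val f) : ℝ → ℂ) x := by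
  have integrable_FT := (integrable_FT_and_integral_le f).1
  have ae_eq : (fun x => (rep f x : ℂ)) =ᵐ[volume] 𝓕⁻ (FT (val f) : ℝ → ℂ) := by
    filter_upwards [ae_eq_fourierInv_of_fourier_ae_eq (g := toC (val f)) integrable_FT .rfl,
      coeFn_toC (val f), rep_ae_eq_val f] with x h1 h2 h3
    rw [← h1, h2, h3]
  exact congrFun (((Complex.continuous_ofReal.comp (rep_continuous f)).ae_eq_iff_eq volume
    (continuous_fourierInv integrable_FT)).1 ae_eq) x

theorem abs_rep_le (f : H1) (x : ℝ) : |rep f x| ≤ sobolevConst * ‖f‖ := by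
  rw [← Real.norm_eq_abs, ← Complex.norm_real, rep_eq_fourierInv]
  exact (norm_fourierInv_le _ x).trans (integrable_FT_and_integral_le f).2

/-- The operator `Q⁻²` as a map from `L²` to `H¹`. -/
def invQ2 : L2 →L[ℝ] H1 :=
  H1.lift (invQ.comp invQ) (dxInvQ.comp invQ) fun _ => isWeakDeriv_invQ _

/-- The operator `∂ₓ Q⁻²` as a map from `L²` to `H¹`. -/
def dxInvQ2 : L2 →L[ℝ] H1 :=
  H1.lift (dxInvQ.comp invQ) (dxInvQ.comp dxInvQ) fun f => (isWeakDeriv_invQ f).dxInvQ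

theorem der_invQ2 (w : L2) : der (invQ2 w) = val (dxInvQ2 w) := rfl

theorem der_dxInvQ2 (w : L2) : der (dxInvQ2 w) = val (invQ2 w) - w := by
  change dxInvQ (dxInvQ w) = invQ (invQ w) - w
  exact eq_sub_of_add_eq (by rw [add_comm, ← sub_eq_iff_eq_add.1 (invQ_invQ_sub_dxInvQ_dxInvQ w)])

theorem invQsq_eq_rep {w : ℝ → ℝ} {f : L2} (h : w =ᵐ[volume] f) : invQsq w = rep (invQ2 f) := by
  funext x
  rw [invQsq, fourierL2_eq_FT h, ← Complex.ofReal_re (rep (invQ2 f) x), rep_eq_fourierInv]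
  congr 1
  refine Real.fourierInv_congr_ae ?_ x
  filter_upwards [FT_invQ (invQ f), FT_invQ f] with k h1 h2
  change _ = FT (invQ (invQ f)) k
  rw [h1, h2, ← mul_assoc, ← mul_inv, ← sq, ofReal_symbQ_sq]
  simp [symb]

theorem deriv_invQsq_eq_rep {w : ℝ → ℝ} {f : L2} (h : w =ᵐ[volume] f) :
    deriv (invQsq w) = rep (dxInvQ2 f) := by
  rw [invQsq_eq_rep h]
  funext x
  exact (hasDerivAt_rep (rep_continuous _) (der_invQ2 f ▸ rep_ae_eq_val _) x).deriv

/-! ### Multiplication in `H¹` and `H²` -/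

theorem memLp_top_rep (f : H1) : MemLp (rep f) ∞ volume :=
  memLp_top_of_bound (rep_continuous f).aestronglyMeasurable _ (ae_of_all _ (abs_rep_le f))

/-- The embedding of `H¹` into `L^∞`. -/
def toLinfty : H1 →L[ℝ] Lp ℝ ∞ (volume : Measure ℝ) :=
  LinearMap.mkContinuous
    { toFun := fun f => (memLp_top_rep f).toLp
      map_add' := fun f g => by simp only [rep_add]; rfl
      map_smul' := fun c f => by simp only [rep_smul]; rfl }
    sobolevConst fun f => by
      change ‖(memLp_top_rep f).toLp‖ ≤ sobolevConst * ‖f‖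
      rw [Lp.norm_toLp, eLpNorm_exponent_top]
      exact ENNReal.toReal_le_of_le_ofReal (mul_nonneg sobolevConst_nonneg (norm_nonneg f))
        (eLpNormEssSup_le_of_ae_bound (ae_of_all _ (abs_rep_le f)))

/-- The product of an element of `H¹` and an element of `L²`. -/
def mulL : H1 →L[ℝ] L2 →L[ℝ] L2 :=
  ((ContinuousLinearMap.mul ℝ ℝ).holderL volume ∞ 2 2).comp toLinfty

theorem coeFn_mulL (f : H1) (g : L2) : mulL f g =ᵐ[volume] fun x => rep f x * g x :=
  coeFn_mulLp (memLp_top_rep f) g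

theorem norm_mulL_le (f : H1) (g : L2) : ‖mulL f g‖ ≤ sobolevConst * ‖f‖ * ‖g‖ :=
  norm_mulLp_apply_le (memLp_top_rep f) (abs_rep_le f) g

theorem mulL_val_comm (f g : H1) : mulL f (val g) = mulL g (val f) := by
  apply Lp.ext
  filter_upwards [coeFn_mulL f (val g), coeFn_mulL g (val f), rep_ae_eq_val f,
    rep_ae_eq_val g] with x h1 h2 h3 h4
  rw [h1, h2, ← h3, ← h4, mul_comm]

theorem isWeakDeriv_mulL (f g : H1) :
    IsWeakDeriv (mulL f (val g)) (mulL f (der g) + mulL g (der f)) := by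
  refine DenseRange.induction_on₂ (p := fun f g : H1 =>
    IsWeakDeriv (mulL f (val g)) (mulL f (der g) + mulL g (der f))) denseRange_incl ?_ ?_ f g
  · exact isClosed_isWeakDeriv.preimage (f := fun q : H1 × H1 =>
      (mulL q.1 (val q.2), mulL q.1 (der q.2) + mulL q.2 (der q.1))) (by fun_prop)
  · intro f g
    refine isWeakDeriv_of_hasDerivAt
      (fun x => (hasDerivAt_rep_incl f x).mul (hasDerivAt_rep_incl g x)) ?_ ?_
    · filter_upwards [coeFn_mulL (incl f) (val (incl g)), rep_ae_eq_val (incl g)] with x h1 h2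
      rw [h1, ← h2]; rfl
    · filter_upwards [coeFn_mulL (incl f) (der (incl g)), coeFn_mulL (incl g) (der (incl f)),
        Lp.coeFn_add (mulL (incl f) (der (incl g))) (mulL (incl g) (der (incl f))),
        rep_ae_eq_val (dx f), rep_ae_eq_val (dx g)] with x h1 h2 h3 h4 h5
      rw [h3, Pi.add_apply, h1, h2, der_incl, der_incl, ← h4, ← h5]
      ring

/-- Multiplication in `H¹`. -/
def mulH1 : H1 →L[ℝ] H1 →L[ℝ] H1 :=
  LinearMap.mkContinuous₂
    (LinearMap.mk₂ ℝ (fun f g => H1.mk _ _ (isWeakDeriv_mulL f g))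
      (fun f f' g => H1.ext_val (by simp))
      (fun c f g => H1.ext_val (by simp))
      (fun f g g' => H1.ext_val (by simp))
      (fun c f g => H1.ext_val (by simp)))
    (3 * sobolevConst) fun f g => by
      have bound (f : H1) {g : L2} {a : ℝ} (hg : ‖g‖ ≤ a) : ‖mulL f g‖ ≤ sobolevConst * ‖f‖ * a :=
        (norm_mulL_le f g).trans
          (mul_le_mul_of_nonneg_left hg (mul_nonneg sobolevConst_nonneg (norm_nonneg f)))
      calc ‖H1.mk _ _ (isWeakDeriv_mulL f g)‖
          ≤ ‖mulL f (val g)‖ + ‖mulL f (der g) + mulL g (der f)‖ := H1.norm_le_add _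
        _ ≤ ‖mulL f (val g)‖ + (‖mulL f (der g)‖ + ‖mulL g (der f)‖) := by
            gcongr
            exact norm_add_le _ _
        _ ≤ 3 * sobolevConst * ‖f‖ * ‖g‖ := by
            linarith [bound f (norm_val_le g), bound f (norm_der_le g), bound g (norm_der_le f)]

theorem val_mulH1 (f g : H1) : val (mulH1 f g) = mulL f (val g) := rfl

theorem der_mulH1 (f g : H1) : der (mulH1 f g) = mulL f (der g) + mulL g (der f) := rfl

theorem rep_mulH1 (f g : H1) : rep (mulH1 f g) = fun x => rep f x * rep g x := by
  refine rep_eq_of_ae_eq_val ((rep_continuous f).mul (rep_continuous g)) ?_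
  filter_upwards [coeFn_mulL f (val g), rep_ae_eq_val g] with x h1 h2
  rw [val_mulH1, h1, ← h2]

/-- Multiplication in `H²`. -/
def mulH2 : H2 →L[ℝ] H2 →L[ℝ] H2 :=
  LinearMap.mkContinuous₂
    (LinearMap.mk₂ ℝ (fun f g => H2.mk (mulH1 (incl f) (incl g))
        (mulH1 (dx f) (incl g) + mulH1 (incl f) (dx g)) (by
          rw [der_mulH1, map_add, val_mulH1, val_mulH1, der_incl, der_incl,
            mulL_val_comm (dx f), add_comm]))
      (fun f f' g => incl_injective (by simp))
      (fun c f g => incl_injective (by simp))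
      (fun f g g' => incl_injective (by simp))
      (fun c f g => incl_injective (by simp)))
    (3 * ‖mulH1‖) fun f g => by
      have bound {u v : H1} (hu : ‖u‖ ≤ ‖f‖) (hv : ‖v‖ ≤ ‖g‖) :
          ‖mulH1 u v‖ ≤ ‖mulH1‖ * ‖f‖ * ‖g‖ :=
        (mulH1.le_opNorm₂ u v).trans (by gcongr)
      refine (H2.norm_le_add _).trans ?_
      rw [LinearMap.mk₂_apply, incl_mk, dx_mk]
      linarith [norm_add_le (mulH1 (dx f) (incl g)) (mulH1 (incl f) (dx g)),
        bound (norm_incl_le f) (norm_incl_le g), bound (norm_dx_le f) (norm_incl_le g),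
        bound (norm_incl_le f) (norm_dx_le g)]

theorem incl_mulH2 (f g : H2) : incl (mulH2 f g) = mulH1 (incl f) (incl g) := rfl

/-! ### Products and convolutions -/

open Convolution in
theorem FT_mulH1 (f g : H1) : FT (val (mulH1 f g)) =ᵐ[volume]
    (FT (val f) : ℝ → ℂ) ⋆[ContinuousLinearMap.mul ℂ ℂ] (FT (val g) : ℝ → ℂ) := by
  have hf := (integrable_FT_and_integral_le f).1
  have hg := (integrable_FT_and_integral_le g).1
  rw [FT_apply]
  refine fourier_ae_eq_of_ae_eq_fourierInv (hf.integrable_convolution _ hg) ?_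
  filter_upwards [coeFn_toC (val (mulH1 f g)), rep_ae_eq_val (mulH1 f g)] with x h1 h2
  rw [h1, ← h2, rep_mulH1, Complex.ofReal_mul, rep_eq_fourierInv, rep_eq_fourierInv,
    Real.fourierInv_eq_fourier_neg, Real.fourierInv_eq_fourier_neg,
    Real.fourierInv_eq_fourier_neg, Real.fourier_mul_convolution_eq hf hg]

section Young

variable {X : Type*} [MeasurableSpace X] {μ : Measure X}

theorem sq_lintegral_le {f : X → ℝ≥0∞} (hf : AEMeasurable f μ) :
    (∫⁻ x, f x ∂μ) ^ 2 ≤ μ Set.univ * ∫⁻ x, f x ^ 2 ∂μ := by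
  have half_add_half : (1 / 2 : ℝ) * 2 = 1 := by norm_num
  have holder := ENNReal.lintegral_mul_le_Lp_mul_Lq μ Real.HolderConjugate.two_two
    aemeasurable_const (f := 1) hf
  simp only [one_mul, Pi.one_apply, ENNReal.rpow_two, one_pow, lintegral_one] at holder
  calc (∫⁻ x, f x ∂μ) ^ 2
      ≤ (μ Set.univ ^ (1 / 2 : ℝ) * (∫⁻ x, f x ^ 2 ∂μ) ^ (1 / 2 : ℝ)) ^ 2 := by gcongr
    _ = μ Set.univ * ∫⁻ x, f x ^ 2 ∂μ := by
      rw [mul_pow, ← ENNReal.rpow_two, ← ENNReal.rpow_two, ← ENNReal.rpow_mul,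
        ← ENNReal.rpow_mul, half_add_half, ENNReal.rpow_one, ENNReal.rpow_one]

theorem sq_lintegral_mul_le {w f : X → ℝ≥0∞} (hw : Measurable w) (hf : Measurable f) :
    (∫⁻ x, w x * f x ∂μ) ^ 2 ≤ (∫⁻ x, w x ∂μ) * ∫⁻ x, w x * f x ^ 2 ∂μ := by
  have h := sq_lintegral_le (μ := μ.withDensity w) hf.aemeasurable
  rwa [withDensity_apply _ .univ, Measure.restrict_univ,
    lintegral_withDensity_eq_lintegral_mul _ hw hf,
    lintegral_withDensity_eq_lintegral_mul _ hw (hf.pow_const 2)] at h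

variable [AddCommGroup X] [MeasurableAdd₂ X] [MeasurableNeg X] [SFinite μ]
  [μ.IsAddRightInvariant]

/- Young's inequality `‖w ⋆ f‖₂ ≤ ‖w‖₁ ‖f‖₂`, by the Cauchy–Schwarz inequality for the measure
with density `w`. -/
theorem lintegral_sq_convolution_le {w f : X → ℝ≥0∞} (hw : Measurable w) (hf : Measurable f) :
    ∫⁻ k, (∫⁻ m, w m * f (k - m) ∂μ) ^ 2 ∂μ ≤ (∫⁻ m, w m ∂μ) ^ 2 * ∫⁻ m, f m ^ 2 ∂μ := by
  have measurable_uncurry : Measurable fun p : X × X => w p.2 * f (p.1 - p.2) ^ 2 :=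
    (hw.comp measurable_snd).mul ((hf.comp (measurable_fst.sub measurable_snd)).pow_const _)
  calc ∫⁻ k, (∫⁻ m, w m * f (k - m) ∂μ) ^ 2 ∂μ
      ≤ ∫⁻ k, (∫⁻ m, w m ∂μ) * ∫⁻ m, w m * f (k - m) ^ 2 ∂μ ∂μ :=
        lintegral_mono fun k =>
          sq_lintegral_mul_le hw (hf.comp (measurable_const.sub measurable_id))
    _ = (∫⁻ m, w m ∂μ) * ∫⁻ m, ∫⁻ k, w m * f (k - m) ^ 2 ∂μ ∂μ := by
        rw [lintegral_const_mul _ measurable_uncurry.lintegral_prod_right',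
          lintegral_lintegral_swap measurable_uncurry.aemeasurable]
    _ = (∫⁻ m, w m ∂μ) * ∫⁻ m, w m * ∫⁻ k, f k ^ 2 ∂μ ∂μ := by
        congr! 3 with m
        rw [lintegral_sub_right_eq_self (fun k => w m * f k ^ 2) m,
          lintegral_const_mul _ (hf.pow_const 2)]
    _ = (∫⁻ m, w m ∂μ) ^ 2 * ∫⁻ m, f m ^ 2 ∂μ := by
        rw [lintegral_mul_const _ hw, ← mul_assoc, sq]

theorem ofReal_norm_sq_eq_lintegral {X E : Type*} [MeasurableSpace X] {μ : Measure X}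
    [NormedAddCommGroup E] (g : Lp E 2 μ) :
    ENNReal.ofReal (‖g‖ ^ 2) = ∫⁻ x, ‖g x‖ₑ ^ 2 ∂μ := by
  rw [ENNReal.ofReal_pow (norm_nonneg _), Lp.norm_def,
    ENNReal.ofReal_toReal (Lp.eLpNorm_ne_top g),
    eLpNorm_eq_lintegral_rpow_enorm_toReal two_ne_zero ENNReal.ofNat_ne_top, ← ENNReal.rpow_two,
    ← ENNReal.rpow_mul]
  simp

end Young

/-! ### The commutator of `Q` with a multiplication -/

/-- The commutator `[Q, α]` of `Q` and the multiplication by `α`, as a map from `H²` to `H¹`. -/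
def commQ (α : H2) : H2 →L[ℝ] H1 := QH2.comp (mulH2 α) - (mulH1 (incl α)).comp QH2

theorem commQ_apply (α f : H2) :
    commQ α f = QH2 (mulH2 α f) - mulH1 (incl α) (QH2 f) := rfl

theorem abs_symbQ_sub_le (k l : ℝ) : |symbQ k - symbQ l| ≤ |2 * Real.pi * (k - l)| := by
  have sum_pos : 0 < symbQ k + symbQ l := add_pos (symbQ_pos k) (symbQ_pos l)
  have difference_of_squares : (symbQ k - symbQ l) * (symbQ k + symbQ l) =
      (2 * Real.pi * (k - l)) * (2 * Real.pi * k + 2 * Real.pi * l) := by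
    linear_combination symbQ_sq k - symbQ_sq l
  refine le_of_mul_le_mul_right ?_ sum_pos
  calc |symbQ k - symbQ l| * (symbQ k + symbQ l)
      = |2 * Real.pi * (k - l)| * |2 * Real.pi * k + 2 * Real.pi * l| := by
        rw [← abs_mul, ← difference_of_squares, abs_mul, abs_of_pos sum_pos]
    _ ≤ |2 * Real.pi * (k - l)| * (symbQ k + symbQ l) := by
        gcongr
        exact (abs_add_le _ _).trans (add_le_add (abs_le_symbQ k) (abs_le_symbQ l))

theorem symbQ_mul_abs_symbQ_sub_le (k m : ℝ) :
    symbQ k * |symbQ k - symbQ (k - m)| ≤ 2 * symbQ m ^ 2 * symbQ (k - m) := by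
  have abs_sub_le := abs_symbQ_sub_le k (k - m)
  rw [sub_sub_cancel] at abs_sub_le
  set s := |2 * Real.pi * m| with hs
  have hs0 : 0 ≤ s := abs_nonneg _
  have symbQ_m_sq : symbQ m ^ 2 = 1 + s ^ 2 := by rw [symbQ_sq, hs, sq_abs]
  have one_le := one_le_symbQ (k - m)
  have symbQ_k_le : symbQ k ≤ symbQ (k - m) * (1 + s) := by
    have := (le_abs_self _).trans abs_sub_le
    nlinarith
  calc symbQ k * |symbQ k - symbQ (k - m)| ≤ (symbQ (k - m) * (1 + s)) * s := by gcongr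
    _ = ((1 + s) * s) * symbQ (k - m) := by ring
    _ ≤ 2 * symbQ m ^ 2 * symbQ (k - m) := by
        rw [symbQ_m_sq]
        refine mul_le_mul_of_nonneg_right ?_ (by linarith)
        nlinarith [sq_nonneg (s - 1)]

section

variable {α : H2} {γ : H1}

theorem FT_incl_sub (hγ : der (dx α) = val γ) :
    ∀ᵐ k, FT (val (incl α - γ)) k = (symbQ k : ℂ) ^ 2 * FT (val (incl α)) k := by
  rw [map_sub]
  filter_upwards [FT_sub_ae (val (incl α)) (val γ), (isWeakDeriv_val_der (incl α)).FT_ae_eq,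
    (isWeakDeriv_val_der (dx α)).FT_ae_eq] with k h1 h2 h3
  rw [h1, ← hγ, h3, ← der_incl, h2, ofReal_symbQ_sq]
  push_cast
  linear_combination (-(2 * Real.pi * k) ^ 2 * FT (val (incl α)) k) * Complex.I_sq

theorem FT_QL2_commQ (α f : H2) :
    ∀ᵐ k, FT (QL2 (commQ α f)) k =
      ∫ m, ((symbQ k * (symbQ k - symbQ (k - m)) : ℝ) : ℂ) *
        (FT (val (incl α)) m * FT (val (incl f)) (k - m)) := by
  have integrable_FT (g : H1) := (integrable_FT_and_integral_le g).1
  filter_upwards [FT_QL2 (commQ α f), FT_sub_ae (val (QH2 (mulH2 α f)))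
    (val (mulH1 (incl α) (QH2 f))), FT_QL2 (incl (mulH2 α f)),
    FT_mulH1 (incl α) (incl f), FT_mulH1 (incl α) (QH2 f),
    (integrable_FT (incl α)).ae_convolution_exists (ContinuousLinearMap.mul ℂ ℂ)
      (integrable_FT (incl f)),
    (integrable_FT (incl α)).ae_convolution_exists (ContinuousLinearMap.mul ℂ ℂ)
      (integrable_FT (QH2 f))] with k h1 h2 h3 h4 h5 hf hg
  rw [h1, commQ_apply, map_sub, h2, val_QH2, h3, incl_mulH2, h4, h5, convolution_def,
    convolution_def, ← integral_const_mul, ← integral_sub (hf.integrable.const_mul _) hg.integrable,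
    ← integral_const_mul]
  refine integral_congr_ae ?_
  filter_upwards [(quasiMeasurePreserving_sub_left volume k).ae (FT_QL2 (incl f))] with m hm
  rw [ContinuousLinearMap.mul_apply', ContinuousLinearMap.mul_apply', val_QH2, hm]
  push_cast
  ring

theorem enorm_FT_QL2_commQ_le (hγ : der (dx α) = val γ) (f : H2) :
    ∀ᵐ k, ‖FT (QL2 (commQ α f)) k‖ₑ ≤
      ∫⁻ m, 2 * ‖FT (val (incl α - γ)) m‖ₑ * ‖FT (val (QH2 f)) (k - m)‖ₑ := by
  filter_upwards [FT_QL2_commQ α f] with k hk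
  rw [hk]
  refine (enorm_integral_le_lintegral_enorm _).trans (lintegral_mono_ae ?_)
  filter_upwards [FT_incl_sub hγ,
    (quasiMeasurePreserving_sub_left volume k).ae (FT_QL2 (incl f))] with m hα hf
  rw [hα, val_QH2, hf]
  set A := FT (val (incl α)) m
  set F := FT (val (incl f)) (k - m)
  have norm_le : ‖((symbQ k * (symbQ k - symbQ (k - m)) : ℝ) : ℂ) * (A * F)‖ ≤
      ‖2 * ((symbQ m : ℂ) ^ 2 * A) * ((symbQ (k - m) : ℂ) * F)‖ := by
    simp only [norm_mul, norm_pow, Complex.norm_real, Real.norm_eq_abs, abs_of_pos (symbQ_pos _),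
      Complex.norm_ofNat]
    calc symbQ k * |symbQ k - symbQ (k - m)| * (‖A‖ * ‖F‖)
        ≤ 2 * symbQ m ^ 2 * symbQ (k - m) * (‖A‖ * ‖F‖) :=
          mul_le_mul_of_nonneg_right (symbQ_mul_abs_symbQ_sub_le k m) (by positivity)
      _ = 2 * (symbQ m ^ 2 * ‖A‖) * (symbQ (k - m) * ‖F‖) := by ring
  have enorm_two : ‖(2 : ℂ)‖ₑ = 2 := by simp [enorm_eq_nnnorm]
  simpa only [enorm_mul, enorm_two] using enorm_le_iff_norm_le.2 norm_le

theorem lintegral_enorm_FT_val_le (f : H1) :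
    ∫⁻ k, ‖FT (val f) k‖ₑ ≤ ENNReal.ofReal (sobolevConst * ‖f‖) := by
  obtain ⟨integrable_FT, integral_le⟩ := integrable_FT_and_integral_le f
  rw [← ofReal_integral_norm_eq_lintegral_enorm integrable_FT]
  exact ENNReal.ofReal_le_ofReal integral_le

/- With `γ = α''` the condition says that `α` lies in `H³`, and `α - γ = Q² α`. -/
theorem norm_commQ_le (hγ : der (dx α) = val γ) (f : H2) :
    ‖commQ α f‖ ≤ 2 * sobolevConst * ‖incl α - γ‖ * ‖incl f‖ := by
  have measurable_enorm (g : LC) : Measurable fun k => ‖g k‖ₑ :=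
    (Lp.stronglyMeasurable g).measurable.enorm
  have const_nonneg := sobolevConst_nonneg
  refine (sq_le_sq₀ (norm_nonneg _) (by positivity)).1 ?_
  rw [← ENNReal.ofReal_le_ofReal_iff (by positivity), ← norm_QL2, ← norm_FT,
    ofReal_norm_sq_eq_lintegral]
  calc ∫⁻ k, ‖FT (QL2 (commQ α f)) k‖ₑ ^ 2
      ≤ ∫⁻ k, (∫⁻ m, 2 * ‖FT (val (incl α - γ)) m‖ₑ * ‖FT (val (QH2 f)) (k - m)‖ₑ) ^ 2 :=
        lintegral_mono_ae ((enorm_FT_QL2_commQ_le hγ f).mono fun _ hk => by gcongr)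
    _ ≤ (∫⁻ m, 2 * ‖FT (val (incl α - γ)) m‖ₑ) ^ 2 * ∫⁻ m, ‖FT (val (QH2 f)) m‖ₑ ^ 2 :=
        lintegral_sq_convolution_le ((measurable_enorm _).const_mul 2) (measurable_enorm _)
    _ ≤ (2 * ENNReal.ofReal (sobolevConst * ‖incl α - γ‖)) ^ 2 * ENNReal.ofReal (‖incl f‖ ^ 2) := by
        rw [lintegral_const_mul _ (measurable_enorm _), ← ofReal_norm_sq_eq_lintegral, norm_FT,
          val_QH2, norm_QL2]
        gcongr
        exact lintegral_enorm_FT_val_le _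
    _ = ENNReal.ofReal ((2 * sobolevConst * ‖incl α - γ‖ * ‖incl f‖) ^ 2) := by
        rw [← ENNReal.ofReal_ofNat 2, ← ENNReal.ofReal_mul zero_le_two,
          ← ENNReal.ofReal_pow (by positivity), ← ENNReal.ofReal_mul (by positivity), ← mul_pow]
        ring_nf

/-- The continuous extension of the commutator `[Q, α]` to `H¹`. It is `0` by convention unless
the commutator is bounded in the norm of `H¹`. -/
def commExt (α : H2) : H1 →L[ℝ] H1 :=
  LinearMap.extendOfNorm (commQ α).toLinearMap incl.toLinearMap

theorem commExt_incl (hγ : der (dx α) = val γ) (f : H2) : commExt α (incl f) = commQ α f :=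
  LinearMap.extendOfNorm_eq (f := (commQ α).toLinearMap) (e := incl.toLinearMap) denseRange_incl
    ⟨_, norm_commQ_le hγ⟩ f

theorem norm_commExt_le (hγ : der (dx α) = val γ) :
    ‖commExt α‖ ≤ 2 * sobolevConst * ‖incl α - γ‖ :=
  LinearMap.opNorm_extendOfNorm_le (f := (commQ α).toLinearMap) (e := incl.toLinearMap)
    denseRange_incl (by have := sobolevConst_nonneg; positivity) (norm_commQ_le hγ)

theorem commExt_sub {α' : H2} {γ' : H1} (hγ : der (dx α) = val γ)
    (hγ' : der (dx α') = val γ') : commExt α - commExt α' = commExt (α - α') := by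
  have h : der (dx (α - α')) = val (γ - γ') := by simp only [map_sub, hγ, hγ']
  refine DFunLike.coe_injective (denseRange_incl.equalizer (by fun_prop) (by fun_prop) ?_)
  funext f
  change commExt α (incl f) - commExt α' (incl f) = commExt (α - α') (incl f)
  rw [commExt_incl hγ, commExt_incl hγ', commExt_incl h]
  simp only [commQ_apply, map_sub, sub_apply]
  abel

end

/-! ### First order differential operators -/

/-- The operator `f ↦ α f' + β f` from `H²` to `H¹`. -/
def opL (α β : H1) : H2 →L[ℝ] H1 := (mulH1 α).comp dx + (mulH1 β).comp incl

/-- The operator `f ↦ α f' + β f` from `H¹` to `L²`. -/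
def opLL2 (α β : H1) : H1 →L[ℝ] L2 := (mulL α).comp der + (mulL β).comp val

theorem opL_apply (α β : H1) (f : H2) : opL α β f = mulH1 α (dx f) + mulH1 β (incl f) := rfl

theorem opLL2_apply (α β f : H1) : opLL2 α β f = mulL α (der f) + mulL β (val f) := rfl

theorem opLL2_incl (α β : H1) (f : H2) : opLL2 α β (incl f) = val (opL α β f) := by
  rw [opLL2_apply, opL_apply, map_add, val_mulH1, val_mulH1, der_incl]

theorem rep_opL (α β : H1) (f : H2) :
    rep (opL α β f) = fun x => rep α x * rep (dx f) x + rep β x * rep (incl f) x := by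
  rw [opL_apply, rep_add, rep_mulH1, rep_mulH1]
  rfl

theorem norm_opL_apply_le (α β : H1) (f : H2) :
    ‖opL α β f‖ ≤ ‖mulH1‖ * (‖α‖ + ‖β‖) * ‖f‖ :=
  calc ‖mulH1 α (dx f) + mulH1 β (incl f)‖
      ≤ ‖mulH1‖ * ‖α‖ * ‖dx f‖ + ‖mulH1‖ * ‖β‖ * ‖incl f‖ :=
        norm_add_le_of_le (mulH1.le_opNorm₂ _ _) (mulH1.le_opNorm₂ _ _)
    _ ≤ ‖mulH1‖ * ‖α‖ * ‖f‖ + ‖mulH1‖ * ‖β‖ * ‖f‖ := by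
        gcongr
        exacts [norm_dx_le f, norm_incl_le f]
    _ = ‖mulH1‖ * (‖α‖ + ‖β‖) * ‖f‖ := by ring

/-- The operator `Q L Q⁻¹ - L` for `L f = α f' + β f`, written as `[Q, α] ∂ₓ Q⁻¹ + Q β Q⁻¹ - β`,
which is bounded in `H¹`. -/
def opB (α β : H2) : H1 →L[ℝ] H1 :=
  (commExt α).comp (dx.comp invQH1) + QH2.comp ((mulH2 β).comp invQH1) - mulH1 (incl β)

theorem opB_apply (α β : H2) (x : H1) : opB α β x =
    commExt α (dx (invQH1 x)) + QH2 (mulH2 β (invQH1 x)) - mulH1 (incl β) x := rfl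

theorem QH2_invQH1 (x : H1) : QH2 (invQH1 x) = x := QE.apply_symm_apply x

theorem QL2_opL_invQH1 {α : H2} {γ : H1} (hγ : der (dx α) = val γ) (β : H2) (x : H1) :
    QL2 (opL (incl α) (incl β) (invQH1 x)) =
      opLL2 (incl α) (incl β) x + val (opB α β x) := by
  refine congrFun (denseRange_incl.equalizer
    (g := fun x => QL2 (opL (incl α) (incl β) (invQH1 x)))
    (h := fun x => opLL2 (incl α) (incl β) x + val (opB α β x))
    (by fun_prop) (by fun_prop) (funext fun f => ?_)) x
  have opL_eq_incl : opL (incl α) (incl β) (invQH1 (incl f)) =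
      incl (mulH2 α (invQH1 (dx f)) + mulH2 β (invQH1 (incl f))) := by
    rw [opL_apply, dx_invQH1_incl, map_add, incl_mulH2, incl_mulH2]
  change QL2 (opL (incl α) (incl β) (invQH1 (incl f))) =
    opLL2 (incl α) (incl β) (incl f) + val (opB α β (incl f))
  rw [opL_eq_incl, ← val_QH2, opB_apply, dx_invQH1_incl, commExt_incl hγ, commQ_apply,
    QH2_invQH1, opLL2_incl, opL_apply, ← map_add, map_add QH2]
  congr 1
  abel

theorem exists_opLL2_invQH1_eq_iff {α : H2} {γ : H1} (hγ : der (dx α) = val γ) (β : H2) (x z : H1) :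
    (∃ y : H2, opLL2 (incl α) (incl β) (incl (invQH1 x)) = val (incl y) ∧ QH2 y = z) ↔
      opLL2 (incl α) (incl β) x = val (z - opB α β x) := by
  have conj_eq := QL2_opL_invQH1 hγ β x
  rw [opLL2_incl]
  constructor
  · rintro ⟨y, hy, rfl⟩
    rw [H1.ext_val hy, ← val_QH2] at conj_eq
    rw [map_sub, conj_eq, add_sub_cancel_right]
  · intro h
    rw [h, map_sub, sub_add_cancel] at conj_eq
    refine ⟨invQH1 z, ?_, QH2_invQH1 z⟩
    congr 1
    apply QL2_injective
    rw [conj_eq, QL2_incl_invQH1]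

theorem norm_opB_sub_le {α α' : H2} {γ γ' : H1} (hγ : der (dx α) = val γ)
    (hγ' : der (dx α') = val γ') (β β' : H2) :
    ‖opB α β - opB α' β'‖ ≤ 2 * sobolevConst * ‖incl (α - α') - (γ - γ')‖ * ‖dx.comp invQH1‖ +
      ‖QH2‖ * (‖mulH2‖ * ‖β - β'‖ * ‖invQH1‖) + ‖mulH1‖ * ‖β - β'‖ := by
  have h : der (dx (α - α')) = val (γ - γ') := by simp only [map_sub, hγ, hγ']
  have opB_sub : opB α β - opB α' β' = (commExt (α - α')).comp (dx.comp invQH1) +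
      QH2.comp ((mulH2 (β - β')).comp invQH1) - mulH1 (incl (β - β')) := by
    rw [← commExt_sub hγ hγ', opB, opB]
    ext1 x
    simp only [sub_apply, add_apply, ContinuousLinearMap.comp_apply, map_sub]
    abel
  rw [opB_sub]
  refine norm_sub_le_of_le (norm_add_le_of_le ?_ ?_) ?_
  · refine (ContinuousLinearMap.opNorm_comp_le _ _).trans ?_
    gcongr
    exact norm_commExt_le h
  · refine (ContinuousLinearMap.opNorm_comp_le _ _).trans ?_
    gcongr
    refine (ContinuousLinearMap.opNorm_comp_le _ _).trans ?_
    gcongr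
    exact mulH2.le_opNorm _
  · refine (mulH1.le_opNorm _).trans ?_
    gcongr
    exact norm_incl_le _

theorem norm_opB_le {α : H2} {γ : H1} (hγ : der (dx α) = val γ) (β : H2) :
    ‖opB α β‖ ≤ 2 * sobolevConst * ‖incl α - γ‖ * ‖dx.comp invQH1‖ +
      ‖QH2‖ * (‖mulH2‖ * ‖β‖ * ‖invQH1‖) + ‖mulH1‖ * ‖β‖ := by
  have h0 : der (dx (0 : H2)) = val (0 : H1) := by simp only [map_zero]
  have commExt_zero : commExt 0 = 0 := by simpa using (commExt_sub h0 h0).symm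
  have opB_zero : opB 0 0 = 0 := by ext1 x; simp [opB_apply, commExt_zero]
  simpa [opB_zero] using norm_opB_sub_le hγ h0 β 0

/-! ### Families of bounded smooth functions -/

/-- A jointly continuous family `F t` of real functions, bounded locally uniformly in the
parameter `t`. -/
def BddFamily (F : ℝ → ℝ → ℝ) : Prop :=
  Continuous (Function.uncurry F) ∧ ∀ T : ℝ, ∃ C : ℝ, ∀ t, |t| ≤ T → ∀ x, |F t x| ≤ C

/-- Families of `k` times differentiable functions, which together with their derivatives up to the
order `k` are jointly continuous, and bounded locally uniformly in the parameter. -/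
def SmoothFamily : ℕ → (ℝ → ℝ → ℝ) → Prop
  | 0, F => BddFamily F
  | k + 1, F => BddFamily F ∧ (∀ t, Differentiable ℝ (F t)) ∧ SmoothFamily k fun t => deriv (F t)

theorem SmoothFamily.bdd : ∀ {k : ℕ} {F : ℝ → ℝ → ℝ}, SmoothFamily k F → BddFamily F
  | 0, _, h => h
  | _ + 1, _, h => h.1

theorem SmoothFamily.of_succ : ∀ {k : ℕ} {F : ℝ → ℝ → ℝ}, SmoothFamily (k + 1) F → SmoothFamily k F
  | 0, _, h => h.1
  | _ + 1, _, h => ⟨h.1, h.2.1, of_succ h.2.2⟩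

theorem SmoothFamily.mono {k l : ℕ} {F : ℝ → ℝ → ℝ} (h : SmoothFamily k F) (hl : l ≤ k) :
    SmoothFamily l F := by
  induction k, hl using Nat.le_induction with
  | base => exact h
  | succ n _ ih => exact ih h.of_succ

theorem SmoothFamily.of_hasDerivAt {k : ℕ} {F G : ℝ → ℝ → ℝ} (h : BddFamily F)
    (hd : ∀ t x, HasDerivAt (F t) (G t x) x) (hG : SmoothFamily k G) : SmoothFamily (k + 1) F := by
  refine ⟨h, fun t x => (hd t x).differentiableAt, ?_⟩
  rwa [show (fun t => deriv (F t)) = G from funext fun t => funext fun x => (hd t x).deriv]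

theorem SmoothFamily.hasDerivAt {k : ℕ} {F : ℝ → ℝ → ℝ} (h : SmoothFamily (k + 1) F) (t x : ℝ) :
    HasDerivAt (F t) (deriv (F t) x) x := (h.2.1 t x).hasDerivAt

theorem BddFamily.add {F G : ℝ → ℝ → ℝ} (hF : BddFamily F) (hG : BddFamily G) :
    BddFamily fun t x => F t x + G t x := by
  refine ⟨hF.1.add hG.1, fun T => ?_⟩
  obtain ⟨C, hC⟩ := hF.2 T
  obtain ⟨C', hC'⟩ := hG.2 T
  exact ⟨C + C', fun t ht x => (abs_add_le _ _).trans (add_le_add (hC t ht x) (hC' t ht x))⟩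

theorem BddFamily.mul {F G : ℝ → ℝ → ℝ} (hF : BddFamily F) (hG : BddFamily G) :
    BddFamily fun t x => F t x * G t x := by
  refine ⟨hF.1.mul hG.1, fun T => ?_⟩
  obtain ⟨C, hC⟩ := hF.2 T
  obtain ⟨C', hC'⟩ := hG.2 T
  refine ⟨|C| * |C'|, fun t ht x => ?_⟩
  rw [abs_mul]
  exact mul_le_mul ((hC t ht x).trans (le_abs_self _)) ((hC' t ht x).trans (le_abs_self _))
    (abs_nonneg _) (abs_nonneg _)

theorem BddFamily.exp {F : ℝ → ℝ → ℝ} (hF : BddFamily F) :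
    BddFamily fun t x => Real.exp (F t x) := by
  refine ⟨Real.continuous_exp.comp hF.1, fun T => ?_⟩
  obtain ⟨C, hC⟩ := hF.2 T
  refine ⟨Real.exp C, fun t ht x => ?_⟩
  rw [abs_of_pos (Real.exp_pos _)]
  exact Real.exp_le_exp.2 ((le_abs_self _).trans (hC t ht x))

theorem BddFamily.integral {F : ℝ → ℝ → ℝ} (hF : BddFamily F) :
    BddFamily fun t x => ∫ s in (0 : ℝ)..t, F s x := by
  refine ⟨?_, fun T => ?_⟩
  · exact intervalIntegral.continuous_parametric_intervalIntegral_of_continuous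
      (f := fun (p : ℝ × ℝ) (s : ℝ) => F s p.2)
      (hF.1.comp (continuous_snd.prodMk (continuous_snd.comp continuous_fst))) continuous_fst
  · obtain ⟨C, hC⟩ := hF.2 T
    refine ⟨|C| * T, fun t ht x => ?_⟩
    have norm_le : ∀ s ∈ Set.uIoc 0 t, ‖F s x‖ ≤ |C| := fun s hs => by
      have abs_le := abs_sub_left_of_mem_uIcc (uIoc_subset_uIcc hs)
      rw [sub_zero, sub_zero] at abs_le
      exact (hC s (abs_le.trans ht) x).trans (le_abs_self _)
    calc |∫ s in (0 : ℝ)..t, F s x| ≤ |C| * |t - 0| :=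
          intervalIntegral.norm_integral_le_of_norm_le_const norm_le
      _ ≤ |C| * T := by rw [sub_zero]; gcongr

theorem BddFamily.comp {F ψ : ℝ → ℝ → ℝ} (hF : BddFamily F)
    (hψ : Continuous (Function.uncurry ψ)) : BddFamily fun t x => F t (ψ t x) :=
  ⟨hF.1.comp (continuous_fst.prodMk hψ), fun T =>
    let ⟨C, hC⟩ := hF.2 T
    ⟨C, fun t ht _ => hC t ht _⟩⟩

theorem BddFamily.reparam {F : ℝ → ℝ → ℝ} (hF : BddFamily F) {r : ℝ → ℝ} (hr : Continuous r) :
    BddFamily fun t => F (r t) := by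
  refine ⟨hF.1.comp ((hr.comp continuous_fst).prodMk continuous_snd), fun T => ?_⟩
  obtain ⟨M, hM⟩ := isCompact_Icc.exists_bound_of_continuousOn (s := Icc (-T) T) hr.continuousOn
  obtain ⟨C, hC⟩ := hF.2 M
  exact ⟨C, fun t ht x => hC _ (hM t (abs_le.1 ht)) x⟩

theorem SmoothFamily.add : ∀ {k : ℕ} {F G : ℝ → ℝ → ℝ}, SmoothFamily k F → SmoothFamily k G →
    SmoothFamily k fun t x => F t x + G t x
  | 0, _, _, hF, hG => BddFamily.add hF hG
  | _ + 1, _, _, hF, hG => .of_hasDerivAt (hF.1.add hG.1)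
      (fun t x => (hF.hasDerivAt t x).add (hG.hasDerivAt t x)) (hF.2.2.add hG.2.2)

theorem SmoothFamily.mul : ∀ {k : ℕ} {F G : ℝ → ℝ → ℝ}, SmoothFamily k F → SmoothFamily k G →
    SmoothFamily k fun t x => F t x * G t x
  | 0, _, _, hF, hG => BddFamily.mul hF hG
  | _ + 1, _, _, hF, hG => .of_hasDerivAt (hF.1.mul hG.1)
      (fun t x => (hF.hasDerivAt t x).mul (hG.hasDerivAt t x))
      ((hF.2.2.mul hG.of_succ).add (hF.of_succ.mul hG.2.2))

theorem SmoothFamily.exp : ∀ {k : ℕ} {F : ℝ → ℝ → ℝ}, SmoothFamily k F →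
    SmoothFamily k fun t x => Real.exp (F t x)
  | 0, _, hF => BddFamily.exp hF
  | _ + 1, _, hF => .of_hasDerivAt hF.1.exp (fun t x => (hF.hasDerivAt t x).exp)
      (hF.of_succ.exp.mul hF.2.2)

theorem BddFamily.const (c : ℝ) : BddFamily fun _ _ => c :=
  ⟨continuous_const, fun _ => ⟨|c|, fun _ _ _ => le_rfl⟩⟩

theorem SmoothFamily.const : ∀ (k : ℕ) (c : ℝ), SmoothFamily k fun _ _ => c
  | 0, c => BddFamily.const c
  | k + 1, c => .of_hasDerivAt (BddFamily.const c) (fun _ x => hasDerivAt_const x c) (.const k 0)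

theorem SmoothFamily.const_mul {k : ℕ} {F : ℝ → ℝ → ℝ} (c : ℝ) (hF : SmoothFamily k F) :
    SmoothFamily k fun t x => c * F t x := (SmoothFamily.const k c).mul hF

theorem SmoothFamily.neg {k : ℕ} {F : ℝ → ℝ → ℝ} (hF : SmoothFamily k F) :
    SmoothFamily k fun t x => -F t x := by
  simpa using hF.const_mul (-1)

theorem SmoothFamily.hasDerivAt_integral {F : ℝ → ℝ → ℝ} (hF : SmoothFamily 1 F) (t x : ℝ) :
    HasDerivAt (fun x => ∫ s in (0 : ℝ)..t, F s x) (∫ s in (0 : ℝ)..t, deriv (F s) x) x := by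
  obtain ⟨C, hC⟩ := hF.2.2.2 |t|
  have continuous_param : ∀ y, Continuous fun s => F s y := fun y =>
    hF.1.1.comp (continuous_id.prodMk continuous_const)
  have continuous_deriv : Continuous fun s => deriv (F s) x :=
    hF.2.2.1.comp (continuous_id.prodMk continuous_const)
  refine (intervalIntegral.hasDerivAt_integral_of_dominated_loc_of_deriv_le (s := univ)
    (F := fun x s => F s x) (F' := fun x s => deriv (F s) x) (bound := fun _ => C) univ_mem
    (.of_forall fun y => (continuous_param y).aestronglyMeasurable)
    ((continuous_param x).intervalIntegrable _ _) continuous_deriv.aestronglyMeasurable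
    (ae_of_all _ fun s hs y _ => hC s ?_ y) intervalIntegrable_const
    (ae_of_all _ fun s _ y _ => hF.hasDerivAt s y)).2
  simpa using abs_sub_left_of_mem_uIcc (uIoc_subset_uIcc hs)

theorem SmoothFamily.integral : ∀ {k : ℕ} {F : ℝ → ℝ → ℝ}, SmoothFamily k F →
    SmoothFamily k fun t x => ∫ s in (0 : ℝ)..t, F s x
  | 0, _, hF => BddFamily.integral hF
  | _ + 1, _, hF => .of_hasDerivAt hF.1.integral
      (fun t x => SmoothFamily.hasDerivAt_integral (hF.mono (by omega)) t x) hF.2.2.integral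

theorem SmoothFamily.comp : ∀ {k : ℕ} {F ψ : ℝ → ℝ → ℝ}, SmoothFamily (k + 1) F →
    Continuous (Function.uncurry ψ) → (∀ t, Differentiable ℝ (ψ t)) →
    SmoothFamily k (fun t => deriv (ψ t)) → SmoothFamily (k + 1) fun t x => F t (ψ t x)
  | 0, _, ψ, hF, h1, h2, h3 => .of_hasDerivAt (hF.1.comp h1)
      (fun t x => (hF.hasDerivAt t (ψ t x)).comp x (h2 t x).hasDerivAt)
      (BddFamily.mul (BddFamily.comp hF.2.2 h1) h3)
  | _ + 1, _, ψ, hF, h1, h2, h3 => .of_hasDerivAt (hF.1.comp h1)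
      (fun t x => (hF.hasDerivAt t (ψ t x)).comp x (h2 t x).hasDerivAt)
      ((comp hF.2.2 h1 h2 h3.of_succ).mul h3)

theorem SmoothFamily.reparam : ∀ {k : ℕ} {F : ℝ → ℝ → ℝ}, SmoothFamily k F → ∀ {r : ℝ → ℝ},
    Continuous r → SmoothFamily k fun t => F (r t)
  | 0, _, hF, _, hr => BddFamily.reparam hF hr
  | _ + 1, _, hF, _, hr => ⟨hF.1.reparam hr, fun _ => hF.2.1 _, hF.2.2.reparam hr⟩

/-- Continuous functions which are bounded together with their derivatives up to the order `k`, as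
constant smooth families. -/
abbrev Cb (k : ℕ) (f : ℝ → ℝ) : Prop := SmoothFamily k fun _ => f

theorem MemCb.bddFamily {n : ℕ} {f : ℝ → ℝ} (h : MemCb n f) : BddFamily fun _ => f :=
  let ⟨C, hC⟩ := h.2 0 n.zero_le
  ⟨h.1.continuous.comp continuous_snd, fun _ => ⟨C, fun _ _ x => by simpa using hC x⟩⟩

theorem MemCb.cb : ∀ {n : ℕ} {f : ℝ → ℝ}, MemCb n f → Cb n f
  | 0, _, h => h.bddFamily
  | n + 1, f, h => by
    have contDiff : ContDiff ℝ (n + 1 : ℕ) f := h.1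
    obtain ⟨differentiable, -, contDiff_deriv⟩ :=
      (contDiff_succ_iff_deriv (n := n)).1 (by exact_mod_cast contDiff)
    refine ⟨h.bddFamily, fun _ => differentiable, MemCb.cb ⟨contDiff_deriv, fun m hm => ?_⟩⟩
    rw [← iteratedDeriv_succ']
    exact h.2 (m + 1) (by omega)

theorem Cb.continuous {k : ℕ} {f : ℝ → ℝ} (h : Cb k f) : Continuous f :=
  (SmoothFamily.bdd h).1.comp (continuous_const (y := (0 : ℝ)) |>.prodMk continuous_id)

theorem Cb.bound {k : ℕ} {f : ℝ → ℝ} (h : Cb k f) : ∃ C, 0 ≤ C ∧ ∀ x, |f x| ≤ C := by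
  obtain ⟨C, hC⟩ := (SmoothFamily.bdd h).2 0
  exact ⟨C, (abs_nonneg _).trans (hC 0 (by simp) 0), hC 0 (by simp)⟩

theorem SmoothFamily.freeze {k : ℕ} {F : ℝ → ℝ → ℝ} (h : SmoothFamily k F) (t : ℝ) : Cb k (F t) :=
  h.reparam (r := fun _ => t) continuous_const

/-! ### The flow of a vector field -/

section Flow

variable {ξ : ℝ → ℝ}

theorem Cb.lipschitz (hξ : Cb 1 ξ) : ∃ K : ℝ≥0, LipschitzWith K ξ ∧ ∀ x, |deriv ξ x| ≤ K := by
  obtain ⟨C, C_nonneg, hC⟩ := Cb.bound (k := 0) (f := deriv ξ) hξ.2.2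
  exact ⟨⟨C, C_nonneg⟩, lipschitzWith_of_nnnorm_deriv_le (hξ.2.1 0) fun x => hC x, hC⟩

theorem exists_local_solution (hξ : Cb 1 ξ) (x : ℝ) (n : ℕ) : ∃ γ : ℝ → ℝ, γ 0 = x ∧
    ∀ t ∈ Ioo (-(n + 1 : ℝ)) (n + 1), HasDerivAt γ (ξ (γ t)) t := by
  obtain ⟨K, hK, -⟩ := hξ.lipschitz
  obtain ⟨M, M_nonneg, hM⟩ := Cb.bound hξ
  have n_pos : (0 : ℝ) ≤ n + 1 := by positivity
  have isPicardLindelof : IsPicardLindelof (fun _ => ξ) (tmin := -(n + 1 : ℝ)) (tmax := n + 1)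
      ⟨0, by linarith, n_pos⟩ x (⟨M, M_nonneg⟩ * ⟨n + 1, n_pos⟩) 0 ⟨M, M_nonneg⟩ K :=
    .of_time_independent (fun y _ => hM y) hK.lipschitzOnWith
      (by simp only [sub_zero, zero_sub, neg_neg, max_self, NNReal.coe_zero]; exact le_rfl)
  obtain ⟨γ, γ_zero, hγ⟩ := isPicardLindelof.exists_eq_forall_mem_Icc_hasDerivWithinAt₀
  exact ⟨γ, γ_zero, fun t ht =>
    (hγ t (Ioo_subset_Icc_self ht)).hasDerivAt (Icc_mem_nhds ht.1 ht.2)⟩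

theorem exists_solution (hξ : Cb 1 ξ) (x : ℝ) :
    ∃ γ : ℝ → ℝ, γ 0 = x ∧ ∀ s, HasDerivAt γ (ξ (γ s)) s := by
  obtain ⟨K, hK, -⟩ := hξ.lipschitz
  choose γ γ_zero hγ using exists_local_solution hξ x
  have agree : ∀ m n : ℕ, m ≤ n → ∀ t ∈ Ioo (-(m + 1 : ℝ)) (m + 1), γ m t = γ n t := by
    intro m n hmn
    have hmn' : (m : ℝ) ≤ n := by exact_mod_cast hmn
    exact ODE_solution_unique_of_mem_Ioo (v := fun _ => ξ) (s := fun _ => univ) (t₀ := 0)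
      (fun _ _ => hK.lipschitzOnWith) ⟨by linarith [m.cast_nonneg (α := ℝ)], by positivity⟩
      (fun t ht => ⟨hγ m t ht, trivial⟩)
      (fun t ht => ⟨hγ n t ⟨by linarith [ht.1], by linarith [ht.2]⟩, trivial⟩)
      (by rw [γ_zero, γ_zero])
  have mem_Ioo_floor : ∀ t : ℝ, t ∈ Ioo (-((⌊|t|⌋₊ : ℝ) + 1)) (⌊|t|⌋₊ + 1) := fun t =>
    abs_lt.1 (Nat.lt_floor_add_one |t|)
  refine ⟨fun t => γ ⌊|t|⌋₊ t, γ_zero _, fun s => ?_⟩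
  refine (hγ _ s (mem_Ioo_floor s)).congr_of_eventuallyEq ?_
  filter_upwards [Ioo_mem_nhds (mem_Ioo_floor s).1 (mem_Ioo_floor s).2] with t ht
  have floor_lt : ⌊|t|⌋₊ < ⌊|s|⌋₊ + 1 :=
    (Nat.floor_lt (abs_nonneg _)).2 (by exact_mod_cast abs_lt.2 ht)
  exact agree _ _ (Nat.lt_succ_iff.1 floor_lt) t (mem_Ioo_floor t)

theorem flow_zero (hξ : Cb 1 ξ) (x : ℝ) : flow ξ 0 x = x := by
  rw [flow, dif_pos (exists_solution hξ x)]
  exact (exists_solution hξ x).choose_spec.1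

theorem hasDerivAt_flow (hξ : Cb 1 ξ) (t x : ℝ) :
    HasDerivAt (fun t => flow ξ t x) (ξ (flow ξ t x)) t := by
  simp only [flow, dif_pos (exists_solution hξ x)]
  exact (exists_solution hξ x).choose_spec.2 t

theorem flow_unique (hξ : Cb 1 ξ) {γ : ℝ → ℝ} (h : ∀ s, HasDerivAt γ (ξ (γ s)) s) (t : ℝ) :
    γ t = flow ξ t (γ 0) := by
  obtain ⟨K, hK, -⟩ := hξ.lipschitz
  exact congrFun (ODE_solution_unique_univ (v := fun _ => ξ) (s := fun _ => univ) (t₀ := 0)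
    (fun _ => hK.lipschitzOnWith) (fun t => ⟨h t, trivial⟩)
    (fun t => ⟨hasDerivAt_flow hξ t (γ 0), trivial⟩) (flow_zero hξ (γ 0)).symm) t

theorem flow_add (hξ : Cb 1 ξ) (s t x : ℝ) : flow ξ (s + t) x = flow ξ s (flow ξ t x) := by
  have h := flow_unique hξ (γ := fun s => flow ξ (s + t) x)
    (fun s => (hasDerivAt_flow hξ (s + t) x).comp_add_const s t) s
  simpa using h

theorem flow_neg_flow (hξ : Cb 1 ξ) (t x : ℝ) : flow ξ (-t) (flow ξ t x) = x := by
  rw [← flow_add hξ, neg_add_cancel, flow_zero hξ]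

theorem flow_flow_neg (hξ : Cb 1 ξ) (t x : ℝ) : flow ξ t (flow ξ (-t) x) = x := by
  rw [← flow_add hξ, add_neg_cancel, flow_zero hξ]

theorem continuous_flow_time (hξ : Cb 1 ξ) (x : ℝ) : Continuous fun t => flow ξ t x :=
  continuous_iff_continuousAt.2 fun t => (hasDerivAt_flow hξ t x).continuousAt

theorem abs_flow_sub_flow_le (hξ : Cb 1 ξ) {M : ℝ} (hM : ∀ x, |ξ x| ≤ M) (s t x : ℝ) :
    |flow ξ t x - flow ξ s x| ≤ M * |t - s| := by
  exact Convex.norm_image_sub_le_of_norm_hasDerivWithin_le (s := univ) (C := M)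
    (f := fun t => flow ξ t x) (x := s) (y := t)
    (fun t _ => (hasDerivAt_flow hξ t x).hasDerivWithinAt) (fun t _ => hM _) convex_univ
    trivial trivial

/-- The difference quotient of a continuously differentiable function, written as the mean of the
derivative, so that it is continuous across the diagonal `a = b`. -/
def diffQuot (ξ : ℝ → ℝ) (a b : ℝ) : ℝ := ∫ r in (0 : ℝ)..1, deriv ξ (a + r * (b - a))

theorem diffQuot_mul (hξ : Cb 1 ξ) (a b : ℝ) : ξ b - ξ a = diffQuot ξ a b * (b - a) := by
  have continuous_deriv : Continuous (deriv ξ) := Cb.continuous (k := 0) hξ.2.2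
  have integral_deriv := intervalIntegral.integral_unitInterval_deriv_eq_sub (𝕜 := ℝ) (z₀ := a)
    (z₁ := b - a) (f := ξ) (f' := deriv ξ) (by fun_prop) (fun r _ => hξ.hasDerivAt 0 _)
  simp only [smul_eq_mul, add_sub_cancel] at integral_deriv
  rw [diffQuot, ← integral_deriv, mul_comm]

theorem diffQuot_self (a : ℝ) : diffQuot ξ a a = deriv ξ a := by simp [diffQuot]

theorem continuous_diffQuot (hξ : Cb 1 ξ) : Continuous (Function.uncurry (diffQuot ξ)) := by
  have continuous_deriv : Continuous (deriv ξ) := Cb.continuous (k := 0) hξ.2.2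
  exact intervalIntegral.continuous_parametric_intervalIntegral_of_continuous'
    (f := fun (p : ℝ × ℝ) r => deriv ξ (p.1 + r * (p.2 - p.1)))
    (by simp only [Function.uncurry_def]; fun_prop) _ _

theorem abs_diffQuot_le {K : ℝ} (hK : ∀ x, |deriv ξ x| ≤ K) (a b : ℝ) : |diffQuot ξ a b| ≤ K := by
  simpa [diffQuot] using intervalIntegral.norm_integral_le_of_norm_le_const (a := 0) (b := 1)
    (f := fun r => deriv ξ (a + r * (b - a))) (C := K) (fun r _ => hK _)

theorem flow_sub_flow (hξ : Cb 1 ξ) (t x y : ℝ) : flow ξ t y - flow ξ t x =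
    (y - x) * Real.exp (∫ s in (0 : ℝ)..t, diffQuot ξ (flow ξ s x) (flow ξ s y)) := by
  set θ : ℝ → ℝ := fun s => diffQuot ξ (flow ξ s x) (flow ξ s y) with θ_def
  have continuous_θ : Continuous θ := (continuous_diffQuot hξ).comp
    ((continuous_flow_time hξ x).prodMk (continuous_flow_time hξ y))
  set g : ℝ → ℝ := fun t => (flow ξ t y - flow ξ t x) * Real.exp (-∫ s in (0 : ℝ)..t, θ s)
    with g_def
  have hasDerivAt_g : ∀ t, HasDerivAt g 0 t := by
    intro t
    have hasDerivAt_integral : HasDerivAt (fun t => ∫ s in (0 : ℝ)..t, θ s) (θ t) t :=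
      continuous_θ.integral_hasStrictDerivAt 0 t |>.hasDerivAt
    convert! ((hasDerivAt_flow hξ t y).sub (hasDerivAt_flow hξ t x)).mul
      hasDerivAt_integral.neg.exp using 1
    rw [diffQuot_mul hξ]
    simp only [θ_def, Pi.sub_apply]
    ring
  have g_const : g t = g 0 := is_const_of_deriv_eq_zero
    (fun t => (hasDerivAt_g t).differentiableAt) (fun t => (hasDerivAt_g t).deriv) t 0
  simp only [g_def, intervalIntegral.integral_same, neg_zero, Real.exp_zero, mul_one,
    flow_zero hξ] at g_const
  rw [← g_const, mul_assoc, ← Real.exp_add, neg_add_cancel, Real.exp_zero, mul_one]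

theorem exp_integral_le {θ : ℝ → ℝ} {K : ℝ} (hK : ∀ s, |θ s| ≤ K) (t : ℝ) :
    Real.exp (∫ s in (0 : ℝ)..t, θ s) ≤ Real.exp (K * |t|) := by
  gcongr
  refine (le_abs_self _).trans ?_
  simpa using intervalIntegral.norm_integral_le_of_norm_le_const (a := 0) (b := t)
    (f := θ) fun s _ => hK s

theorem abs_flow_sub_le (hξ : Cb 1 ξ) {K : ℝ} (hK : ∀ x, |deriv ξ x| ≤ K) (t x y : ℝ) :
    |flow ξ t y - flow ξ t x| ≤ Real.exp (K * |t|) * |y - x| := by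
  rw [flow_sub_flow hξ, abs_mul, mul_comm, abs_of_pos (Real.exp_pos _)]
  exact mul_le_mul_of_nonneg_right (exp_integral_le (fun s => abs_diffQuot_le hK _ _) t)
    (abs_nonneg _)

theorem continuous_flow (hξ : Cb 1 ξ) : Continuous (Function.uncurry (flow ξ)) := by
  obtain ⟨K, -, hK⟩ := hξ.lipschitz
  obtain ⟨M, -, hM⟩ := Cb.bound hξ
  rw [continuous_iff_continuousAt]
  rintro ⟨t, x⟩
  have continuous_bound : Continuous fun p : ℝ × ℝ =>
      M * |p.1 - t| + Real.exp (K * |t|) * |p.2 - x| := by fun_prop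
  rw [ContinuousAt, tendsto_iff_norm_sub_tendsto_zero]
  refine squeeze_zero (fun _ => norm_nonneg _) (fun ⟨s, y⟩ => ?_)
    (by simpa using continuous_bound.tendsto (t, x))
  calc |flow ξ s y - flow ξ t x| ≤ |flow ξ s y - flow ξ t y| + |flow ξ t y - flow ξ t x| :=
        abs_sub_le _ _ _
    _ ≤ M * |s - t| + Real.exp (K * |t|) * |y - x| :=
        add_le_add (abs_flow_sub_flow_le hξ hM t s y) (abs_flow_sub_le hξ hK t x y)

/-- The derivative of the flow with respect to the initial value, as the solution of the linearised
equation. -/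
def flowDeriv (ξ : ℝ → ℝ) (t x : ℝ) : ℝ := Real.exp (∫ s in (0 : ℝ)..t, deriv ξ (flow ξ s x))

theorem hasDerivAt_flow_space (hξ : Cb 1 ξ) (t x : ℝ) :
    HasDerivAt (flow ξ t) (flowDeriv ξ t x) x := by
  rw [hasDerivAt_iff_tendsto_slope]
  have continuous_slope : Continuous fun y =>
      Real.exp (∫ s in (0 : ℝ)..t, diffQuot ξ (flow ξ s x) (flow ξ s y)) :=
    Real.continuous_exp.comp
      (intervalIntegral.continuous_parametric_intervalIntegral_of_continuous'
        (f := fun y s => diffQuot ξ (flow ξ s x) (flow ξ s y))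
        ((continuous_diffQuot hξ).comp (((continuous_flow_time hξ x).comp continuous_snd).prodMk
          ((continuous_flow hξ).comp (continuous_snd.prodMk continuous_fst)))) _ _)
  have tendsto_slope := (continuous_slope.tendsto x).mono_left (nhdsWithin_le_nhds (s := {x}ᶜ))
  simp only [diffQuot_self] at tendsto_slope
  refine tendsto_slope.congr' ?_
  filter_upwards [self_mem_nhdsWithin] with y hy
  rw [slope_def_field, flow_sub_flow hξ, mul_div_cancel_left₀ _ (sub_ne_zero.2 hy)]

theorem deriv_flow_space (hξ : Cb 1 ξ) : (fun t => deriv (flow ξ t)) = flowDeriv ξ :=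
  funext fun t => funext fun x => (hasDerivAt_flow_space hξ t x).deriv

theorem differentiable_flow (hξ : Cb 1 ξ) (t : ℝ) : Differentiable ℝ (flow ξ t) :=
  fun x => (hasDerivAt_flow_space hξ t x).differentiableAt

theorem smoothFamily_flowDeriv {k : ℕ} (hξ : Cb (k + 1) ξ) : SmoothFamily k (flowDeriv ξ) := by
  induction k with
  | zero => exact ((BddFamily.comp hξ.2.2 (continuous_flow hξ)).integral).exp
  | succ k ih =>
    have h1 : Cb 1 ξ := hξ.mono (by omega)
    refine (SmoothFamily.comp (F := fun _ => deriv ξ) hξ.2.2 (continuous_flow h1)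
      (differentiable_flow h1) ?_).integral.exp
    rw [deriv_flow_space h1]
    exact ih hξ.of_succ

theorem SmoothFamily.comp_flow {k : ℕ} {F : ℝ → ℝ → ℝ} (hF : SmoothFamily k F)
    (h1 : Cb 1 ξ) (hk : Cb k ξ) {r : ℝ → ℝ} (hr : Continuous r) :
    SmoothFamily k fun t x => F t (flow ξ (r t) x) := by
  have continuous_flow_comp : Continuous (Function.uncurry fun t => flow ξ (r t)) :=
    (continuous_flow h1).comp ((hr.comp continuous_fst).prodMk continuous_snd)
  cases k with
  | zero => exact BddFamily.comp hF continuous_flow_comp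
  | succ k =>
    refine SmoothFamily.comp hF continuous_flow_comp (fun t => differentiable_flow h1 _) ?_
    rw [show (fun t => deriv (flow ξ (r t))) = fun t => flowDeriv ξ (r t) from
      funext fun t => congrFun (deriv_flow_space h1) (r t)]
    exact (smoothFamily_flowDeriv hk).reparam hr

theorem abs_flowDeriv_le {K : ℝ} (hK : ∀ x, |deriv ξ x| ≤ K) (t x : ℝ) :
    |flowDeriv ξ t x| ≤ Real.exp (K * |t|) := by
  rw [flowDeriv, abs_of_pos (Real.exp_pos _)]
  exact exp_integral_le (fun s => hK _) t

end Flow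

/-! ### Strongly continuous families of operators -/

section StronglyContinuous

variable {E F G : Type*} [NormedAddCommGroup E] [NormedSpace ℝ E] [NormedAddCommGroup F]
  [NormedSpace ℝ F] [NormedAddCommGroup G] [NormedSpace ℝ G]

/-- Families of bounded operators which are bounded locally uniformly in the parameter. -/
def LocallyBounded (T : ℝ → E →L[ℝ] F) : Prop :=
  ∀ M : ℝ, ∃ C : ℝ, 0 ≤ C ∧ ∀ t, |t| ≤ M → ∀ x, ‖T t x‖ ≤ C * ‖x‖

/-- Strongly continuous families of operators. Joint continuity and local boundedness are part of
the definition, so that the notion is stable under composition without appeal to the uniform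
boundedness principle. -/
def StronglyContinuous (T : ℝ → E →L[ℝ] F) : Prop :=
  Continuous (fun p : ℝ × E => T p.1 p.2) ∧ LocallyBounded T

theorem StronglyContinuous.of_dense {T : ℝ → E →L[ℝ] F} (hb : LocallyBounded T) {s : Set E}
    (hs : Dense s) (h : ∀ x ∈ s, Continuous fun t => T t x) : StronglyContinuous T := by
  refine ⟨continuous_of_locally_uniform_approx_of_continuousAt fun ⟨t, x⟩ u hu => ?_, hb⟩
  obtain ⟨ε, hε, hεu⟩ := Metric.mem_uniformity_dist.1 hu
  obtain ⟨C, C_nonneg, hC⟩ := hb (|t| + 1)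
  set δ := ε / (2 * (C + 1)) with hδ
  have δ_pos : 0 < δ := by positivity
  obtain ⟨y, hy, hys⟩ := Metric.dense_iff.1 hs x δ δ_pos
  rw [Metric.mem_ball', dist_eq_norm] at hy
  have near : ∀ᶠ p : ℝ × E in 𝓝 (t, x), |p.1| < |t| + 1 ∧ ‖p.2 - x‖ < δ :=
    .and ((by fun_prop : Continuous fun p : ℝ × E => |p.1|).continuousAt.eventually_lt_const
        (lt_add_one |t|))
      ((by fun_prop : Continuous fun p : ℝ × E => ‖p.2 - x‖).continuousAt.eventually_lt_const
        (by simpa using δ_pos))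
  refine ⟨_, near, fun p => T p.1 y, ((h y hys).comp continuous_fst).continuousAt,
    fun p ⟨p_fst, p_snd⟩ => hεu ?_⟩
  rw [dist_eq_norm, ← map_sub]
  calc ‖T p.1 (p.2 - y)‖ ≤ C * ‖p.2 - y‖ := hC _ p_fst.le _
    _ ≤ C * (‖p.2 - x‖ + ‖x - y‖) := by
        gcongr
        exact norm_sub_le_norm_sub_add_norm_sub ..
    _ ≤ C * (2 * δ) := by gcongr; linarith
    _ < (C + 1) * (2 * δ) := by gcongr; linarith
    _ = ε := by rw [hδ]; field_simp

theorem StronglyContinuous.of_forall {T : ℝ → E →L[ℝ] F} (hb : LocallyBounded T)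
    (h : ∀ x, Continuous fun t => T t x) : StronglyContinuous T :=
  .of_dense hb dense_univ fun x _ => h x

theorem StronglyContinuous.apply {T : ℝ → E →L[ℝ] F} (hT : StronglyContinuous T) {X : Type*}
    [TopologicalSpace X] {r : X → ℝ} {g : X → E} (hr : Continuous r) (hg : Continuous g) :
    Continuous fun a => T (r a) (g a) :=
  hT.1.comp (hr.prodMk hg)

theorem StronglyContinuous.apply_const {T : ℝ → E →L[ℝ] F} (hT : StronglyContinuous T) (x : E) :
    Continuous fun t => T t x :=
  hT.apply continuous_id continuous_const

theorem LocallyBounded.comp {T : ℝ → F →L[ℝ] G} {S : ℝ → E →L[ℝ] F} (hT : LocallyBounded T)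
    (hS : LocallyBounded S) : LocallyBounded fun t => (T t).comp (S t) := fun M => by
  obtain ⟨C, C_nonneg, hC⟩ := hT M
  obtain ⟨D, D_nonneg, hD⟩ := hS M
  refine ⟨C * D, by positivity, fun t ht x => (hC t ht _).trans ?_⟩
  rw [mul_assoc]
  gcongr
  exact hD t ht x

theorem LocallyBounded.add {T S : ℝ → E →L[ℝ] F} (hT : LocallyBounded T) (hS : LocallyBounded S) :
    LocallyBounded fun t => T t + S t := fun M => by
  obtain ⟨C, C_nonneg, hC⟩ := hT M
  obtain ⟨D, D_nonneg, hD⟩ := hS M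
  refine ⟨C + D, by positivity, fun t ht x => ?_⟩
  rw [add_mul]
  exact (norm_add_le _ _).trans (add_le_add (hC t ht x) (hD t ht x))

theorem LocallyBounded.reparam {T : ℝ → E →L[ℝ] F} (hT : LocallyBounded T) {r : ℝ → ℝ}
    (hr : Continuous r) : LocallyBounded fun t => T (r t) := fun M => by
  obtain ⟨N, hN⟩ := isCompact_Icc.exists_bound_of_continuousOn (s := Icc (-M) M) hr.continuousOn
  obtain ⟨C, C_nonneg, hC⟩ := hT N
  exact ⟨C, C_nonneg, fun t ht x => hC _ (hN t (abs_le.1 ht)) x⟩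

theorem StronglyContinuous.comp {T : ℝ → F →L[ℝ] G} {S : ℝ → E →L[ℝ] F}
    (hT : StronglyContinuous T) (hS : StronglyContinuous S) :
    StronglyContinuous fun t => (T t).comp (S t) :=
  ⟨hT.apply continuous_fst hS.1, hT.2.comp hS.2⟩

theorem StronglyContinuous.add {T S : ℝ → E →L[ℝ] F} (hT : StronglyContinuous T)
    (hS : StronglyContinuous S) : StronglyContinuous fun t => T t + S t :=
  ⟨hT.1.add hS.1, hT.2.add hS.2⟩

theorem StronglyContinuous.reparam {T : ℝ → E →L[ℝ] F} (hT : StronglyContinuous T) {r : ℝ → ℝ}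
    (hr : Continuous r) : StronglyContinuous fun t => T (r t) :=
  ⟨hT.apply (hr.comp continuous_fst) continuous_snd, hT.2.reparam hr⟩

theorem StronglyContinuous.const (T : E →L[ℝ] F) : StronglyContinuous fun _ => T :=
  ⟨T.continuous.comp continuous_snd, fun _ => ⟨‖T‖, norm_nonneg _, fun _ _ => T.le_opNorm⟩⟩

theorem StronglyContinuous.of_components {T : ℝ → E →L[ℝ] H1}
    (h0 : StronglyContinuous fun t => val.comp (T t))
    (h1 : StronglyContinuous fun t => der.comp (T t)) : StronglyContinuous T := by
  refine ⟨H1.continuous_of_val_der h0.1 h1.1, fun M => ?_⟩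
  obtain ⟨C, C_nonneg, hC⟩ := h0.2 M
  obtain ⟨D, D_nonneg, hD⟩ := h1.2 M
  refine ⟨C + D, by positivity, fun t ht x => (H1.norm_le_add _).trans ?_⟩
  rw [add_mul]
  exact add_le_add (hC t ht x) (hD t ht x)

end StronglyContinuous

/-! ### Multiplication by smooth functions and composition with the flow -/

theorem norm_sub_sq_eq_integral {f g : L2} {F G : ℝ → ℝ} (hf : f =ᵐ[volume] F)
    (hg : g =ᵐ[volume] G) : ‖f - g‖ ^ 2 = ∫ x, (F x - G x) ^ 2 := by
  rw [← real_inner_self_eq_norm_sq, inner_eq_integral_mul]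
  refine integral_congr_ae ?_
  filter_upwards [Lp.coeFn_sub f g, hf, hg] with x hsub hfx hgx
  rw [hsub, Pi.sub_apply, hfx, hgx, sq]

theorem continuous_L2_of_dominated {g : ℝ → L2} {G : ℝ → ℝ → ℝ} (hg : ∀ t, g t =ᵐ[volume] G t)
    (hc : ∀ x, Continuous fun t => G t x)
    (hb : ∀ M : ℝ, ∃ B : ℝ → ℝ, MemLp B 2 ∧ ∀ t, |t| ≤ M → ∀ x, |G t x| ≤ B x) :
    Continuous g := by
  refine continuous_iff_continuousAt.2 fun s => ?_
  obtain ⟨B, hB, hGB⟩ := hb (|s| + 1)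
  have aestronglyMeasurable_G : ∀ t, AEStronglyMeasurable (G t) volume := fun t =>
    (Lp.aestronglyMeasurable (g t)).congr (hg t)
  have abs_le_near : ∀ᶠ t in 𝓝 s, |t| ≤ |s| + 1 :=
    (continuous_abs.tendsto s).eventually (ge_mem_nhds (by simp))
  have tendsto_integral : Tendsto (fun t => ∫ x, (G t x - G s x) ^ 2) (𝓝 s)
      (𝓝 (∫ _x : ℝ, (0 : ℝ))) := by
    refine tendsto_integral_filter_of_dominated_convergence (fun x => (2 * B x) ^ 2)
      (.of_forall fun t => ((aestronglyMeasurable_G t).sub (aestronglyMeasurable_G s)).pow 2)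
      ?_ (hB.const_mul 2).integrable_sq (ae_of_all _ fun x => ?_)
    · filter_upwards [abs_le_near] with t ht
      refine ae_of_all _ fun x => ?_
      rw [norm_pow, Real.norm_eq_abs]
      gcongr
      linarith [abs_sub (G t x) (G s x), hGB t ht x, hGB s (by simp) x]
    · have continuous_sq : Continuous fun t => (G t x - G s x) ^ 2 :=
        ((hc x).sub continuous_const).pow 2
      simpa using continuous_sq.tendsto s
  rw [ContinuousAt, tendsto_iff_norm_sub_tendsto_zero]
  simp only [integral_zero, ← norm_sub_sq_eq_integral (hg _) (hg s)] at tendsto_integral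
  simpa [Real.sqrt_sq (norm_nonneg _)] using tendsto_integral.sqrt

theorem Cb.memLp_top {k : ℕ} {p : ℝ → ℝ} (h : Cb k p) : MemLp p ⊤ volume :=
  let ⟨C, _, hC⟩ := Cb.bound h
  memLp_top_of_bound (Cb.continuous h).aestronglyMeasurable C (ae_of_all _ hC)

/-- Multiplication by a bounded continuous function in `L²`. -/
def Cb.mul {k : ℕ} {p : ℝ → ℝ} (h : Cb k p) : L2 →L[ℝ] L2 := mulLp h.memLp_top

theorem Cb.coeFn_mul {k : ℕ} {p : ℝ → ℝ} (h : Cb k p) (f : L2) :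
    h.mul f =ᵐ[volume] fun x => p x * f x :=
  coeFn_mulLp h.memLp_top f

theorem Cb.norm_mul_le {k : ℕ} {p : ℝ → ℝ} (h : Cb k p) {C : ℝ} (hC : ∀ x, |p x| ≤ C) (f : L2) :
    ‖h.mul f‖ ≤ C * ‖f‖ :=
  norm_mulLp_apply_le h.memLp_top hC f

theorem stronglyContinuous_mul {k : ℕ} {F : ℝ → ℝ → ℝ} (hF : SmoothFamily k F) :
    StronglyContinuous fun t => (hF.freeze t).mul := by
  refine .of_forall (fun M => ?_) fun f => ?_
  · obtain ⟨C, hC⟩ := hF.bdd.2 M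
    exact ⟨|C|, abs_nonneg _, fun t ht f => (hF.freeze t).norm_mul_le
      (fun x => (hC t ht x).trans (le_abs_self _)) f⟩
  · refine continuous_L2_of_dominated (fun t => (hF.freeze t).coeFn_mul f)
      (fun x => (hF.bdd.1.comp (continuous_id.prodMk continuous_const)).mul continuous_const)
      fun M => ?_
    obtain ⟨C, hC⟩ := hF.bdd.2 M
    refine ⟨fun x => C * |f x|, (Lp.memLp f).abs.const_mul C, fun t ht x => ?_⟩
    rw [abs_mul]
    exact mul_le_mul_of_nonneg_right (hC t ht x) (abs_nonneg _)

section Comp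

variable {ξ : ℝ → ℝ}

theorem measurable_flow (hξ : Cb 1 ξ) (t : ℝ) : Measurable (flow ξ t) :=
  (differentiable_flow hξ t).continuous.measurable

theorem map_flow_le (hξ : Cb 1 ξ) {K : ℝ} (hK : ∀ x, |deriv ξ x| ≤ K) (t : ℝ) :
    Measure.map (flow ξ t) volume ≤ ENNReal.ofReal (Real.exp (K * |t|)) • volume := by
  refine Measure.le_iff.2 fun s hs => ?_
  have lipschitz : LipschitzWith (Real.exp (K * |t|)).toNNReal (flow ξ (-t)) :=
    LipschitzWith.of_dist_le_mul fun x y => by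
      rw [Real.dist_eq, Real.dist_eq, Real.coe_toNNReal _ (Real.exp_pos _).le]
      simpa using abs_flow_sub_le hξ hK (-t) y x
  have volume_image_le := lipschitz.hausdorffMeasure_image_le (d := 1) zero_le_one s
  rw [hausdorffMeasure_real, ENNReal.rpow_one] at volume_image_le
  rwa [Measure.map_apply (measurable_flow hξ t) hs, ← image_eq_preimage_of_inverse
    (flow_flow_neg hξ t) (flow_neg_flow hξ t)]

theorem memLp_comp_flow (hξ : Cb 1 ξ) (t : ℝ) (f : L2) :
    MemLp (fun x => f (flow ξ t x)) 2 volume := by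
  obtain ⟨K, -, hK⟩ := hξ.lipschitz
  exact ((Lp.memLp f).of_measure_le_smul ENNReal.ofReal_ne_top (map_flow_le hξ hK t)).comp_of_map
    (measurable_flow hξ t).aemeasurable

theorem quasiMeasurePreserving_flow (hξ : Cb 1 ξ) (t : ℝ) :
    Measure.QuasiMeasurePreserving (flow ξ t) volume volume := by
  obtain ⟨K, -, hK⟩ := hξ.lipschitz
  exact ⟨measurable_flow hξ t, Measure.absolutelyContinuous_of_le_smul (map_flow_le hξ hK t)⟩

theorem eLpNorm_comp_flow_le (hξ : Cb 1 ξ) {K : ℝ} (hK : ∀ x, |deriv ξ x| ≤ K) (t : ℝ) {p : ℝ≥0∞}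
    (hp : 1 ≤ p) {f : ℝ → ℝ} (hf : AEStronglyMeasurable f volume) :
    eLpNorm (f ∘ flow ξ t) p volume ≤
      ENNReal.ofReal (Real.exp (K * |t|)) * eLpNorm f p volume := by
  have K_nonneg : 0 ≤ K := (abs_nonneg _).trans (hK 0)
  have one_le_exp : 1 ≤ ENNReal.ofReal (Real.exp (K * |t|)) := by
    rw [← ENNReal.ofReal_one]
    exact ENNReal.ofReal_le_ofReal (Real.one_le_exp (by positivity))
  have exponent_le_one : (1 / p).toReal ≤ 1 :=
    ENNReal.toReal_le_of_le_ofReal zero_le_one (by simpa using hp)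
  have map_le := map_flow_le hξ hK t
  calc eLpNorm (f ∘ flow ξ t) p volume
      = eLpNorm f p (Measure.map (flow ξ t) volume) :=
        (eLpNorm_map_measure (hf.mono_ac (Measure.absolutelyContinuous_of_le_smul map_le))
          (measurable_flow hξ t).aemeasurable).symm
    _ ≤ ENNReal.ofReal (Real.exp (K * |t|)) ^ (1 / p).toReal * eLpNorm f p volume :=
        eLpNorm_le_of_measure_le_smul map_le
    _ ≤ ENNReal.ofReal (Real.exp (K * |t|)) * eLpNorm f p volume := by
        gcongr
        simpa using ENNReal.rpow_le_rpow_of_exponent_le one_le_exp exponent_le_one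

theorem norm_toLp_comp_flow_le (hξ : Cb 1 ξ) {K : ℝ} (hK : ∀ x, |deriv ξ x| ≤ K) (t : ℝ) (f : L2) :
    ‖(memLp_comp_flow hξ t f).toLp‖ ≤ Real.exp (K * |t|) * ‖f‖ := by
  rw [Lp.norm_toLp, Lp.norm_def, ← ENNReal.toReal_ofReal (Real.exp_pos (K * |t|)).le,
    ← ENNReal.toReal_mul]
  exact ENNReal.toReal_mono (ENNReal.mul_ne_top ENNReal.ofReal_ne_top (Lp.eLpNorm_ne_top f))
    (eLpNorm_comp_flow_le hξ hK t one_le_two (Lp.aestronglyMeasurable f))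

/-- Composition with the flow in `L²`. -/
def compL (hξ : Cb 1 ξ) (t : ℝ) : L2 →L[ℝ] L2 :=
  LinearMap.mkContinuous
    { toFun := fun f => (memLp_comp_flow hξ t f).toLp
      map_add' := fun f g => by
        apply Lp.ext
        filter_upwards [(memLp_comp_flow hξ t (f + g)).coeFn_toLp,
          (memLp_comp_flow hξ t f).coeFn_toLp, (memLp_comp_flow hξ t g).coeFn_toLp,
          (quasiMeasurePreserving_flow hξ t).ae (Lp.coeFn_add f g),
          Lp.coeFn_add (memLp_comp_flow hξ t f).toLp (memLp_comp_flow hξ t g).toLp]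
          with x comp_add comp_f comp_g hadd hadd_comp
        rw [comp_add, hadd_comp, Pi.add_apply, comp_f, comp_g, hadd, Pi.add_apply]
      map_smul' := fun c f => by
        apply Lp.ext
        filter_upwards [(memLp_comp_flow hξ t (c • f)).coeFn_toLp,
          (memLp_comp_flow hξ t f).coeFn_toLp,
          (quasiMeasurePreserving_flow hξ t).ae (Lp.coeFn_smul c f),
          Lp.coeFn_smul c (memLp_comp_flow hξ t f).toLp] with x comp_smul comp_f hsmul hsmul_comp
        rw [RingHom.id_apply, comp_smul, hsmul, Pi.smul_apply, hsmul_comp, Pi.smul_apply, comp_f] }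
    (Real.exp (hξ.lipschitz.choose * |t|))
    (norm_toLp_comp_flow_le hξ hξ.lipschitz.choose_spec.2 t)

theorem coeFn_compL (hξ : Cb 1 ξ) (t : ℝ) (f : L2) :
    compL hξ t f =ᵐ[volume] fun x => f (flow ξ t x) := (memLp_comp_flow hξ t f).coeFn_toLp

theorem coeFn_compL_of_ae_eq (hξ : Cb 1 ξ) (t : ℝ) {f : L2} {g : ℝ → ℝ} (h : g =ᵐ[volume] f) :
    compL hξ t f =ᵐ[volume] fun x => g (flow ξ t x) := by
  filter_upwards [coeFn_compL hξ t f, (quasiMeasurePreserving_flow hξ t).ae h] with x hcomp hx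
  rw [hcomp, hx]

theorem norm_compL_apply_le (hξ : Cb 1 ξ) {K : ℝ} (hK : ∀ x, |deriv ξ x| ≤ K) (t : ℝ) (f : L2) :
    ‖compL hξ t f‖ ≤ Real.exp (K * |t|) * ‖f‖ := norm_toLp_comp_flow_le hξ hK t f

theorem abs_le_of_mem_tsupport_flow (hξ : Cb 1 ξ) {N M ρ : ℝ} (hN : ∀ x, |ξ x| ≤ N) {g : ℝ → ℝ}
    (hg : tsupport g ⊆ Metric.closedBall 0 ρ) {t x : ℝ} (ht : |t| ≤ M) (hx : g (flow ξ t x) ≠ 0) :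
    |x| ≤ ρ + N * M := by
  have N_nonneg : 0 ≤ N := (abs_nonneg _).trans (hN 0)
  have abs_flow_le : |flow ξ t x| ≤ ρ := by simpa using hg (subset_tsupport g hx)
  have displacement := abs_flow_sub_flow_le hξ hN t 0 x
  rw [flow_zero hξ, zero_sub, abs_neg] at displacement
  calc |x| ≤ |flow ξ t x| + |x - flow ξ t x| := by
        simpa using abs_add_le (flow ξ t x) (x - flow ξ t x)
    _ ≤ ρ + N * |t| := add_le_add abs_flow_le displacement
    _ ≤ ρ + N * M := by gcongr

theorem stronglyContinuous_compL (hξ : Cb 1 ξ) : StronglyContinuous (compL hξ) := by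
  obtain ⟨K, -, hK⟩ := hξ.lipschitz
  obtain ⟨N, -, hN⟩ := Cb.bound hξ
  refine .of_dense (fun M => ⟨Real.exp (K * M), (Real.exp_pos _).le, fun t ht f =>
    (norm_compL_apply_le hξ hK t f).trans (by gcongr)⟩)
    (Lp.dense_hasCompactSupport_contDiff ENNReal.ofNat_ne_top) ?_
  rintro f ⟨g, hfg, compactSupport_g, contDiff_g⟩
  refine continuous_L2_of_dominated (fun t => coeFn_compL_of_ae_eq hξ t hfg.symm)
    (fun x => contDiff_g.continuous.comp (continuous_flow_time hξ x)) fun M => ?_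
  obtain ⟨C, hC⟩ := contDiff_g.continuous.bounded_above_of_compact_support compactSupport_g
  obtain ⟨ρ, hρ⟩ := compactSupport_g.isCompact.isBounded.subset_closedBall (0 : ℝ)
  refine ⟨(Metric.closedBall 0 (ρ + N * M)).indicator fun _ => C,
    memLp_indicator_const 2 measurableSet_closedBall C
      (Or.inr measure_closedBall_lt_top.ne), fun t ht x => ?_⟩
  by_cases hx : g (flow ξ t x) = 0
  · rw [hx, abs_zero]
    exact indicator_nonneg (fun _ _ => (norm_nonneg _).trans (hC 0)) x
  · rw [indicator_of_mem (by simpa using abs_le_of_mem_tsupport_flow hξ hN hρ ht hx)]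
    exact hC _

end Comp

theorem Cb.deriv {k : ℕ} {p : ℝ → ℝ} (h : Cb (k + 1) p) : Cb k (deriv p) := h.2.2

theorem isWeakDeriv_mul {p : ℝ → ℝ} (hp : Cb 1 p) (f : H1) :
    IsWeakDeriv (hp.mul (val f)) (hp.mul (der f) + hp.deriv.mul (val f)) := by
  refine denseRange_incl.induction_on (p := fun f : H1 =>
    IsWeakDeriv (hp.mul (val f)) (hp.mul (der f) + hp.deriv.mul (val f))) f ?_ fun f => ?_
  · exact isClosed_isWeakDeriv.preimage (f := fun f : H1 =>
      (hp.mul (val f), hp.mul (der f) + hp.deriv.mul (val f))) (by fun_prop)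
  · refine isWeakDeriv_of_hasDerivAt
      (fun x => (hp.hasDerivAt 0 x).mul (hasDerivAt_rep_incl f x)) ?_ ?_
    · filter_upwards [hp.coeFn_mul (val (incl f)), rep_ae_eq_val (incl f)] with x hmul hx
      rw [hmul, ← hx]; rfl
    · filter_upwards [hp.coeFn_mul (der (incl f)), hp.deriv.coeFn_mul (val (incl f)),
        Lp.coeFn_add (hp.mul (der (incl f))) (hp.deriv.mul (val (incl f))),
        rep_ae_eq_val (incl f), rep_ae_eq_val (dx f)] with x hmul_der hmul_val hadd hval hder
      rw [hadd, Pi.add_apply, hmul_der, hmul_val, der_incl, ← hval, ← hder]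
      ring

/-- Multiplication by a function of the class `C_b^1` in `H¹`. -/
def mulOp {p : ℝ → ℝ} (hp : Cb 1 p) : H1 →L[ℝ] H1 :=
  H1.lift (hp.mul.comp val) (hp.mul.comp der + hp.deriv.mul.comp val) (isWeakDeriv_mul hp)

theorem val_mulOp {p : ℝ → ℝ} (hp : Cb 1 p) (f : H1) : val (mulOp hp f) = hp.mul (val f) := rfl

theorem der_mulOp {p : ℝ → ℝ} (hp : Cb 1 p) (f : H1) :
    der (mulOp hp f) = hp.mul (der f) + hp.deriv.mul (val f) := rfl

theorem rep_mulOp {p : ℝ → ℝ} (hp : Cb 1 p) (f : H1) :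
    rep (mulOp hp f) = fun x => p x * rep f x := by
  refine rep_eq_of_ae_eq_val ((Cb.continuous hp).mul (rep_continuous f)) ?_
  filter_upwards [hp.coeFn_mul (val f), rep_ae_eq_val f] with x hmul hx
  rw [val_mulOp, hmul, ← hx]

theorem stronglyContinuous_mulOp {F : ℝ → ℝ → ℝ} (hF : SmoothFamily 1 F) :
    StronglyContinuous fun t => mulOp (hF.freeze t) :=
  .of_components ((stronglyContinuous_mul hF).comp (.const val))
    (((stronglyContinuous_mul hF).comp (.const der)).add
      ((stronglyContinuous_mul hF.2.2).comp (.const val)))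

section Comp

variable {ξ : ℝ → ℝ}

theorem cb_flowDeriv (hξ : Cb 1 ξ) (t : ℝ) : Cb 0 (flowDeriv ξ t) :=
  (smoothFamily_flowDeriv hξ).freeze t

theorem isWeakDeriv_comp (hξ : Cb 1 ξ) (t : ℝ) (f : H1) :
    IsWeakDeriv (compL hξ t (val f)) ((cb_flowDeriv hξ t).mul (compL hξ t (der f))) := by
  refine denseRange_incl.induction_on (p := fun f : H1 =>
    IsWeakDeriv (compL hξ t (val f)) ((cb_flowDeriv hξ t).mul (compL hξ t (der f))))
    f ?_ fun f => ?_
  · exact isClosed_isWeakDeriv.preimage (f := fun f : H1 =>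
      (compL hξ t (val f), (cb_flowDeriv hξ t).mul (compL hξ t (der f)))) (by fun_prop)
  · refine isWeakDeriv_of_hasDerivAt (fun x => (hasDerivAt_rep_incl f (flow ξ t x)).comp x
      (hasDerivAt_flow_space hξ t x)) ?_ ?_
    · exact (coeFn_compL_of_ae_eq hξ t (rep_ae_eq_val _)).symm
    · rw [der_incl]
      filter_upwards [coeFn_compL_of_ae_eq hξ t (rep_ae_eq_val (dx f)),
        (cb_flowDeriv hξ t).coeFn_mul (compL hξ t (val (dx f)))] with x hcomp hmul
      rw [hmul, hcomp, mul_comm]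

/-- Composition with the flow in `H¹`. -/
def compOp (hξ : Cb 1 ξ) (t : ℝ) : H1 →L[ℝ] H1 :=
  H1.lift ((compL hξ t).comp val) ((cb_flowDeriv hξ t).mul.comp ((compL hξ t).comp der))
    (isWeakDeriv_comp hξ t)

theorem val_compOp (hξ : Cb 1 ξ) (t : ℝ) (f : H1) : val (compOp hξ t f) = compL hξ t (val f) := rfl

theorem der_compOp (hξ : Cb 1 ξ) (t : ℝ) (f : H1) :
    der (compOp hξ t f) = (cb_flowDeriv hξ t).mul (compL hξ t (der f)) := rfl

theorem rep_compOp (hξ : Cb 1 ξ) (t : ℝ) (f : H1) :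
    rep (compOp hξ t f) = fun x => rep f (flow ξ t x) :=
  rep_eq_of_ae_eq_val ((rep_continuous f).comp (differentiable_flow hξ t).continuous)
    (coeFn_compL_of_ae_eq hξ t (rep_ae_eq_val f)).symm

theorem stronglyContinuous_compOp (hξ : Cb 1 ξ) : StronglyContinuous (compOp hξ) :=
  .of_components ((stronglyContinuous_compL hξ).comp (.const val))
    ((stronglyContinuous_mul (smoothFamily_flowDeriv hξ)).comp
      ((stronglyContinuous_compL hξ).comp (.const der)))

end Comp

/-! ### The group `U` in Sobolev spaces -/

section SFam

variable {X : Type*} [NormedAddCommGroup X] [NormedSpace ℝ X]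

/-- Strongly continuous families of operators with values in `H^{k+1}`, encoded by the existence of
strongly continuous families in `H¹` for the weak derivatives up to the order `k`. -/
def SobFamily : ℕ → (ℝ → X →L[ℝ] H1) → Prop
  | 0, T => StronglyContinuous T
  | k + 1, T => StronglyContinuous T ∧ ∃ T' : ℝ → X →L[ℝ] H1,
      (∀ t v, der (T t v) = val (T' t v)) ∧ SobFamily k T'

theorem SobFamily.stronglyContinuous : ∀ {k : ℕ} {T : ℝ → X →L[ℝ] H1}, SobFamily k T →
    StronglyContinuous T
  | 0, _, h => h
  | _ + 1, _, h => h.1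

theorem SobFamily.of_succ : ∀ {k : ℕ} {T : ℝ → X →L[ℝ] H1}, SobFamily (k + 1) T → SobFamily k T
  | 0, _, h => h.1
  | _ + 1, _, ⟨h, T', h1, h2⟩ => ⟨h, T', h1, of_succ h2⟩

theorem SobFamily.add : ∀ {k : ℕ} {T S : ℝ → X →L[ℝ] H1}, SobFamily k T → SobFamily k S →
    SobFamily k fun t => T t + S t
  | 0, _, _, hT, hS => StronglyContinuous.add hT hS
  | _ + 1, _, _, ⟨hT, T', h1, h2⟩, ⟨hS, S', h3, h4⟩ =>
    ⟨hT.add hS, fun t => T' t + S' t, fun t v => by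
      rw [add_apply, add_apply, map_add, map_add, h1, h3], h2.add h4⟩

theorem SobFamily.mul : ∀ {k : ℕ} {T : ℝ → X →L[ℝ] H1} {F : ℝ → ℝ → ℝ}
    (hF : SmoothFamily (k + 1) F), SobFamily k T →
    SobFamily k fun t => (mulOp ((hF.mono (Nat.le_add_left 1 k)).freeze t)).comp (T t)
  | 0, _, _, hF, hT => (stronglyContinuous_mulOp hF).comp hT
  | k + 1, T, F, hF, ⟨hT, T', h1, h2⟩ => by
    have hF1 : SmoothFamily 1 F := hF.mono (by omega)
    have hF1' : SmoothFamily 1 fun t => deriv (F t) := hF.2.2.mono (by omega)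
    refine ⟨(stronglyContinuous_mulOp hF1).comp hT, fun t => (mulOp (hF1.freeze t)).comp (T' t) +
      (mulOp (hF1'.freeze t)).comp (T t), fun t v => ?_, ?_⟩
    · simp only [add_apply, ContinuousLinearMap.comp_apply, map_add, der_mulOp, val_mulOp, h1]
      rfl
    · exact (mul hF.of_succ h2).add (mul hF.2.2 (of_succ ⟨hT, T', h1, h2⟩))

theorem SobFamily.comp_flow {ξ : ℝ → ℝ} (hξ : Cb 1 ξ) {r : ℝ → ℝ} (hr : Continuous r) :
    ∀ {k : ℕ} {T : ℝ → X →L[ℝ] H1} (_ : Cb (k + 1) ξ), SobFamily k T →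
    SobFamily k fun t => (compOp hξ (r t)).comp (T t)
  | 0, _, _, hT => ((stronglyContinuous_compOp hξ).reparam hr).comp hT
  | k + 1, T, hk, ⟨hT, T', h1, h2⟩ => by
    have hD : SmoothFamily (k + 1) fun t => flowDeriv ξ (r t) :=
      (smoothFamily_flowDeriv hk).reparam hr
    refine ⟨((stronglyContinuous_compOp hξ).reparam hr).comp hT, _, fun t v => ?_,
      SobFamily.mul hD (comp_flow hξ hr hk.of_succ h2)⟩
    simp only [ContinuousLinearMap.comp_apply, val_mulOp, der_compOp, val_compOp, h1]
    rfl

theorem SobFamily.const_smul (c : ℝ) : ∀ {k : ℕ} {T : ℝ → X →L[ℝ] H1}, SobFamily k T →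
    SobFamily k fun t => c • T t
  | 0, _, hT => StronglyContinuous.comp (.const (c • ContinuousLinearMap.id ℝ H1)) hT
  | _ + 1, _, ⟨hT, T', h1, h2⟩ =>
    ⟨StronglyContinuous.comp (.const (c • ContinuousLinearMap.id ℝ H1)) hT, fun t => c • T' t,
      fun t v => by simp only [smul_apply, map_smul, h1], h2.const_smul c⟩

theorem bddFamily_rep (f : H1) : BddFamily fun _ => rep f :=
  ⟨(rep_continuous f).comp continuous_snd, fun _ => ⟨_, fun _ _ => abs_rep_le f⟩⟩

theorem SobFamily.cb : ∀ {k : ℕ} {T : ℝ → X →L[ℝ] H1}, SobFamily k T → ∀ t v, Cb k (rep (T t v))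
  | 0, _, _, _, _ => bddFamily_rep _
  | _ + 1, T, ⟨_, T', h1, h2⟩, t, v =>
    .of_hasDerivAt (G := fun _ => rep (T' t v)) (bddFamily_rep (T t v))
      (fun _ => hasDerivAt_rep (rep_continuous _) (by rw [h1]; exact rep_ae_eq_val _)) (h2.cb t v)

theorem SobFamily.exists_H2 {T : ℝ → X →L[ℝ] H1} (hT : SobFamily 1 T) :
    ∃ S : ℝ → X →L[ℝ] H2, StronglyContinuous S ∧ ∀ t v, incl (S t v) = T t v := by
  obtain ⟨h0, T', h1, h2⟩ := hT
  refine ⟨fun t => H2.lift (T t) (T' t) (h1 t), ⟨?_, fun M => ?_⟩, fun t v => rfl⟩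
  · exact Continuous.subtype_mk ((WithLp.prodContinuousLinearEquiv 2 ℝ H1 H1).symm.continuous.comp
      (h0.1.prodMk h2.1)) _
  · obtain ⟨C, C_nonneg, hC⟩ := h0.2 M
    obtain ⟨D, D_nonneg, hD⟩ := (SobFamily.stronglyContinuous (k := 0) h2).2 M
    refine ⟨C + D, by positivity, fun t ht x => (H2.norm_le_add _).trans ?_⟩
    rw [add_mul]
    exact add_le_add (hC t ht x) (hD t ht x)

theorem sobFamily_incl : SobFamily 1 fun _ => incl :=
  ⟨.const _, fun _ => dx, fun _ v => der_incl v, .const _⟩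

end SFam

section Group

variable {ξ η : ℝ → ℝ}

/-- The exponent `c(t,x)` in the definition of `U`, after the substitution `r = t - s`. -/
def expo (ξ η : ℝ → ℝ) (t x : ℝ) : ℝ := ∫ r in (0 : ℝ)..t, η (flow ξ (-r) x)

theorem U_apply (ξ η : ℝ → ℝ) (t : ℝ) (f : ℝ → ℝ) (x : ℝ) :
    U ξ η t f x = Real.exp (expo ξ η t x) * f (flow ξ (-t) x) := by
  have integral_comp := intervalIntegral.integral_comp_sub_left (a := 0) (b := t)
    (fun r => η (flow ξ (-r) x)) t
  simp only [neg_sub, sub_self, sub_zero] at integral_comp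
  rw [U, expo, integral_comp]

theorem smoothFamily_expo {k : ℕ} (h1 : Cb 1 ξ) (hξ : Cb k ξ) (hη : Cb k η) :
    SmoothFamily k (expo ξ η) :=
  (SmoothFamily.comp_flow (F := fun _ => η) hη h1 hξ continuous_neg).integral

theorem smoothFamily_weight {k : ℕ} (h1 : Cb 1 ξ) (hξ : Cb k ξ) (hη : Cb k η) :
    SmoothFamily k fun t x => Real.exp (expo ξ η t x) := (smoothFamily_expo h1 hξ hη).exp

theorem expo_add (h1 : Cb 1 ξ) (hη : Cb 1 η) (s t x : ℝ) :
    expo ξ η (s + t) x = expo ξ η s x + expo ξ η t (flow ξ (-s) x) := by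
  have continuous_integrand : Continuous fun r => η (flow ξ (-r) x) :=
    (Cb.continuous hη).comp ((continuous_flow_time h1 x).comp continuous_neg)
  have integral_comp := intervalIntegral.integral_comp_add_right (a := 0) (b := t)
    (fun r => η (flow ξ (-r) x)) s
  rw [zero_add, add_comm t s] at integral_comp
  rw [expo, ← intervalIntegral.integral_add_adjacent_intervals (b := s)
    (continuous_integrand.intervalIntegrable _ _) (continuous_integrand.intervalIntegrable _ _),
    ← integral_comp, expo, expo]
  simp only [neg_add, flow_add h1]

theorem expo_zero (x : ℝ) : expo ξ η 0 x = 0 := by simp [expo]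

theorem expo_neg (h1 : Cb 1 ξ) (hη : Cb 1 η) (t x : ℝ) :
    expo ξ η t x + expo ξ η (-t) (flow ξ (-t) x) = 0 := by
  rw [← expo_add h1 hη, add_neg_cancel, expo_zero]

theorem cb_weight (hξ : Cb 1 ξ) (hη : Cb 1 η) (t : ℝ) :
    Cb 1 fun x => Real.exp (expo ξ η t x) := (smoothFamily_weight hξ hξ hη).freeze t

/-- The group `U` in `L²`. -/
def UL (hξ : Cb 1 ξ) (hη : Cb 1 η) (t : ℝ) : L2 →L[ℝ] L2 :=
  (cb_weight hξ hη t).mul.comp (compL hξ (-t))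

/-- The group `U` in `H¹`. -/
def UH (hξ : Cb 1 ξ) (hη : Cb 1 η) (t : ℝ) : H1 →L[ℝ] H1 :=
  (mulOp (cb_weight hξ hη t)).comp (compOp hξ (-t))

theorem val_UH (hξ : Cb 1 ξ) (hη : Cb 1 η) (t : ℝ) (f : H1) :
    val (UH hξ hη t f) = UL hξ hη t (val f) := rfl

theorem rep_UH (hξ : Cb 1 ξ) (hη : Cb 1 η) (t : ℝ) (f : H1) :
    rep (UH hξ hη t f) = U ξ η t (rep f) := by
  funext x
  rw [U_apply, UH, ContinuousLinearMap.comp_apply, rep_mulOp, rep_compOp]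

theorem stronglyContinuous_UH (hξ : Cb 1 ξ) (hη : Cb 1 η) : StronglyContinuous (UH hξ hη) :=
  (stronglyContinuous_mulOp (smoothFamily_weight hξ hξ hη)).comp
    ((stronglyContinuous_compOp hξ).reparam continuous_neg)

theorem stronglyContinuous_UL (hξ : Cb 1 ξ) (hη : Cb 1 η) : StronglyContinuous (UL hξ hη) :=
  (stronglyContinuous_mul (smoothFamily_weight hξ hξ hη)).comp
    ((stronglyContinuous_compL hξ).reparam continuous_neg)

theorem UH_zero (hξ : Cb 1 ξ) (hη : Cb 1 η) : UH hξ hη 0 = ContinuousLinearMap.id ℝ H1 := by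
  ext1 f
  apply H1.ext_rep
  funext x
  rw [rep_UH, U_apply, expo_zero, neg_zero, flow_zero hξ, Real.exp_zero, one_mul]
  rfl

theorem UH_add (hξ : Cb 1 ξ) (hη : Cb 1 η) (s t : ℝ) :
    UH hξ hη (s + t) = (UH hξ hη s).comp (UH hξ hη t) := by
  ext1 f
  apply H1.ext_rep
  funext x
  rw [ContinuousLinearMap.comp_apply, rep_UH, rep_UH, rep_UH, U_apply, U_apply, U_apply,
    expo_add hξ hη, Real.exp_add, neg_add_rev, flow_add hξ, mul_assoc]

theorem UH_add_apply (hξ : Cb 1 ξ) (hη : Cb 1 η) (s t : ℝ) (f : H1) :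
    UH hξ hη (s + t) f = UH hξ hη s (UH hξ hη t f) := by
  rw [UH_add]
  rfl

theorem UH_neg_apply (hξ : Cb 1 ξ) (hη : Cb 1 η) (t : ℝ) (f : H1) :
    UH hξ hη (-t) (UH hξ hη t f) = f := by
  rw [← UH_add_apply, neg_add_cancel, UH_zero]
  rfl

theorem UH_apply_neg (hξ : Cb 1 ξ) (hη : Cb 1 η) (t : ℝ) (f : H1) :
    UH hξ hη t (UH hξ hη (-t) f) = f := by
  simpa using UH_neg_apply hξ hη (-t) f

theorem SobFamily.UH {X : Type*} [NormedAddCommGroup X] [NormedSpace ℝ X] {k : ℕ}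
    {T : ℝ → X →L[ℝ] H1} (hT : SobFamily k T) (hξ : Cb 1 ξ) (hη : Cb 1 η) (hξk : Cb (k + 1) ξ)
    (hηk : Cb (k + 1) η) {r : ℝ → ℝ} (hr : Continuous r) :
    SobFamily k fun t => (UH hξ hη (r t)).comp (T t) := by
  have continuous_neg_r : Continuous fun t => -r t := hr.neg
  have sobFamily_mul := SobFamily.mul ((smoothFamily_weight hξ hξk hηk).reparam hr)
    (SobFamily.comp_flow hξ continuous_neg_r hξk hT)
  exact sobFamily_mul

theorem exists_UH2 (hξ : Cb 1 ξ) (hη : Cb 1 η) (hξ2 : Cb 2 ξ) (hη2 : Cb 2 η) :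
    ∃ S : ℝ → H2 →L[ℝ] H2, StronglyContinuous S ∧ ∀ t f, incl (S t f) = UH hξ hη t (incl f) := by
  have sobFamily_UH_incl : SobFamily 1 fun t => (UH hξ hη t).comp incl :=
    sobFamily_incl.UH hξ hη hξ2 hη2 (r := fun t => t) continuous_id
  exact sobFamily_UH_incl.exists_H2

theorem abs_deriv_expo_le (hξ : Cb 1 ξ) (hη : Cb 1 η) {K : ℝ} (hK : ∀ x, |deriv ξ x| ≤ K)
    (hK' : ∀ x, |deriv η x| ≤ K) (t x : ℝ) :
    |deriv (expo ξ η t) x| ≤ K * Real.exp (K * |t|) * |t| := by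
  have K_nonneg : 0 ≤ K := (abs_nonneg _).trans (hK 0)
  have hasDerivAt_integrand : ∀ r, HasDerivAt (fun x => η (flow ξ (-r) x))
      (deriv η (flow ξ (-r) x) * flowDeriv ξ (-r) x) x := fun r =>
    (hη.hasDerivAt 0 _).comp x (hasDerivAt_flow_space hξ (-r) x)
  have abs_integrand_le : ∀ r ∈ Set.uIoc 0 t,
      ‖deriv (fun x => η (flow ξ (-r) x)) x‖ ≤ K * Real.exp (K * |t|) := by
    intro r hr
    have abs_r_le : |-r| ≤ |t| := by
      simpa using abs_sub_left_of_mem_uIcc (uIoc_subset_uIcc hr)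
    rw [(hasDerivAt_integrand r).deriv, norm_mul]
    refine mul_le_mul (hK' _) ((abs_flowDeriv_le hK _ _).trans ?_) (norm_nonneg _) K_nonneg
    gcongr
  have deriv_expo := (SmoothFamily.hasDerivAt_integral
    (SmoothFamily.comp_flow (F := fun _ => η) hη hξ hξ continuous_neg) t x).deriv
  calc |deriv (expo ξ η t) x| = |∫ r in (0 : ℝ)..t, deriv (fun x => η (flow ξ (-r) x)) x| :=
        congrArg abs deriv_expo
    _ ≤ K * Real.exp (K * |t|) * |t| := by
        simpa using intervalIntegral.norm_integral_le_of_norm_le_const abs_integrand_le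

theorem exp_expo_le {K : ℝ} (hK : ∀ x, |η x| ≤ K) (t x : ℝ) :
    Real.exp (expo ξ η t x) ≤ Real.exp (K * |t|) :=
  exp_integral_le (fun _ => hK _) t

theorem norm_weight_mul_le (hξ : Cb 1 ξ) (hη : Cb 1 η) {K : ℝ} (hK : ∀ x, |η x| ≤ K) (t : ℝ)
    (f : L2) : ‖(cb_weight hξ hη t).mul f‖ ≤ Real.exp (K * |t|) * ‖f‖ :=
  Cb.norm_mul_le _ (fun x => by
    rw [abs_of_pos (Real.exp_pos _)]
    exact exp_expo_le hK t x) f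

theorem norm_deriv_weight_mul_le (hξ : Cb 1 ξ) (hη : Cb 1 η) {K : ℝ} (hK : ∀ x, |deriv ξ x| ≤ K)
    (hK' : ∀ x, |η x| ≤ K) (hK'' : ∀ x, |deriv η x| ≤ K) (t : ℝ) (f : L2) :
    ‖(cb_weight hξ hη t).deriv.mul f‖ ≤
      Real.exp (K * |t|) * (K * Real.exp (K * |t|) * |t|) * ‖f‖ :=
  Cb.norm_mul_le _ (fun x => by
    rw [((smoothFamily_expo hξ hξ hη).hasDerivAt t x).exp.deriv, abs_mul,
      abs_of_pos (Real.exp_pos _)]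
    exact mul_le_mul (exp_expo_le hK' t x) (abs_deriv_expo_le hξ hη hK hK'' t x) (abs_nonneg _)
      (Real.exp_pos _).le) f

theorem norm_val_UH_le (hξ : Cb 1 ξ) (hη : Cb 1 η) {K : ℝ} (hK : ∀ x, |deriv ξ x| ≤ K)
    (hK' : ∀ x, |η x| ≤ K) (t : ℝ) (f : H1) :
    ‖val (UH hξ hη t f)‖ ≤ Real.exp (K * |t|) ^ 2 * ‖val f‖ := by
  have norm_comp_le := norm_compL_apply_le hξ hK (-t) (val f)
  rw [abs_neg] at norm_comp_le
  calc ‖val (UH hξ hη t f)‖ ≤ Real.exp (K * |t|) * ‖compL hξ (-t) (val f)‖ :=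
        norm_weight_mul_le hξ hη hK' t _
    _ ≤ Real.exp (K * |t|) * (Real.exp (K * |t|) * ‖val f‖) := by gcongr
    _ = Real.exp (K * |t|) ^ 2 * ‖val f‖ := by ring

theorem norm_der_UH_le (hξ : Cb 1 ξ) (hη : Cb 1 η) {K : ℝ} (hK : ∀ x, |deriv ξ x| ≤ K)
    (hK' : ∀ x, |η x| ≤ K) (hK'' : ∀ x, |deriv η x| ≤ K) (t : ℝ) (f : H1) :
    ‖der (UH hξ hη t f)‖ ≤ Real.exp (K * |t|) ^ 3 * (‖der f‖ + K * |t| * ‖val f‖) := by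
  have K_nonneg : 0 ≤ K := (abs_nonneg _).trans (hK 0)
  have norm_comp_le (g : L2) := norm_compL_apply_le hξ hK (-t) g
  have abs_flowDeriv_le := abs_flowDeriv_le hK (-t)
  rw [abs_neg] at norm_comp_le abs_flowDeriv_le
  set e := Real.exp (K * |t|)
  have e_pos : 0 < e := Real.exp_pos _
  calc ‖der (UH hξ hη t f)‖
      ≤ ‖(cb_weight hξ hη t).mul ((cb_flowDeriv hξ (-t)).mul (compL hξ (-t) (der f)))‖ +
        ‖(cb_weight hξ hη t).deriv.mul (compL hξ (-t) (val f))‖ := norm_add_le _ _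
    _ ≤ e * (e * ‖compL hξ (-t) (der f)‖) + e * (K * e * |t|) * ‖compL hξ (-t) (val f)‖ :=
        add_le_add ((norm_weight_mul_le hξ hη hK' t _).trans
          (mul_le_mul_of_nonneg_left (Cb.norm_mul_le _ abs_flowDeriv_le _) e_pos.le))
          (norm_deriv_weight_mul_le hξ hη hK hK' hK'' t _)
    _ ≤ e * (e * (e * ‖der f‖)) + e * (K * e * |t|) * (e * ‖val f‖) := by
        gcongr <;> exact norm_comp_le _
    _ = e ^ 3 * (‖der f‖ + K * |t| * ‖val f‖) := by ring

theorem H1.norm_le_of_norm_val_le_of_norm_der_le {f g : H1} {c k : ℝ} (hc : 0 ≤ c) (hk : 0 ≤ k)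
    (hval : ‖val g‖ ≤ c * ‖val f‖) (hder : ‖der g‖ ≤ c * (‖der f‖ + k * ‖val f‖)) :
    ‖g‖ ≤ c * (1 + k) * ‖f‖ := by
  refine (sq_le_sq₀ (norm_nonneg _) (by positivity)).1 ?_
  have quadratic_le : ‖val f‖ ^ 2 + (‖der f‖ + k * ‖val f‖) ^ 2 ≤
      (1 + k) ^ 2 * (‖val f‖ ^ 2 + ‖der f‖ ^ 2) := by
    nlinarith [mul_nonneg hk (sq_nonneg (‖val f‖ - ‖der f‖)), mul_nonneg hk (sq_nonneg ‖val f‖),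
      mul_nonneg hk (sq_nonneg ‖der f‖), mul_nonneg (mul_nonneg hk hk) (sq_nonneg ‖der f‖)]
  calc ‖g‖ ^ 2 = ‖val g‖ ^ 2 + ‖der g‖ ^ 2 := H1.norm_sq_eq g
    _ ≤ (c * ‖val f‖) ^ 2 + (c * (‖der f‖ + k * ‖val f‖)) ^ 2 := by gcongr
    _ = c ^ 2 * (‖val f‖ ^ 2 + (‖der f‖ + k * ‖val f‖) ^ 2) := by ring
    _ ≤ c ^ 2 * ((1 + k) ^ 2 * (‖val f‖ ^ 2 + ‖der f‖ ^ 2)) := by gcongr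
    _ = (c * (1 + k) * ‖f‖) ^ 2 := by rw [mul_pow _ ‖f‖, H1.norm_sq_eq, mul_pow, mul_assoc]

theorem norm_UH_apply_le (hξ : Cb 1 ξ) (hη : Cb 1 η) {K : ℝ} (hK : ∀ x, |deriv ξ x| ≤ K)
    (hK' : ∀ x, |η x| ≤ K) (hK'' : ∀ x, |deriv η x| ≤ K) (t : ℝ) (f : H1) :
    ‖UH hξ hη t f‖ ≤ Real.exp (4 * K * |t|) * ‖f‖ := by
  have K_nonneg : 0 ≤ K := (abs_nonneg _).trans (hK 0)
  have one_le_exp : 1 ≤ Real.exp (K * |t|) := Real.one_le_exp (by positivity)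
  have norm_val_le : ‖val (UH hξ hη t f)‖ ≤ Real.exp (K * |t|) ^ 3 * ‖val f‖ :=
    (norm_val_UH_le hξ hη hK hK' t f).trans (by gcongr; norm_num)
  calc ‖UH hξ hη t f‖ ≤ Real.exp (K * |t|) ^ 3 * (1 + K * |t|) * ‖f‖ :=
        H1.norm_le_of_norm_val_le_of_norm_der_le (by positivity) (by positivity) norm_val_le
          (norm_der_UH_le hξ hη hK hK' hK'' t f)
    _ ≤ Real.exp (K * |t|) ^ 3 * Real.exp (K * |t|) * ‖f‖ := by
        gcongr
        rw [add_comm]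
        exact Real.add_one_le_exp _
    _ = Real.exp (4 * K * |t|) * ‖f‖ := by
        rw [← pow_succ, ← Real.exp_nat_mul]
        push_cast
        ring_nf

end Group

/-! ### First order operators as generators -/

/-- Evaluation at a point as a functional on `H¹`; it commutes with Bochner integrals. -/
def evalL (x : ℝ) : H1 →L[ℝ] ℝ :=
  LinearMap.mkContinuous
    { toFun := fun f => rep f x
      map_add' := fun f g => by rw [rep_add]; rfl
      map_smul' := fun c f => by rw [rep_smul]; rfl } sobolevConst (fun f => abs_rep_le f x)

theorem tendsto_inv_smul_integral {E : Type*} [NormedAddCommGroup E] [NormedSpace ℝ E]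
    [CompleteSpace E] {g : ℝ → E} (hg : Continuous g) :
    Tendsto (fun h : ℝ => h⁻¹ • ∫ s in (0 : ℝ)..h, g s) (𝓝[>] 0) (𝓝 (g 0)) := by
  have hasDerivAt_integral : HasDerivAt (fun h => ∫ s in (0 : ℝ)..h, g s) (g 0) 0 :=
    intervalIntegral.integral_hasDerivAt_right (hg.intervalIntegrable _ _)
      hg.stronglyMeasurable.stronglyMeasurableAtFilter hg.continuousAt
  simpa using hasDerivAt_integral.tendsto_slope_zero_right

section Generator

variable {α β : H1}

theorem hasDerivAt_rep_UH_incl (hα : Cb 1 (rep α)) (hβ : Cb 1 fun x => -rep β x) (f : H2)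
    (x s : ℝ) : HasDerivAt (fun s => rep (UH hα hβ s (incl f)) x)
      (-rep (UH hα hβ s (opL α β f)) x) s := by
  have continuous_integrand : Continuous fun r => -rep β (flow (rep α) (-r) x) :=
    (Cb.continuous hβ).comp ((continuous_flow_time hα x).comp continuous_neg)
  have hasDerivAt_expo : HasDerivAt (fun s => expo (rep α) (fun x => -rep β x) s x)
      (-rep β (flow (rep α) (-s) x)) s :=
    intervalIntegral.integral_hasDerivAt_right (continuous_integrand.intervalIntegrable _ _)
      continuous_integrand.stronglyMeasurable.stronglyMeasurableAtFilter
      continuous_integrand.continuousAt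
  have hasDerivAt_flow_neg : HasDerivAt (fun s => flow (rep α) (-s) x)
      (-rep α (flow (rep α) (-s) x)) s := by
    have hasDerivAt_comp := (hasDerivAt_flow hα (-s) x).comp s (hasDerivAt_neg s)
    rwa [mul_neg_one] at hasDerivAt_comp
  have rep_UH_incl : (fun s => rep (UH hα hβ s (incl f)) x) = fun s =>
      Real.exp (expo (rep α) (fun x => -rep β x) s x) * rep (incl f) (flow (rep α) (-s) x) := by
    funext s
    rw [rep_UH, U_apply]
  rw [rep_UH_incl]
  convert! hasDerivAt_expo.exp.mul
    ((hasDerivAt_rep_incl f (flow (rep α) (-s) x)).comp s hasDerivAt_flow_neg) using 1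
  rw [rep_UH, U_apply, rep_opL]
  simp only [Function.comp]
  ring

theorem UH_incl_sub (hα : Cb 1 (rep α)) (hβ : Cb 1 fun x => -rep β x) (f : H2) (h : ℝ) :
    UH hα hβ h (incl f) - incl f = -∫ s in (0 : ℝ)..h, UH hα hβ s (opL α β f) := by
  have continuous_UH : Continuous fun s => UH hα hβ s (opL α β f) :=
    (stronglyContinuous_UH hα hβ).apply_const _
  apply H1.ext_rep
  funext x
  have rep_integral : rep (∫ s in (0 : ℝ)..h, UH hα hβ s (opL α β f)) x =
      ∫ s in (0 : ℝ)..h, rep (UH hα hβ s (opL α β f)) x :=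
    ((evalL x).intervalIntegral_comp_comm (continuous_UH.intervalIntegrable _ _)).symm
  have continuous_rep_UH : Continuous fun s => rep (UH hα hβ s (opL α β f)) x :=
    (evalL x).continuous.comp continuous_UH
  have integral_eq_sub := intervalIntegral.integral_eq_sub_of_hasDerivAt (a := 0) (b := h)
    (fun s _ => hasDerivAt_rep_UH_incl hα hβ f x s)
    (continuous_rep_UH.neg.intervalIntegrable _ _)
  rw [intervalIntegral.integral_neg] at integral_eq_sub
  rw [rep_sub, rep_neg, Pi.sub_apply, Pi.neg_apply, rep_integral, integral_eq_sub, UH_zero]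
  rfl

theorem val_integral_UH {ξ η : ℝ → ℝ} (hξ : Cb 1 ξ) (hη : Cb 1 η) (h : ℝ) (x : H1) :
    val (∫ s in (0 : ℝ)..h, UH hξ hη s x) = ∫ s in (0 : ℝ)..h, UL hξ hη s (val x) :=
  (val.intervalIntegral_comp_comm
    (((stronglyContinuous_UH hξ hη).apply_const x).intervalIntegrable _ _)).symm

theorem UL_val_sub (hα : Cb 1 (rep α)) (hβ : Cb 1 fun x => -rep β x) (h : ℝ) (x : H1) :
    UL hα hβ h (val x) - val x = -∫ s in (0 : ℝ)..h, UL hα hβ s (opLL2 α β x) := by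
  refine denseRange_incl.induction_on (p := fun x =>
    UL hα hβ h (val x) - val x = -∫ s in (0 : ℝ)..h, UL hα hβ s (opLL2 α β x)) x
    (isClosed_eq (by fun_prop) (Continuous.neg ?_)) fun f => ?_
  · exact intervalIntegral.continuous_parametric_intervalIntegral_of_continuous'
      (f := fun (x : H1) s => UL hα hβ s (opLL2 α β x))
      ((stronglyContinuous_UL hα hβ).apply continuous_snd
        ((opLL2 α β).continuous.comp continuous_fst)) _ _
  · have val_UH_incl_sub := congrArg val (UH_incl_sub hα hβ f h)
    rwa [map_sub, val_UH, map_neg, val_integral_UH, ← opLL2_incl] at val_UH_incl_sub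

theorem UH_sub_of_opLL2_eq (hα : Cb 1 (rep α)) (hβ : Cb 1 fun x => -rep β x) {x y : H1}
    (hxy : opLL2 α β x = val y) (h : ℝ) :
    UH hα hβ h x - x = -∫ s in (0 : ℝ)..h, UH hα hβ s y := by
  apply H1.ext_val
  rw [map_sub, val_UH, map_neg, UL_val_sub, hxy, val_integral_UH]

theorem tendsto_of_opLL2_eq (hα : Cb 1 (rep α)) (hβ : Cb 1 fun x => -rep β x) {x y : H1}
    (hxy : opLL2 α β x = val y) :
    Tendsto (fun h : ℝ => h⁻¹ • (UH hα hβ h x - x)) (𝓝[>] 0) (𝓝 (-y)) := by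
  have tendsto_mean := (tendsto_inv_smul_integral
    ((stronglyContinuous_UH hα hβ).apply_const y)).neg
  simp only [UH_zero] at tendsto_mean
  refine tendsto_mean.congr fun h => ?_
  rw [UH_sub_of_opLL2_eq hα hβ hxy, smul_neg]

/-- The graph of the operator `f ↦ α f' + β f` with domain `H²` in `H¹`. -/
def graphL (α β : H1) : Submodule ℝ (H1 × H1) := LinearMap.range (incl.prod (opL α β)).toLinearMap

theorem mem_graphL {p : H1 × H1} : p ∈ graphL α β ↔ ∃ f, (incl f, opL α β f) = p :=
  Iff.rfl

theorem opLL2_eq_of_mem_closure {x y : H1} (h : (x, y) ∈ (graphL α β).topologicalClosure) :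
    opLL2 α β x = val y := by
  rw [← SetLike.mem_coe, Submodule.topologicalClosure_coe] at h
  have isClosed_eq_val : IsClosed {p : H1 × H1 | opLL2 α β p.1 = val p.2} :=
    isClosed_eq ((opLL2 α β).continuous.comp continuous_fst) (val.continuous.comp continuous_snd)
  have graphL_subset : (graphL α β : Set (H1 × H1)) ⊆ {p | opLL2 α β p.1 = val p.2} := by
    rintro p hp
    obtain ⟨f, rfl⟩ := mem_graphL.1 hp
    exact opLL2_incl α β f
  simpa only [Set.mem_ofPred_eq] using closure_minimal graphL_subset isClosed_eq_val h

theorem opL_eq_UH_opL (hα : Cb 1 (rep α)) (hβ : Cb 1 fun x => -rep β x) {f g : H2} {s : ℝ}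
    (hfg : incl g = UH hα hβ s (incl f)) : opL α β g = UH hα hβ s (opL α β f) := by
  have tendsto_g := tendsto_of_opLL2_eq hα hβ (opLL2_incl α β g)
  have tendsto_UH_f := ((UH hα hβ s).continuous.tendsto _).comp
    (tendsto_of_opLL2_eq hα hβ (opLL2_incl α β f))
  have quotient_eq (h : ℝ) : h⁻¹ • (UH hα hβ h (incl g) - incl g) =
      (UH hα hβ s ∘ fun h : ℝ => h⁻¹ • (UH hα hβ h (incl f) - incl f)) h := by
    rw [hfg, Function.comp_apply, map_smul, map_sub, ← UH_add_apply, ← UH_add_apply, add_comm]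
  have neg_eq := tendsto_nhds_unique tendsto_g
    (tendsto_UH_f.congr fun h => (quotient_eq h).symm)
  rwa [map_neg, neg_inj] at neg_eq

theorem integral_UH_mem_closure_graphL (hα : Cb 2 (rep α)) (hβ : Cb 2 fun x => -rep β x) (h : ℝ)
    (x : H1) : (∫ s in (0 : ℝ)..h, UH hα.of_succ hβ.of_succ s x,
      x - UH hα.of_succ hβ.of_succ h x) ∈ (graphL α β).topologicalClosure := by
  set T := UH hα.of_succ hβ.of_succ
  obtain ⟨S, hS, hST⟩ := exists_UH2 hα.of_succ hβ.of_succ hα hβ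
  refine denseRange_incl.induction_on (p := fun x => (∫ s in (0 : ℝ)..h, T s x, x - T h x) ∈
    (graphL α β).topologicalClosure) x ?_ fun f => ?_
  · refine (Submodule.isClosed_topologicalClosure _).preimage (f := fun x : H1 =>
      (∫ s in (0 : ℝ)..h, T s x, x - T h x)) (Continuous.prodMk ?_ (by fun_prop))
    exact intervalIntegral.continuous_parametric_intervalIntegral_of_continuous'
      (f := fun (x : H1) s => T s x)
      ((stronglyContinuous_UH _ _).apply continuous_snd continuous_fst) _ _
  · have intervalIntegrable_S : IntervalIntegrable (fun s => S s f) volume 0 h :=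
      (hS.apply_const f).intervalIntegrable _ _
    have incl_integral : incl (∫ s in (0 : ℝ)..h, S s f) = ∫ s in (0 : ℝ)..h, T s (incl f) := by
      rw [← incl.intervalIntegral_comp_comm intervalIntegrable_S]
      simp only [hST, T]
    have opL_integral : opL α β (∫ s in (0 : ℝ)..h, S s f) = incl f - T h (incl f) := by
      rw [← (opL α β).intervalIntegral_comp_comm intervalIntegrable_S]
      simp only [fun s => opL_eq_UH_opL hα.of_succ hβ.of_succ (hST s f)]
      rw [← neg_sub, UH_incl_sub, neg_neg]
    refine Submodule.le_topologicalClosure _ (mem_graphL.2 ⟨∫ s in (0 : ℝ)..h, S s f, ?_⟩)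
    rw [incl_integral, opL_integral]

theorem mem_closure_graphL_of_tendsto (hα : Cb 2 (rep α)) (hβ : Cb 2 fun x => -rep β x) {x y : H1}
    (hxy : Tendsto (fun h : ℝ => h⁻¹ • (UH hα.of_succ hβ.of_succ h x - x)) (𝓝[>] 0) (𝓝 (-y))) :
    (x, y) ∈ (graphL α β).topologicalClosure := by
  set T := UH hα.of_succ hβ.of_succ
  have tendsto_mean := tendsto_inv_smul_integral
    ((stronglyContinuous_UH hα.of_succ hβ.of_succ).apply_const x)
  have tendsto_quotient := hxy.neg
  rw [UH_zero] at tendsto_mean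
  rw [neg_neg] at tendsto_quotient
  have tendsto_pair : Tendsto (fun h : ℝ => h⁻¹ • (∫ s in (0 : ℝ)..h, T s x, x - T h x)) (𝓝[>] 0)
      (𝓝 (x, y)) := by
    refine (tendsto_mean.prodMk_nhds tendsto_quotient).congr fun h => ?_
    rw [Prod.smul_mk, ← smul_neg, neg_sub]
  exact (Submodule.isClosed_topologicalClosure _).mem_of_tendsto tendsto_pair
    (Eventually.of_forall fun h => Submodule.smul_mem _ _
      (integral_UH_mem_closure_graphL hα hβ h x))

theorem mem_closure_graphL_iff (hα : Cb 2 (rep α)) (hβ : Cb 2 fun x => -rep β x) {x y : H1} :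
    (x, y) ∈ (graphL α β).topologicalClosure ↔ opLL2 α β x = val y :=
  ⟨opLL2_eq_of_mem_closure, fun hxy =>
    mem_closure_graphL_of_tendsto hα hβ (tendsto_of_opLL2_eq hα.of_succ hβ.of_succ hxy)⟩

theorem mem_closure_graphL_iff_tendsto (hα : Cb 2 (rep α)) (hβ : Cb 2 fun x => -rep β x)
    {x y : H1} : (x, y) ∈ (graphL α β).topologicalClosure ↔
      Tendsto (fun h : ℝ => h⁻¹ • (UH hα.of_succ hβ.of_succ h x - x)) (𝓝[>] 0) (𝓝 (-y)) :=
  ⟨fun hxy => tendsto_of_opLL2_eq hα.of_succ hβ.of_succ (opLL2_eq_of_mem_closure hxy),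
    mem_closure_graphL_of_tendsto hα hβ⟩

end Generator

/-! ### The coefficients of the conjugated operators -/

section SFam

variable {X : Type*} [NormedAddCommGroup X] [NormedSpace ℝ X]

theorem SobFamily.invQ2_succ_succ {k : ℕ} {W : ℝ → X →L[ℝ] H1} (hW : SobFamily k W)
    (hW' : SobFamily k fun t => StochCH.invQ2.comp (val.comp (W t))) :
    SobFamily (k + 2) (fun t => StochCH.invQ2.comp (val.comp (W t))) ∧
      SobFamily (k + 1) fun t => dxInvQ2.comp (val.comp (W t)) := by
  have sobFamily_dxInvQ2 : SobFamily (k + 1) fun t => dxInvQ2.comp (val.comp (W t)) :=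
    ⟨(StronglyContinuous.const _).comp ((StronglyContinuous.const _).comp hW.stronglyContinuous),
      fun t => StochCH.invQ2.comp (val.comp (W t)) + (-1 : ℝ) • W t,
      fun t v => by simp [der_dxInvQ2, sub_eq_add_neg], hW'.add (hW.const_smul (-1))⟩
  exact ⟨⟨hW'.stronglyContinuous, _, fun t v => der_invQ2 _, sobFamily_dxInvQ2⟩, sobFamily_dxInvQ2⟩

theorem SobFamily.invQ2 {k : ℕ} {W : ℝ → X →L[ℝ] H1} (hW : SobFamily k W) :
    SobFamily (k + 2) (fun t => StochCH.invQ2.comp (val.comp (W t))) ∧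
      SobFamily (k + 1) fun t => dxInvQ2.comp (val.comp (W t)) := by
  induction k with
  | zero =>
    exact invQ2_succ_succ (k := 0) hW
      ((StronglyContinuous.const _).comp ((StronglyContinuous.const _).comp hW))
  | succ k ih => exact hW.invQ2_succ_succ (ih hW.of_succ).1.of_succ

theorem SobFamily.exists_H3 {T : ℝ → X →L[ℝ] H1} (hT : SobFamily 2 T) :
    ∃ (S : ℝ → X →L[ℝ] H2) (G : ℝ → X →L[ℝ] H1), StronglyContinuous S ∧ StronglyContinuous G ∧
      (∀ t v, incl (S t v) = T t v) ∧ ∀ t v, der (dx (S t v)) = val (G t v) := by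
  obtain ⟨S, stronglyContinuous_S, incl_S⟩ := hT.of_succ.exists_H2
  obtain ⟨-, T', der_T, -, G, der_T', stronglyContinuous_G⟩ := hT
  refine ⟨S, G, stronglyContinuous_S, stronglyContinuous_G, incl_S, fun t v => ?_⟩
  have dx_S : dx (S t v) = T' t v := H1.ext_val (by rw [← der_T, ← incl_S, der_incl])
  rw [dx_S, der_T']

end SFam

theorem Cb.cb_one {k : ℕ} {f : ℝ → ℝ} (h : Cb (k + 1) f) : Cb 1 f := h.mono (Nat.le_add_left 1 k)

section Coefficients

variable {ξ η : ℝ → ℝ} (hξ : Cb 4 ξ) (hη : Cb 3 η)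

/-- `a = Q⁻² U_t⁻¹ v`, the coefficient of `∂ₓ` in `A(U_t⁻¹ v)`. -/
def invQ2U (t : ℝ) : H1 →L[ℝ] H1 := invQ2.comp (val.comp (UH hξ.cb_one hη.cb_one (-t)))

/-- `a' = ∂ₓ Q⁻² U_t⁻¹ v`, half of the coefficient of order zero in `A(U_t⁻¹ v)`. -/
def dxInvQ2U (t : ℝ) : H1 →L[ℝ] H1 := dxInvQ2.comp (val.comp (UH hξ.cb_one hη.cb_one (-t)))

theorem smoothFamily_deriv_expo_neg (hξ : Cb 4 ξ) (hη : Cb 3 η) :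
    SmoothFamily 2 fun t => deriv (expo ξ η (-t)) :=
  (smoothFamily_expo hξ.cb_one hξ.of_succ hη).2.2.reparam continuous_neg

/-- The coefficient of `∂ₓ` in `U_t A(U_t⁻¹ v) U_t⁻¹`. -/
def coefA (t : ℝ) : H1 →L[ℝ] H1 := (compOp hξ.cb_one (-t)).comp
  ((mulOp ((smoothFamily_flowDeriv hξ).freeze t).cb_one).comp (invQ2U hξ hη t))

/-- The coefficient of order zero in `U_t A(U_t⁻¹ v) U_t⁻¹`. -/
def coefB (t : ℝ) : H1 →L[ℝ] H1 := (compOp hξ.cb_one (-t)).comp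
  ((2 : ℝ) • dxInvQ2U hξ hη t +
    (mulOp (((smoothFamily_deriv_expo_neg hξ hη).freeze t).of_succ)).comp (invQ2U hξ hη t))

theorem rep_coefA (t : ℝ) (v : H1) (x : ℝ) : rep (coefA hξ hη t v) x =
    flowDeriv ξ t (flow ξ (-t) x) * rep (invQ2U hξ hη t v) (flow ξ (-t) x) := by
  rw [coefA, ContinuousLinearMap.comp_apply, rep_compOp, ContinuousLinearMap.comp_apply, rep_mulOp]

theorem rep_coefB (t : ℝ) (v : H1) (x : ℝ) : rep (coefB hξ hη t v) x =
    2 * rep (dxInvQ2U hξ hη t v) (flow ξ (-t) x) +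
      deriv (expo ξ η (-t)) (flow ξ (-t) x) * rep (invQ2U hξ hη t v) (flow ξ (-t) x) := by
  rw [coefB, ContinuousLinearMap.comp_apply, rep_compOp, add_apply, smul_apply, rep_add, rep_smul,
    ContinuousLinearMap.comp_apply, rep_mulOp]
  rfl

theorem sobFamily_UH_neg : SobFamily 0 fun t => UH hξ.cb_one hη.cb_one (-t) :=
  (stronglyContinuous_UH hξ.cb_one hη.cb_one).reparam continuous_neg

theorem sobFamily_coefA : SobFamily 2 (coefA hξ hη) :=
  SobFamily.comp_flow hξ.cb_one continuous_neg hξ.of_succ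
    (SobFamily.mul (smoothFamily_flowDeriv hξ) (sobFamily_UH_neg hξ hη).invQ2.1)

theorem sobFamily_coefB : SobFamily 1 (coefB hξ hη) :=
  SobFamily.comp_flow hξ.cb_one continuous_neg hξ.of_succ.of_succ
    (((sobFamily_UH_neg hξ hη).invQ2.2.const_smul 2).add
      (SobFamily.mul (smoothFamily_deriv_expo_neg hξ hη) (sobFamily_UH_neg hξ hη).invQ2.1.of_succ))

theorem cb_coefA (t : ℝ) (v : H1) : Cb 2 (rep (coefA hξ hη t v)) :=
  (sobFamily_coefA hξ hη).cb t v

theorem cb_coefB (t : ℝ) (v : H2) : Cb 2 (rep (coefB hξ hη t (incl v))) := by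
  have sobFamily_UH_incl : SobFamily 1 fun t => (UH hξ.cb_one hη.cb_one (-t)).comp incl :=
    sobFamily_incl.UH hξ.cb_one hη.cb_one hξ.of_succ.of_succ hη.of_succ continuous_neg
  have cb_invQ2U : Cb 2 (rep (invQ2U hξ hη t (incl v))) :=
    (sobFamily_UH_incl.invQ2.1.cb t v).of_succ
  have cb_dxInvQ2U : Cb 2 (rep (dxInvQ2U hξ hη t (incl v))) := sobFamily_UH_incl.invQ2.2.cb t v
  rw [funext (rep_coefB hξ hη t (incl v))]
  exact SmoothFamily.comp_flow (F := fun _ y => 2 * rep (dxInvQ2U hξ hη t (incl v)) y +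
      deriv (expo ξ η (-t)) y * rep (invQ2U hξ hη t (incl v)) y)
    ((SmoothFamily.const_mul 2 cb_dxInvQ2U).add
      (SmoothFamily.mul ((smoothFamily_deriv_expo_neg hξ hη).freeze t) cb_invQ2U))
    hξ.cb_one hξ.of_succ.of_succ (r := fun _ => -t) continuous_const

theorem rep_dx_of_incl_eq_UH {t : ℝ} {f g : H2}
    (hfg : incl f = UH hξ.cb_one hη.cb_one (-t) (incl g)) (y : ℝ) :
    rep (dx f) y = Real.exp (expo ξ η (-t) y) * (deriv (expo ξ η (-t)) y *
      rep (incl g) (flow ξ t y) + rep (dx g) (flow ξ t y) * flowDeriv ξ t y) := by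
  have rep_f : rep (incl f) = fun y => Real.exp (expo ξ η (-t) y) * rep (incl g) (flow ξ t y) := by
    funext y
    rw [hfg, rep_UH, U_apply, neg_neg]
  have hasDerivAt_f := hasDerivAt_rep_incl f y
  rw [rep_f] at hasDerivAt_f
  rw [hasDerivAt_f.unique
    (((smoothFamily_expo hξ.cb_one hξ.cb_one hη.cb_one).hasDerivAt (-t) y).exp.mul
      ((hasDerivAt_rep_incl g (flow ξ t y)).comp y (hasDerivAt_flow_space hξ.cb_one t y)))]
  ring

theorem rep_opL_conj (t : ℝ) (v f g : H2)
    (hfg : incl f = UH hξ.cb_one hη.cb_one (-t) (incl g)) :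
    rep (opL (coefA hξ hη t (incl v)) (coefB hξ hη t (incl v)) g) =
      U ξ η t (opA (U ξ η (-t) (rep (incl v))) f) := by
  have U_ae_eq_val : U ξ η (-t) (rep (incl v)) =ᵐ[volume]
      val (UH hξ.cb_one hη.cb_one (-t) (incl v)) := by
    rw [← rep_UH hξ.cb_one hη.cb_one]
    exact rep_ae_eq_val _
  have invQsq_eq : invQsq (U ξ η (-t) (rep (incl v))) = rep (invQ2U hξ hη t (incl v)) :=
    invQsq_eq_rep U_ae_eq_val
  have deriv_invQsq_eq : deriv (invQsq (U ξ η (-t) (rep (incl v)))) =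
      rep (dxInvQ2U hξ hη t (incl v)) := deriv_invQsq_eq_rep U_ae_eq_val
  funext x
  have exp_mul_exp_neg :
      Real.exp (expo ξ η t x) * Real.exp (expo ξ η (-t) (flow ξ (-t) x)) = 1 := by
    rw [← Real.exp_add, expo_neg hξ.cb_one hη.cb_one, Real.exp_zero]
  simp only [rep_opL]
  rw [rep_coefA, rep_coefB, U_apply, opA, deriv_invQsq_eq, invQsq_eq,
    rep_dx_of_incl_eq_UH hξ hη hfg, hfg, rep_UH, U_apply, neg_neg]
  simp only [flow_flow_neg hξ.cb_one]
  set y := flow ξ (-t) x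
  linear_combination (-(rep (invQ2U hξ hη t (incl v)) y *
    (deriv (expo ξ η (-t)) y * rep (incl g) x + rep (dx g) x * flowDeriv ξ t y) +
    2 * rep (dxInvQ2U hξ hη t (incl v)) y * rep (incl g) x)) * exp_mul_exp_neg

theorem conjGraph_eq (t : ℝ) (v : H2) : conjGraph ξ η t v =
    graphL (coefA hξ hη t (incl v)) (coefB hξ hη t (incl v)) := by
  obtain ⟨S, -, incl_S⟩ := exists_UH2 hξ.cb_one hη.cb_one hξ.of_succ.of_succ hη.of_succ
  ext ⟨x, y⟩
  rw [mem_graphL]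
  constructor
  · rintro ⟨f, rep_f, rep_y⟩
    have incl_S_eq : incl (S t f) = x := by
      rw [← rep_UH hξ.cb_one hη.cb_one] at rep_f
      rw [incl_S, H1.ext_rep rep_f, UH_apply_neg]
    refine ⟨S t f, Prod.ext incl_S_eq (H1.ext_rep ?_)⟩
    rw [rep_opL_conj hξ hη t v f (S t f) (by rw [incl_S, UH_neg_apply])]
    exact rep_y.symm
  · rintro ⟨g, hg⟩
    obtain ⟨rfl, rfl⟩ := Prod.mk.inj hg
    refine ⟨S (-t) g, ?_, ?_⟩
    · rw [incl_S, rep_UH]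
    · exact rep_opL_conj hξ hη t v _ g (incl_S (-t) g)

theorem graph_hatA (t : ℝ) (v : H2) : (hatA ξ η t v).graph =
    (graphL (coefA hξ hη t (incl v)) (coefB hξ hη t (incl v))).topologicalClosure := by
  have graph_eq : (conjGraph ξ η t v).toLinearPMap.graph =
      graphL (coefA hξ hη t (incl v)) (coefB hξ hη t (incl v)) := by
    rw [Submodule.toLinearPMap_graph_eq _ (conjGraph_single_valued ξ η t v), conjGraph_eq hξ hη]
  have isClosable : (conjGraph ξ η t v).toLinearPMap.IsClosable := by
    refine ⟨((graphL (coefA hξ hη t (incl v))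
      (coefB hξ hη t (incl v))).topologicalClosure).toLinearPMap, ?_⟩
    rw [graph_eq, Submodule.toLinearPMap_graph_eq]
    rintro ⟨x, y⟩ mem_closure (rfl : x = 0)
    have val_eq := opLL2_eq_of_mem_closure mem_closure
    rw [map_zero] at val_eq
    exact H1.ext_val (by rw [← val_eq, map_zero])
  rw [hatA, ← isClosable.graph_closure_eq_closure_graph, graph_eq]

theorem cb_neg_coefB (t : ℝ) (v : H2) : Cb 2 fun x => -rep (coefB hξ hη t (incl v)) x :=
  SmoothFamily.neg (cb_coefB hξ hη t v)

theorem mem_graph_hatA_iff (t : ℝ) (v : H2) (x y : H1) : (x, y) ∈ (hatA ξ η t v).graph ↔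
    opLL2 (coefA hξ hη t (incl v)) (coefB hξ hη t (incl v)) x = val y := by
  rw [graph_hatA hξ hη]
  exact mem_closure_graphL_iff (cb_coefA hξ hη t _) (cb_neg_coefB hξ hη t v)

theorem incl_mem_graph_hatA (t : ℝ) (v u : H2) :
    (incl u, opL (coefA hξ hη t (incl v)) (coefB hξ hη t (incl v)) u) ∈ (hatA ξ η t v).graph :=
  (mem_graph_hatA_iff hξ hη t v _ _).2 (opLL2_incl _ _ u)

theorem incl_mem_domain_hatA (hξ : Cb 4 ξ) (hη : Cb 3 η) (t : ℝ) (v u : H2) :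
    incl u ∈ (hatA ξ η t v).domain :=
  LinearPMap.mem_domain_of_mem_graph (incl_mem_graph_hatA hξ hη t v u)

theorem hatA_apply (t : ℝ) (v u : H2) (h : incl u ∈ (hatA ξ η t v).domain) :
    hatA ξ η t v ⟨incl u, h⟩ = opL (coefA hξ hη t (incl v)) (coefB hξ hη t (incl v)) u :=
  (hatA ξ η t v).mem_graph_snd_inj ((hatA ξ η t v).mem_graph ⟨incl u, h⟩)
    (incl_mem_graph_hatA hξ hη t v u) rfl

theorem mem_graph_neg_iff {E F : Type*} [AddCommGroup E] [Module ℝ E] [AddCommGroup F] [Module ℝ F]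
    {f : E →ₗ.[ℝ] F} {x : E} {y : F} : (x, y) ∈ (-f).graph ↔ (x, -y) ∈ f.graph := by
  simp [LinearPMap.mem_graph_iff, neg_eq_iff_eq_neg]

theorem isGenerator_neg_hatA (t : ℝ) (v : H2) : IsGenerator (-(hatA ξ η t v))
    (UH (cb_coefA hξ hη t (incl v)).of_succ (cb_neg_coefB hξ hη t v).of_succ) := by
  intro x y
  rw [mem_graph_neg_iff, graph_hatA hξ hη, mem_closure_graphL_iff_tendsto
    (cb_coefA hξ hη t (incl v)) (cb_neg_coefB hξ hη t v), neg_neg]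

end Coefficients

/-! ### Kato's condition -/

theorem isC0Semigroup_UH {ξ η : ℝ → ℝ} (hξ : Cb 1 ξ) (hη : Cb 1 η) : IsC0Semigroup (UH hξ hη) :=
  ⟨UH_zero hξ hη, fun s t _ _ => UH_add hξ hη s t,
    fun x => ((stronglyContinuous_UH hξ hη).apply_const x).continuousOn⟩

theorem norm_UH_incl_le {α β : H1} (hα : Cb 1 (rep α)) (hβ : Cb 1 fun x => -rep β x) {α' β' : H2}
    (incl_α' : incl α' = α) (incl_β' : incl β' = β) {K : ℝ} (norm_α'_le : ‖α'‖ ≤ K)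
    (norm_β'_le : ‖β'‖ ≤ K) (t : ℝ) :
    ‖UH hα hβ t‖ ≤ Real.exp (4 * (sobolevConst * K) * |t|) := by
  subst incl_α' incl_β'
  have abs_rep_le_of_norm_le {f : H1} (norm_f_le : ‖f‖ ≤ K) (x : ℝ) :
      |rep f x| ≤ sobolevConst * K :=
    (abs_rep_le f x).trans (mul_le_mul_of_nonneg_left norm_f_le sobolevConst_nonneg)
  refine ContinuousLinearMap.opNorm_le_bound _ (Real.exp_pos _).le fun f =>
    norm_UH_apply_le _ _ (fun x => ?_) (fun x => ?_) (fun x => ?_) t f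
  · rw [deriv_rep_incl]
    exact abs_rep_le_of_norm_le ((norm_dx_le α').trans norm_α'_le) x
  · rw [abs_neg]
    exact abs_rep_le_of_norm_le ((norm_incl_le β').trans norm_β'_le) x
  · have deriv_neg_rep : deriv (fun x => -rep (incl β') x) x = -rep (dx β') x :=
      (hasDerivAt_rep_incl β' x).neg.deriv
    rw [deriv_neg_rep, abs_neg]
    exact abs_rep_le_of_norm_le ((norm_dx_le β').trans norm_β'_le) x

theorem continuous_opB {α β : ℝ → H2} {γ : ℝ → H1} (hα : Continuous α) (hβ : Continuous β)
    (hγ : Continuous γ) (der_dx_α : ∀ t, der (dx (α t)) = val (γ t)) :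
    Continuous fun t => opB (α t) (β t) := by
  refine continuous_iff_continuousAt.2 fun s => ?_
  rw [ContinuousAt, tendsto_iff_norm_sub_tendsto_zero]
  refine squeeze_zero (fun _ => norm_nonneg _)
    (fun t => norm_opB_sub_le (der_dx_α t) (der_dx_α s) _ _) ?_
  have continuous_bound : Continuous fun t =>
      2 * sobolevConst * ‖incl (α t - α s) - (γ t - γ s)‖ * ‖dx.comp invQH1‖ +
        ‖QH2‖ * (‖mulH2‖ * ‖β t - β s‖ * ‖invQH1‖) + ‖mulH1‖ * ‖β t - β s‖ := by fun_prop
  simpa using continuous_bound.tendsto s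

theorem exists_norm_opB_le {X : Type*} [NormedAddCommGroup X] [NormedSpace ℝ X]
    {α β : ℝ → X →L[ℝ] H2} {γ : ℝ → X →L[ℝ] H1} (hα : LocallyBounded α) (hβ : LocallyBounded β)
    (hγ : LocallyBounded γ) (der_dx_α : ∀ t v, der (dx (α t v)) = val (γ t v)) (τ R : ℝ) :
    ∃ l : ℝ, ∀ t ∈ Icc (-τ) τ, ∀ v : X, ‖v‖ ≤ R → ‖opB (α t v) (β t v)‖ ≤ l := by
  obtain ⟨C, C_nonneg, norm_α_le⟩ := hα τ
  obtain ⟨D, D_nonneg, norm_β_le⟩ := hβ τ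
  obtain ⟨M, M_nonneg, norm_γ_le⟩ := hγ τ
  refine ⟨2 * sobolevConst * (C * R + M * R) * ‖dx.comp invQH1‖ +
    ‖QH2‖ * (‖mulH2‖ * (D * R) * ‖invQH1‖) + ‖mulH1‖ * (D * R), fun t ht v norm_v_le => ?_⟩
  have norm_β_le' : ‖β t v‖ ≤ D * R := (norm_β_le t (abs_le.2 ht) v).trans (by gcongr)
  have norm_sub_le' : ‖incl (α t v) - γ t v‖ ≤ C * R + M * R :=
    norm_sub_le_of_le
      ((norm_incl_le _).trans ((norm_α_le t (abs_le.2 ht) v).trans (by gcongr)))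
      ((norm_γ_le t (abs_le.2 ht) v).trans (by gcongr))
  have const_nonneg := sobolevConst_nonneg
  exact (norm_opB_le (der_dx_α t v) _).trans (by gcongr)

theorem opL_sub_opL (α α' β β' : H1) (u : H2) :
    opL α β u - opL α' β' u = opL (α - α') (β - β') u := by
  simp only [opL_apply, map_sub, sub_apply]
  abel

section Kato

variable {ξ η : ℝ → ℝ}

theorem exists_isGenerator_neg_hatA (hξ : Cb 4 ξ) (hη : Cb 3 η) (τ R : ℝ) :
    ∃ κ : ℝ, ∀ t ∈ Icc (-τ) τ, ∀ v : H2, ∃ T : ℝ → H1 →L[ℝ] H1,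
      IsC0Semigroup T ∧ IsGenerator (-(hatA ξ η t v)) T ∧
      (‖v‖ ≤ R → ∀ s, 0 ≤ s → ‖T s‖ ≤ Real.exp (κ * s)) := by
  obtain ⟨SA, stronglyContinuous_SA, incl_SA⟩ := (sobFamily_coefA hξ hη).of_succ.exists_H2
  obtain ⟨SB, stronglyContinuous_SB, incl_SB⟩ := (sobFamily_coefB hξ hη).exists_H2
  obtain ⟨C, C_nonneg, norm_SA_le⟩ := stronglyContinuous_SA.2 τ
  obtain ⟨D, D_nonneg, norm_SB_le⟩ := stronglyContinuous_SB.2 τ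
  refine ⟨4 * (sobolevConst * ((C + D) * R)), fun t ht v =>
    ⟨_, isC0Semigroup_UH _ _, isGenerator_neg_hatA hξ hη t v, fun norm_v_le s hs => ?_⟩⟩
  have norm_incl_v_le : ‖incl v‖ ≤ R := (norm_incl_le v).trans norm_v_le
  have norm_le := norm_UH_incl_le (cb_coefA hξ hη t (incl v)).of_succ
    (cb_neg_coefB hξ hη t v).of_succ (incl_SA t (incl v)) (incl_SB t (incl v))
    (K := (C + D) * R) ((norm_SA_le t (abs_le.2 ht) _).trans (by gcongr; linarith))
    ((norm_SB_le t (abs_le.2 ht) _).trans (by gcongr; linarith)) s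
  rwa [abs_of_nonneg hs] at norm_le

theorem exists_commutator_hatA (hξ : Cb 4 ξ) (hη : Cb 3 η) (τ R : ℝ) :
    ∃ B : ℝ → H2 → (H1 →L[ℝ] H1),
    (∀ t ∈ Icc (-τ) τ, ∀ v : H2, ∀ x z : H1,
      (∃ y : H2, (incl (QE.symm x), incl y) ∈ (hatA ξ η t v).graph ∧ QE y = z) ↔
        (x, z - B t v x) ∈ (hatA ξ η t v).graph) ∧
    (∀ v : H2, StronglyMeasurable (fun t : Icc (-τ) τ => B t v)) ∧
    ∃ l : ℝ, ∀ t ∈ Icc (-τ) τ, ∀ v : H2, ‖v‖ ≤ R → ‖B t v‖ ≤ l := by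
  obtain ⟨SA, G, stronglyContinuous_SA, stronglyContinuous_G, incl_SA, der_dx_SA⟩ :=
    (sobFamily_coefA hξ hη).exists_H3
  obtain ⟨SB, stronglyContinuous_SB, incl_SB⟩ := (sobFamily_coefB hξ hη).exists_H2
  refine ⟨fun t v => opB (SA t (incl v)) (SB t (incl v)), fun t _ v x z => ?_, fun v => ?_, ?_⟩
  · simp only [mem_graph_hatA_iff hξ hη]
    rw [← incl_SA, ← incl_SB]
    exact exists_opLL2_invQH1_eq_iff (der_dx_SA t (incl v)) (SB t (incl v)) x z
  · exact ((continuous_opB (stronglyContinuous_SA.apply_const _)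
      (stronglyContinuous_SB.apply_const _) (stronglyContinuous_G.apply_const _)
      fun t => der_dx_SA t (incl v)).comp continuous_subtype_val).stronglyMeasurable
  · obtain ⟨l, norm_opB_le⟩ := exists_norm_opB_le stronglyContinuous_SA.2 stronglyContinuous_SB.2
      stronglyContinuous_G.2 der_dx_SA τ R
    exact ⟨l, fun t ht v norm_v_le =>
      norm_opB_le t ht (incl v) ((norm_incl_le v).trans norm_v_le)⟩

theorem continuous_opL_coef (hξ : Cb 4 ξ) (hη : Cb 3 η) (v : H2) :
    Continuous fun t => opL (coefA hξ hη t (incl v)) (coefB hξ hη t (incl v)) :=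
  ((mulH1.continuous.comp ((sobFamily_coefA hξ hη).stronglyContinuous.apply_const _)).clm_comp
    continuous_const).add
    ((mulH1.continuous.comp ((sobFamily_coefB hξ hη).stronglyContinuous.apply_const _)).clm_comp
      continuous_const)

theorem exists_norm_opL_coef_sub_le (hξ : Cb 4 ξ) (hη : Cb 3 η) (τ : ℝ) :
    ∃ μ : ℝ, ∀ t ∈ Icc (-τ) τ, ∀ v₁ v₂ u : H2,
    ‖opL (coefA hξ hη t (incl v₁)) (coefB hξ hη t (incl v₁)) u -
      opL (coefA hξ hη t (incl v₂)) (coefB hξ hη t (incl v₂)) u‖ ≤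
      μ * ‖incl (v₁ - v₂)‖ * ‖u‖ := by
  obtain ⟨C, -, norm_coefA_le⟩ := (sobFamily_coefA hξ hη).stronglyContinuous.2 τ
  obtain ⟨D, -, norm_coefB_le⟩ := (sobFamily_coefB hξ hη).stronglyContinuous.2 τ
  refine ⟨‖mulH1‖ * (C + D), fun t ht v₁ v₂ u => ?_⟩
  rw [opL_sub_opL, ← map_sub, ← map_sub, ← map_sub]
  refine (norm_opL_apply_le _ _ _).trans ?_
  rw [mul_assoc ‖mulH1‖ (C + D), add_mul]
  gcongr
  exacts [norm_coefA_le t (abs_le.2 ht) _, norm_coefB_le t (abs_le.2 ht) _]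

theorem katoCondition_hatA (hξ : Cb 4 ξ) (hη : Cb 3 η) (τ R : ℝ) :
    KatoCondition incl QE (Icc (-τ) τ) R (hatA ξ η) where
  embedding := incl_injective
  dense := denseRange_incl
  domain t _ v y := incl_mem_domain_hatA hξ hη t v y
  quasi_accretive := exists_isGenerator_neg_hatA hξ hη τ R
  commutator := exists_commutator_hatA hξ hη τ R
  continuity v := ⟨_, fun t _ y => incl_mem_graph_hatA hξ hη t v y,
    (continuous_opL_coef hξ hη v).continuousOn⟩
  lipschitz := by
    obtain ⟨μ, norm_sub_le⟩ := exists_norm_opL_coef_sub_le hξ hη τ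
    refine ⟨μ, fun t ht v₁ v₂ u _ _ => ?_⟩
    rw [hatA_apply hξ hη, hatA_apply hξ hη]
    exact norm_sub_le t ht v₁ v₂ u

end Kato

end StochCH

end

theorem mainTheorem4 (ξ η : ℝ → ℝ) (hξ : StochCH.MemCb 4 ξ) (hη : StochCH.MemCb 3 η)
    (τ R : ℝ) (hτ : 0 < τ) (hR : 0 < R) :
    ∃ Q : StochCH.H2 ≃L[ℝ] StochCH.H1,
      (∀ f : StochCH.H2,
        StochCH.IsQ (StochCH.rep (StochCH.incl f)) (StochCH.rep (Q f))) ∧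
      StochCH.KatoCondition StochCH.incl Q (Set.Icc (-τ) τ) R (StochCH.hatA ξ η) := by
  exact ⟨StochCH.QE, StochCH.isQ_QE, StochCH.katoCondition_hatA hξ.cb hη.cb τ R⟩
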